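/- Let $T>0$, let $L_2=L_2([0,1],\mathrm{Leb})$ with inner product $(\cdot,\cdot)$, and let $y=\{y(u,t),\,u\in[0,1],\,t\in[0,T]\}$ be a random element of the Skorokhod space $D([0,1],C[0,T])$ on a probability space. Put $\mathcal F_t=\sigma(y(u,s),\,u\in[0,1],\,s\le t)$ and suppose that: (C1) for every $u\in[0,1]$, $y(u,\cdot)$ is a continuous square integrable $(\mathcal F_t)$-martingale; (C2) $y(u,0)=u$ for every $u\in[0,1]$; (C3) $y(u,t)\le y(v,t)$ for all $u<v$ in $[0,1]$ and $t\in[0,T]$; (C4) for all $u,v\in[0,1]$, $[y(u,\cdot),y(v,\cdot)]_t=\int_0^t \frac{\mathbf 1_{\{\tau_{u,v}\le s\}}}{m(u,s)}\,ds$, where $m(u,t)=\mathrm{Leb}\{v:\exists s\le t,\ y(v,s)=y(u,s)\}$ and $\tau_{u,v}=\inf\{t: y(u,t)=y(v,t)\}\wedge T$ (with $1/0=\infty$, so that in particular the integral is almost surely finite). Write $y(t)=y(\cdot,t)\in L_2$, and for $a,b\in L_2$ let $\mathrm{pr}_b a$ be the orthogonal projection in $L_2$ of $a$ onto the subspace of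 $\sigma(b)$-measurable functions. "Predictable" refers to $(\mathcal F_t)$, and continuity of paths is understood almost surely. Let $\mathcal A^2$ be the space of predictable $L_2$-valued processes $f$ on $[0,T]$ with $\|f\|_{\mathcal A^2}^2=E\int_0^T\|f(t)\|_{L_2}^2dt<\infty$, and $\mathcal A$ the space of those with $\int_0^T\|f(t)\|_{L_2}^2dt<\infty$ a.s. The simple processes are $f=\varphi_0\mathbf 1_{\{0\}}+\sum_{k=0}^{n-1}\varphi_k\mathbf 1_{(t_k,t_{k+1}]}$ with $0=t_0<\dots<t_n=T$ and $\mathcal F_{t_k}$-measurable $L_2$-valued $\varphi_k$, $E\|\varphi_k\|_{L_2}^2<\infty$; for them put $I_t(f)=\sum_{k=0}^{n-1}(\varphi_k,\,y(t_{k+1}\wedge t)-y(t_k\wedge t))$. Let $\mathcal M_2$ be the space of continuous square integrable $(\mathcal F_t)$-martingales $M$ on $[0,T]$ with $\|M\|_{\mathcal M_2}^2=E\,M(T)^2$. Then the following hold. (1) Every simple $f$ belongs to $\mathcal A^2$, and $I(f)$ is a continuous square integrable $(\mathcal F_t)$-martingale with quadratic variation $$[I(f)]_t=\int_0^t\|\mathrm{pr}_{y(s)}f(s)\|_{L_2}^2\,ds,\qquad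 t\in[0,T].$$ (2) For every $f\in\mathcal A^2$ the stochastic integral $\int_0^\cdot(f(s),dy(s))\in\mathcal M_2$, that is, the limit in $\mathcal M_2$ of $I(f_n)$ for simple $f_n\to f$ in $\mathcal A^2$, exists, is unique up to indistinguishability, and satisfies $$\Big[\int_0^\cdot(f(s),dy(s))\Big]_t=\int_0^t\|\mathrm{pr}_{y(s)}f(s)\|_{L_2}^2\,ds,\qquad t\in[0,T].$$ (3) For every $f\in\mathcal A$ the stochastic integral $\int_0^\cdot(f(s),dy(s))$ exists and is unique up to indistinguishability, where an adapted process $M$ is called the integral of $f$ if there is a localizing sequence of stopping times $\tau_n$ such that $f\mathbf 1_{[0,\tau_n]}\in\mathcal A^2$ and $M(\cdot\wedge\tau_n)=\int_0^\cdot(f(s)\mathbf 1_{\{s\le\tau_n\}},dy(s))$ for all $n$. It is a continuous local square integrable $(\mathcal F_t)$-martingale, $\int_0^T\|\mathrm{pr}_{y(s)}f(s)\|_{L_2}^2ds<\infty$ a.s., and its quadratic variation is $\int_0^t\|\mathrm{pr}_{y(s)}f(s)\|_{L_2}^2\,ds$. (4) In particular, $y$ is a weak (martingale) solution in $L_2$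 of $dy=\mathrm{pr}_{y}\,dW$, $y(0)=\mathrm{id}$, with $W$ space-time white noise; that is, $t\mapsto y(t)$ is a continuous adapted $L_2$-valued process with $y(0)=\mathrm{id}$ and, for every $g\in L_2$, $(g,y(t))$ is a continuous square integrable $(\mathcal F_t)$-martingale with quadratic variation $\int_0^t\|\mathrm{pr}_{y(s)}^*g\|_{L_2}^2\,ds=\int_0^t\|\mathrm{pr}_{y(s)}g\|_{L_2}^2\,ds$. -/

import Mathlib

open MeasureTheory ProbabilityTheory Filter Topology Set
open scoped NNReal ENNReal

/-- The time interval `[0, T]`; its least element is `⊥ = 0`, its greatest element is `⊤ = T`. -/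
abbrev TimeInterval (T : ℝ≥0) : Type := Set.Icc (0 : ℝ) T

instance fact_zero_le_coe (T : ℝ≥0) : Fact ((0 : ℝ) ≤ T) := ⟨T.2⟩

/-- Lebesgue measure on `[0, T]`. -/
noncomputable def timeLeb (T : ℝ≥0) : Measure (TimeInterval T) :=
  Measure.comap Subtype.val (volume : Measure ℝ)

/-- The real Hilbert space `L₂` of square integrable functions on `[0,1]` (Lebesgue measure). -/
abbrev L2 : Type := Lp ℝ 2 (volume : Measure unitInterval)

/-- Càdlàg functions on `[0,1]` with values in a topological space: right-continuous, with left
limits. -/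
def IsCadlag {E : Type*} [TopologicalSpace E] (x : unitInterval → E) : Prop :=
  ∀ u, ContinuousWithinAt x (Ici u) u ∧ ∃ l, Tendsto x (𝓝[<] u) (𝓝 l)

theorem IsCadlag.measurable {f : unitInterval → ℝ} (hf : IsCadlag f) : Measurable f := by
  let r : ℕ → unitInterval → unitInterval := fun n u =>
    Set.projIcc (0 : ℝ) 1 zero_le_one ((⌊((n : ℝ) + 1) * (u : ℝ)⌋₊ + 1 : ℝ) / ((n : ℝ) + 1))
  have hr_ge : ∀ n u, u ≤ r n u := by
    intro n u
    have hn : (0 : ℝ) < (n : ℝ) + 1 := by positivity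
    have h1 : (u : ℝ) ≤ (⌊((n : ℝ) + 1) * (u : ℝ)⌋₊ + 1 : ℝ) / ((n : ℝ) + 1) := by
      rw [le_div_iff₀ hn, mul_comm]
      exact (Nat.lt_floor_add_one _).le
    have h2 : Set.projIcc (0 : ℝ) 1 zero_le_one (u : ℝ) = u := Set.projIcc_val zero_le_one u
    calc u = Set.projIcc (0 : ℝ) 1 zero_le_one (u : ℝ) := h2.symm
      _ ≤ r n u := Set.monotone_projIcc zero_le_one h1
  have hr_tendsto : ∀ u, Tendsto (fun n => r n u) atTop (𝓝 u) := by
    intro u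
    have h2 : Set.projIcc (0 : ℝ) 1 zero_le_one (u : ℝ) = u := Set.projIcc_val zero_le_one u
    have hcont : Tendsto (Set.projIcc (0 : ℝ) 1 zero_le_one) (𝓝 (u : ℝ)) (𝓝 u) := by
      have := (continuous_projIcc (a := (0 : ℝ)) (b := 1) (h := zero_le_one)).tendsto (u : ℝ)
      rwa [h2] at this
    refine hcont.comp ?_
    have hlim : Tendsto (fun n : ℕ => (u : ℝ) + 1 / ((n : ℝ) + 1)) atTop (𝓝 ((u : ℝ) + 0)) :=
      tendsto_const_nhds.add tendsto_one_div_add_atTop_nhds_zero_nat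
    rw [add_zero] at hlim
    refine tendsto_of_tendsto_of_tendsto_of_le_of_le tendsto_const_nhds hlim ?_ ?_
    · intro n
      have hn : (0 : ℝ) < (n : ℝ) + 1 := by positivity
      show (u : ℝ) ≤ (⌊((n : ℝ) + 1) * (u : ℝ)⌋₊ + 1 : ℝ) / ((n : ℝ) + 1)
      rw [le_div_iff₀ hn, mul_comm]
      exact (Nat.lt_floor_add_one _).le
    · intro n
      have hn : (0 : ℝ) < (n : ℝ) + 1 := by positivity
      show (⌊((n : ℝ) + 1) * (u : ℝ)⌋₊ + 1 : ℝ) / ((n : ℝ) + 1) ≤ (u : ℝ) + 1 / ((n : ℝ) + 1)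
      have h3 := Nat.floor_le (mul_nonneg hn.le u.2.1)
      rw [div_le_iff₀ hn]
      have h4 : ((u : ℝ) + 1 / ((n : ℝ) + 1)) * ((n : ℝ) + 1) = ((n : ℝ) + 1) * (u : ℝ) + 1 := by
        field_simp
      rw [h4]
      linarith
  refine measurable_of_tendsto_metrizable (f := fun n u => f (r n u)) ?_ ?_
  · intro n
    have hg : Measurable (fun k : ℕ => f (Set.projIcc (0 : ℝ) 1 zero_le_one
        ((k + 1 : ℝ) / ((n : ℝ) + 1)))) := measurable_from_nat
    exact hg.comp (Nat.measurable_floor.comp (measurable_subtype_coe.const_mul _))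
  · rw [tendsto_pi_nhds]
    intro u
    exact (hf u).1.tendsto.comp
      (tendsto_nhdsWithin_iff.2 ⟨hr_tendsto u, Eventually.of_forall fun n => hr_ge n u⟩)

theorem IsCadlag.exists_bound {f : unitInterval → ℝ} (hf : IsCadlag f) :
    ∃ C, ∀ u, ‖f u‖ ≤ C := by
  have key : ∃ C, ∀ u ∈ (univ : Set unitInterval), ‖f u‖ ≤ C := by
    refine isCompact_univ.induction_on (p := fun s => ∃ C, ∀ u ∈ s, ‖f u‖ ≤ C) ⟨0, by simp⟩ ?_ ?_ ?_
    · rintro s t hst ⟨C, hC⟩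
      exact ⟨C, fun u hu => hC u (hst hu)⟩
    · rintro s t ⟨C, hC⟩ ⟨D, hD⟩
      refine ⟨max C D, ?_⟩
      rintro u (hu | hu)
      · exact (hC u hu).trans (le_max_left _ _)
      · exact (hD u hu).trans (le_max_right _ _)
    · intro u _
      obtain ⟨hR, l, hL⟩ := hf u
      have h1 : ∀ᶠ v in 𝓝[≥] u, ‖f v‖ < ‖f u‖ + 1 :=
        hR.tendsto.norm.eventually (gt_mem_nhds (lt_add_one _))
      have h2 : ∀ᶠ v in 𝓝[<] u, ‖f v‖ < ‖l‖ + 1 :=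
        hL.norm.eventually (gt_mem_nhds (lt_add_one _))
      refine ⟨{v | ‖f v‖ ≤ max (‖f u‖ + 1) (‖l‖ + 1)}, ?_, _, fun v hv => hv⟩
      rw [nhdsWithin_univ, ← nhdsLT_sup_nhdsGE u]
      refine mem_sup.2 ⟨?_, ?_⟩
      · filter_upwards [h2] with v hv using hv.le.trans (le_max_right _ _)
      · filter_upwards [h1] with v hv using hv.le.trans (le_max_left _ _)
  obtain ⟨C, hC⟩ := key
  exact ⟨C, fun u => hC u (mem_univ u)⟩

theorem IsCadlag.memLp {f : unitInterval → ℝ} (hf : IsCadlag f) :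
    MemLp f 2 (volume : Measure unitInterval) := by
  obtain ⟨C, hC⟩ := hf.exists_bound
  exact MemLp.of_bound hf.measurable.aestronglyMeasurable C (Eventually.of_forall hC)

section Martingales

variable {T : ℝ≥0} {Ω : Type*} {mΩ : MeasurableSpace Ω}

/-- The space `𝓜₂` of continuous square integrable martingales on `[0, T]` (paths are continuous
almost surely). -/
structure IsContSqMartingale (𝓕 : Filtration (TimeInterval T) mΩ) (P : Measure Ω)
    (M : TimeInterval T → Ω → ℝ) : Prop where
  martingale : Martingale M 𝓕 P
  memLp : ∀ t, MemLp (M t) 2 P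
  continuous : ∀ᵐ ω ∂P, Continuous fun t => M t ω

/-- `A` is the mutual variation `[M, N]` of two continuous square integrable martingales: the
continuous adapted process of bounded variation, null at time `0`, such that `M N - A` is a
martingale. -/
structure IsCovariation (𝓕 : Filtration (TimeInterval T) mΩ) (P : Measure Ω)
    (M N A : TimeInterval T → Ω → ℝ) : Prop where
  adapted : StronglyAdapted 𝓕 A
  zero : ∀ᵐ ω ∂P, A ⊥ ω = 0
  continuous : ∀ᵐ ω ∂P, Continuous fun t => A t ω
  boundedVariation : ∀ᵐ ω ∂P, BoundedVariationOn (fun t => A t ω) univ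
  martingale : Martingale (fun t ω => M t ω * N t ω - A t ω) 𝓕 P

/-- `A` is the quadratic variation `[M]` of a continuous square integrable martingale `M`: the
continuous adapted nondecreasing process, null at time `0`, such that `M² - A` is a martingale. -/
structure IsQuadraticVariation (𝓕 : Filtration (TimeInterval T) mΩ) (P : Measure Ω)
    (M A : TimeInterval T → Ω → ℝ) : Prop where
  adapted : StronglyAdapted 𝓕 A
  zero : ∀ᵐ ω ∂P, A ⊥ ω = 0
  continuous : ∀ᵐ ω ∂P, Continuous fun t => A t ω
  monotone : ∀ᵐ ω ∂P, Monotone fun t => A t ω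
  martingale : Martingale (fun t ω => M t ω ^ 2 - A t ω) 𝓕 P

/-- `M` is a continuous local square integrable martingale. On the time interval `[0, T]` a
localizing sequence of stopping times is almost surely eventually equal to `⊤`. -/
def IsContLocalSqMartingale (𝓕 : Filtration (TimeInterval T) mΩ) (P : Measure Ω)
    (M : TimeInterval T → Ω → ℝ) : Prop :=
  StronglyAdapted 𝓕 M ∧ (∀ᵐ ω ∂P, Continuous fun t => M t ω) ∧
    Locally (IsContSqMartingale 𝓕 P) 𝓕 M P

/-- `A` is the quadratic variation `[M]` of a continuous local square integrable martingale `M`: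
the continuous adapted nondecreasing process, null at time `0`, such that `M² - A` is a local
martingale. -/
structure IsLocalQuadraticVariation (𝓕 : Filtration (TimeInterval T) mΩ) (P : Measure Ω)
    (M A : TimeInterval T → Ω → ℝ) : Prop where
  adapted : StronglyAdapted 𝓕 A
  zero : ∀ᵐ ω ∂P, A ⊥ ω = 0
  continuous : ∀ᵐ ω ∂P, Continuous fun t => A t ω
  monotone : ∀ᵐ ω ∂P, Monotone fun t => A t ω
  localMartingale : Locally (fun N => Martingale N 𝓕 P) 𝓕 (fun t ω => M t ω ^ 2 - A t ω) P

end Martingales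

/-- A random element of the Skorokhod space `D([0,1], C[0,T])`; `y.path ω u t` is the position at
time `t` of the particle started at `u`. The Borel sets of that space are generated by the
evaluations. -/
structure RandomFlow (T : ℝ≥0) (Ω : Type*) [MeasurableSpace Ω] where
  path : Ω → unitInterval → C(TimeInterval T, ℝ)
  cadlag : ∀ ω, IsCadlag (path ω)
  measurable : ∀ u t, Measurable fun ω => path ω u t

noncomputable section

namespace RandomFlow

variable {T : ℝ≥0} {Ω : Type*} [mΩ : MeasurableSpace Ω] (y : RandomFlow T Ω)

/-- The filtration `𝓕_t = σ(y(u,s), u ∈ [0,1], s ≤ t)`. -/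
def filtration : Filtration (TimeInterval T) mΩ where
  seq t := ⨆ u : unitInterval, ⨆ s : TimeInterval T, ⨆ _ : s ≤ t,
    MeasurableSpace.comap (fun ω => y.path ω u s) inferInstance
  mono' _ _ hst := iSup_mono fun _ => iSup_mono fun _ => iSup_mono' fun h => ⟨h.trans hst, le_rfl⟩
  le' _ := iSup_le fun u => iSup_le fun s => iSup_le fun _ => (y.measurable u s).comap_le

theorem isCadlag_at (t : TimeInterval T) (ω : Ω) : IsCadlag fun u => y.path ω u t := by
  intro u
  obtain ⟨hR, l, hL⟩ := y.cadlag ω u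
  have hev : Continuous fun g : C(TimeInterval T, ℝ) => g t := continuous_eval_const t
  exact ⟨(hev.tendsto _).comp hR, l t, (hev.tendsto l).comp hL⟩

/-- The `L₂`-valued process `y(t) = y(·, t)`. -/
def toL2 (t : TimeInterval T) (ω : Ω) : L2 := (y.isCadlag_at t ω).memLp.toLp _

/-- The mass `m(u,t) = Leb {v : ∃ s ≤ t, y(v,s) = y(u,s)}`, in `[0,∞]`. -/
def mass (u : unitInterval) (t : TimeInterval T) (ω : Ω) : ℝ≥0∞ :=
  volume {v : unitInterval | ∃ s ≤ t, y.path ω v s = y.path ω u s}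

/-- The meeting time `τ_{u,v} = inf {t : y(u,t) = y(v,t)} ∧ T`. -/
def meetingTime (u v : unitInterval) (ω : Ω) : ℝ :=
  sInf (insert (T : ℝ) {t : ℝ | ∃ h : t ∈ Icc (0 : ℝ) T, y.path ω u ⟨t, h⟩ = y.path ω v ⟨t, h⟩})

/-- The modified Arratia flow, that is, a random element of `D([0,1], C[0,T])` such that each
`y(u,·)` is a continuous square integrable martingale with `y(u,0) = u`, the flow is
order preserving, and `[y(u,·), y(v,·)]_t = ∫₀ᵗ 1_{τ_{u,v} ≤ s} / m(u,s) ds`. The integral is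
taken in `[0,∞]`, with `1 / 0 = ∞`. -/
structure IsModifiedArratiaFlow (P : Measure Ω) : Prop where
  martingale : ∀ u, IsContSqMartingale y.filtration P fun t ω => y.path ω u t
  initial : ∀ u, ∀ᵐ ω ∂P, y.path ω u ⊥ = (u : ℝ)
  order : ∀ᵐ ω ∂P, ∀ u v, u < v → ∀ t, y.path ω u t ≤ y.path ω v t
  covariation : ∀ u v, ∃ A : TimeInterval T → Ω → ℝ,
    IsCovariation y.filtration P (fun t ω => y.path ω u t) (fun t ω => y.path ω v t) A ∧
    ∀ᵐ ω ∂P, ∀ t, (A t ω : EReal) = ((∫⁻ s in Iic t,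
      {s : TimeInterval T | y.meetingTime u v ω ≤ (s : ℝ)}.indicator
        (fun s => (y.mass u s ω)⁻¹) s ∂timeLeb T : ℝ≥0∞) : EReal)

end RandomFlow

/-- `pr b a` is the orthogonal projection in `L₂` of `a` onto the closed subspace of all
(classes of) `σ(b)`-measurable functions of `L₂`. -/
def pr (b : L2) : L2 →L[ℝ] L2 :=
  (lpMeas ℝ ℝ (MeasurableSpace.comap (b : unitInterval → ℝ) inferInstance) 2 volume).subtypeL ∘L
    condExpL2 ℝ ℝ (Lp.stronglyMeasurable b).measurable.comap_le

section Integrands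

variable {T : ℝ≥0} {Ω : Type*} {mΩ : MeasurableSpace Ω}

/-- `‖f‖²_{𝓐²} = E ∫₀ᵀ ‖f(t)‖² dt`. -/
def sqNormA2 (P : Measure Ω) (f : TimeInterval T → Ω → L2) : ℝ≥0∞ :=
  ∫⁻ ω, ∫⁻ t, ‖f t ω‖ₑ ^ 2 ∂timeLeb T ∂P

/-- `‖M‖²_{𝓜₂} = E M(T)²`. -/
def sqNormM2 (P : Measure Ω) (M : TimeInterval T → Ω → ℝ) : ℝ≥0∞ :=
  ∫⁻ ω, ‖M ⊤ ω‖ₑ ^ 2 ∂P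

/-- The space `𝓐²` of predictable `L₂`-valued processes `f` with `E ∫₀ᵀ ‖f(t)‖² dt < ∞`. -/
def MemA2 (𝓕 : Filtration (TimeInterval T) mΩ) (P : Measure Ω)
    (f : TimeInterval T → Ω → L2) : Prop :=
  IsStronglyPredictable 𝓕 f ∧ sqNormA2 P f < ∞

/-- The space `𝓐` of predictable `L₂`-valued processes `f` with `∫₀ᵀ ‖f(t)‖² dt < ∞` a.s. -/
def MemA (𝓕 : Filtration (TimeInterval T) mΩ) (P : Measure Ω)
    (f : TimeInterval T → Ω → L2) : Prop :=
  IsStronglyPredictable 𝓕 f ∧ ∀ᵐ ω ∂P, ∫⁻ t, ‖f t ω‖ₑ ^ 2 ∂timeLeb T < ∞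

/-- A simple process of `𝓐²`: a partition `0 = t₀ < t₁ < ⋯ < tₙ = T` and `L₂`-valued
`𝓕_{t_k}`-measurable random elements `φ_k`, `k < n`, with `E ‖φ_k‖² < ∞`. -/
structure SimpleIntegrand (𝓕 : Filtration (TimeInterval T) mΩ) (P : Measure Ω) where
  n : ℕ
  t : ℕ → TimeInterval T
  φ : ℕ → Ω → L2
  t_zero : t 0 = ⊥
  t_last : t n = ⊤
  t_lt : ∀ k < n, t k < t (k + 1)
  measurable : ∀ k < n, StronglyMeasurable[𝓕 (t k)] (φ k)
  memLp : ∀ k < n, MemLp (φ k) 2 P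

/-- The process `φ₀ 1_{0}(s) + ∑_{k < n} φ_k 1_{(t_k, t_{k+1}]}(s)`. -/
def SimpleIntegrand.process {𝓕 : Filtration (TimeInterval T) mΩ} {P : Measure Ω}
    (f : SimpleIntegrand 𝓕 P) (s : TimeInterval T) (ω : Ω) : L2 :=
  ({⊥} : Set (TimeInterval T)).indicator (fun _ => f.φ 0 ω) s +
    ∑ k ∈ Finset.range f.n, (Ioc (f.t k) (f.t (k + 1))).indicator (fun _ => f.φ k ω) s

end Integrands

namespace RandomFlow

variable {T : ℝ≥0} {Ω : Type*} [mΩ : MeasurableSpace Ω] (y : RandomFlow T Ω) (P : Measure Ω)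

/-- `I_t(f) = ∑_{k < n} (φ_k, y(t_{k+1} ∧ t) - y(t_k ∧ t))` for a simple process `f`. -/
def simpleIntegral {P : Measure Ω} (f : SimpleIntegrand y.filtration P) (t : TimeInterval T)
    (ω : Ω) : ℝ :=
  ∑ k ∈ Finset.range f.n,
    inner ℝ (f.φ k ω) (y.toL2 (min (f.t (k + 1)) t) ω - y.toL2 (min (f.t k) t) ω)

/-- `M = ∫₀^· (f(s), dy(s))` for `f ∈ 𝓐²`: the element `M` of `𝓜₂` is the value at `f` of the
continuous extension to `𝓐²` of the operator `I` defined on simple processes. -/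
def IsStochasticIntegral (f : TimeInterval T → Ω → L2) (M : TimeInterval T → Ω → ℝ) : Prop :=
  IsContSqMartingale y.filtration P M ∧
    ∃ g : ℕ → SimpleIntegrand y.filtration P,
      Tendsto (fun n => sqNormA2 P fun t ω => (g n).process t ω - f t ω) atTop (𝓝 0) ∧
      Tendsto (fun n => sqNormM2 P fun t ω => y.simpleIntegral (g n) t ω - M t ω) atTop (𝓝 0)

/-- `M = ∫₀^· (f(s), dy(s))` for `f ∈ 𝓐`: along a localizing sequence `τ_n` of stopping times,
`f 1_{[0,τ_n]} ∈ 𝓐²` and the stopped process `M(· ∧ τ_n)` is the integral of `f 1_{[0,τ_n]}`. -/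
def IsLocalStochasticIntegral (f : TimeInterval T → Ω → L2) (M : TimeInterval T → Ω → ℝ) : Prop :=
  StronglyAdapted y.filtration M ∧
    ∃ τ : ℕ → Ω → WithTop (TimeInterval T), IsLocalizingSequence y.filtration τ P ∧
      ∀ n, MemA2 y.filtration P (fun s => {ω | (s : WithTop (TimeInterval T)) ≤ τ n ω}.indicator (f s)) ∧
        y.IsStochasticIntegral P
          (fun s => {ω | (s : WithTop (TimeInterval T)) ≤ τ n ω}.indicator (f s))
          (stoppedProcess M (τ n))

/-- `∫₀ᵗ ‖pr_{y(s)} f(s)‖² ds`. -/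
def projectedEnergy (f : TimeInterval T → Ω → L2) (t : TimeInterval T) (ω : Ω) : ℝ :=
  ∫ s in Iic t, ‖pr (y.toL2 s ω) (f s ω)‖ ^ 2 ∂timeLeb T

end RandomFlow

/-- `X` is a weak (martingale) solution on `[0, T]` of the stochastic equation
`dX = σ(X) dW`, `X(0) = x₀` in `L₂`, where `W` is a cylindrical Wiener process (space-time white
noise) in `L₂`: `X` is a continuous adapted `L₂`-valued process which starts from `x₀`, and for
each `g ∈ L₂` the process `(g, X(t))` is a continuous square integrable martingale with quadratic
variation `∫₀ᵗ ‖σ(X(s))* g‖² ds`. -/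
structure IsWeakMartingaleSolution {T : ℝ≥0} {Ω : Type*} {mΩ : MeasurableSpace Ω}
    (𝓕 : Filtration (TimeInterval T) mΩ) (P : Measure Ω) (σ : L2 → L2 →L[ℝ] L2) (x₀ : L2)
    (X : TimeInterval T → Ω → L2) : Prop where
  adapted : StronglyAdapted 𝓕 X
  continuous : ∀ᵐ ω ∂P, Continuous fun t => X t ω
  initial : ∀ᵐ ω ∂P, X ⊥ ω = x₀
  martingale : ∀ g : L2, IsContSqMartingale 𝓕 P fun t ω => inner ℝ g (X t ω)
  integrable : ∀ g : L2, ∀ᵐ ω ∂P,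
    Integrable (fun s => ‖ContinuousLinearMap.adjoint (σ (X s ω)) g‖ ^ 2) (timeLeb T)
  quadraticVariation : ∀ g : L2, IsQuadraticVariation 𝓕 P (fun t ω => inner ℝ g (X t ω))
    fun t ω => ∫ s in Iic t, ‖ContinuousLinearMap.adjoint (σ (X s ω)) g‖ ^ 2 ∂timeLeb T

/-- The identity function of `[0,1]` as an element of `L₂`. -/
def idL2 : L2 :=
  ContinuousMap.toLp (E := ℝ) 2 (volume : Measure unitInterval) ℝ ⟨Subtype.val, continuous_subtype_val⟩

end

/-! ### Second moments in `ℝ≥0∞` and bounded convergence in L². -/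

section SecondMoments

variable {α E : Type*} [MeasurableSpace α] [NormedAddCommGroup E] {μ : Measure α}

/-! Everything rests on one identity. For `s ≤ t`, `B ∈ 𝓕_s` and a fixed `g` in L₂, the integral
over `B` of `(g, y(t) - y(s))²` equals the integral over `B` of `∫_s^t ‖pr_{y(r)} g‖² dr`. By Fubini
the square of `(g, y)` is a double integral over pairs `(u, v)` of starting points, and the
covariation hypothesis replaces the mean increments of `y(u)y(v)` by time integrals of `1_{τ_{u,v} ≤
r} / m(u,r)`.

This density is the kernel of the projection for three reasons. The order makes the difference of
two particles a nonnegative martingale, which stays at zero once it gets there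
(`MeasureTheory.Martingale.ae_absorbedAtZero`). Hence particles that have met are together, and
`m(u,r)` is the mass of the level set of `y(·,r)` through `u`. Next, the integrals in the
covariation are finite while `1/0 = ∞`, so for almost all `(ω, r)` almost every `u` lies in a level
set of positive mass (`ae_levelMass_ne_zero`). Finally, for such a function the projection onto its
σ-algebra is averaging over level sets (`norm_pr_sq_eq_integral`), so integrating `g(u) g(v)`
against the kernel gives `‖pr_{y(r)} g‖²`.

The rest is Itô theory with the contraction `pr` in the isometry. The identity extends from `g` to
an `𝓕_s`-measurable direction by freezing it on its level sets (`setLIntegral_sq_inner_increment`),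
then to integrands which are constant between finitely many times, because the energy identity
`HasEnergy` is transitive in the pair of times. Simple processes are dense in `𝓐²`
(`MemA2.isSimpleLimit`), a fast converging sequence of continuous martingales converges uniformly
(`exists_limit_isContSqMartingale`), and `HasEnergy` survives L² limits (`HasEnergy.of_tendsto`); in
integrated form it is the statement on the quadratic variation. For `𝓐`, stopping an integral is the
same as cutting off its integrand (`IsStochasticIntegral.ae_stoppedProcess_eq`), so integrals along
a localizing sequence are consistent and can be glued.

The filtration is neither completed nor assumed right-continuous. For this reason limits are taken
with `limUnder` at every `ω`, stopping times are constructed so that they are stopping times without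
changes on null sets, and `b ↦ ‖pr_b a‖²` is shown to be Borel. -/

theorem sq_eLpNorm_two (f : α → E) : eLpNorm f 2 μ ^ 2 = ∫⁻ x, ‖f x‖ₑ ^ 2 ∂μ := by
  have h := eLpNorm_nnreal_pow_eq_lintegral (f := f) (μ := μ) (p := 2) two_ne_zero
  simpa using h

theorem tendsto_sq_nhds_zero_iff {ι : Type*} {l : Filter ι} {u : ι → ℝ≥0∞} :
    Tendsto (fun i => u i ^ 2) l (𝓝 0) ↔ Tendsto u l (𝓝 0) := by
  constructor
  · intro h
    have h2 := (ENNReal.continuous_rpow_const (y := (2⁻¹ : ℝ))).tendsto (0 : ℝ≥0∞) |>.comp h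
    have h3 : ∀ i, (u i ^ 2) ^ (2⁻¹ : ℝ) = u i := fun i => by
      rw [← ENNReal.rpow_natCast, ← ENNReal.rpow_mul]; norm_num
    simpa [Function.comp_def, h3] using h2
  · intro h
    simpa using ENNReal.Tendsto.pow (n := 2) h

theorem tendsto_toLp_of_bounded [IsFiniteMeasure μ] {F : ℕ → α → ℝ} {f : α → ℝ}
    (hF : ∀ n, MemLp (F n) 2 μ) (hf : MemLp f 2 μ) (C : ℝ) (hC : ∀ n, ∀ᵐ x ∂μ, ‖F n x‖ ≤ C)
    (h : ∀ᵐ x ∂μ, Tendsto (fun n => F n x) atTop (𝓝 (f x))) :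
    Tendsto (fun n => (hF n).toLp) atTop (𝓝 hf.toLp) := by
  rw [Lp.tendsto_Lp_iff_tendsto_eLpNorm'', ← tendsto_sq_nhds_zero_iff]
  simp only [sq_eLpNorm_two]
  have key := tendsto_lintegral_of_dominated_convergence' (μ := μ)
    (F := fun n x => ‖(F n - f) x‖ₑ ^ 2) (f := fun _ => 0) (fun _ => ENNReal.ofReal (2 * C) ^ 2)
    (fun n => (((hF n).1.sub hf.1).enorm.pow_const 2)) ?_ ?_ ?_
  · simpa using key
  · intro n
    filter_upwards [hC n, h, ae_all_iff.2 hC] with x hx hx2 hx3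
    gcongr
    rw [← ofReal_norm]
    gcongr
    have : ‖f x‖ ≤ C := le_of_tendsto hx2.norm (Eventually.of_forall hx3)
    calc _ ≤ ‖F n x‖ + ‖f x‖ := norm_sub_le _ _
      _ ≤ _ := by linarith
  · simp [ENNReal.mul_eq_top]
  · filter_upwards [h] with x hx
    rw [tendsto_sq_nhds_zero_iff]
    have := (hx.sub_const (f x)).enorm
    simpa using this

end SecondMoments

/-! ### The projection `pr`: level-set averages and joint measurability. -/

section Projection

/-- By the Doob–Dynkin factorization. Two representatives of one class generate different σ-algebras
but the same subspace of L₂, which allows passing from the representative inside `pr` to the actual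
function `y(·,t)`. -/
theorem mem_lpMeas_comap_iff {b β : unitInterval → ℝ}
    (hbβ : b =ᵐ[volume] β) (w : L2) :
    w ∈ lpMeas ℝ ℝ (MeasurableSpace.comap β inferInstance) 2 (volume : Measure unitInterval) ↔
      ∃ H : ℝ → ℝ, Measurable H ∧ w =ᵐ[volume] H ∘ b := by
  rw [mem_lpMeas_iff_aestronglyMeasurable]
  constructor
  · rintro ⟨v, hv, hwv⟩
    obtain ⟨H, hH, rfl⟩ := hv.measurable.exists_eq_measurable_comp
    refine ⟨H, hH, hwv.trans ?_⟩
    filter_upwards [hbβ] with x hx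
    simp [hx]
  · rintro ⟨H, hH, hw⟩
    refine ⟨H ∘ β, (hH.comp (comap_measurable β)).stronglyMeasurable, hw.trans ?_⟩
    filter_upwards [hbβ] with x hx
    simp [hx]

theorem pr_eq_starProjection (b : L2) :
    haveI : Fact (MeasurableSpace.comap (b : unitInterval → ℝ) inferInstance ≤
      (inferInstance : MeasurableSpace unitInterval)) :=
      ⟨(Lp.stronglyMeasurable b).measurable.comap_le⟩
    pr b = (lpMeas ℝ ℝ (MeasurableSpace.comap (b : unitInterval → ℝ) inferInstance) 2
      volume).starProjection := rfl

theorem norm_pr_le (b a : L2) : ‖pr b a‖ ≤ ‖a‖ := by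
  have : Fact (MeasurableSpace.comap (b : unitInterval → ℝ) inferInstance ≤
      (inferInstance : MeasurableSpace unitInterval)) :=
      ⟨(Lp.stronglyMeasurable b).measurable.comap_le⟩
  rw [pr_eq_starProjection]
  exact Submodule.norm_starProjection_apply_le _ _

theorem adjoint_pr (b : L2) : ContinuousLinearMap.adjoint (pr b) = pr b := by
  have : Fact (MeasurableSpace.comap (b : unitInterval → ℝ) inferInstance ≤
      (inferInstance : MeasurableSpace unitInterval)) :=
      ⟨(Lp.stronglyMeasurable b).measurable.comap_le⟩
  rw [pr_eq_starProjection]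
  exact isSelfAdjoint_starProjection _

theorem pr_mem (b a : L2) :
    pr b a ∈ lpMeas ℝ ℝ (MeasurableSpace.comap (b : unitInterval → ℝ) inferInstance) 2
      (volume : Measure unitInterval) :=
  Subtype.property _

theorem inner_pr_eq_of_mem (b a w : L2)
    (hw : w ∈ lpMeas ℝ ℝ (MeasurableSpace.comap (b : unitInterval → ℝ) inferInstance) 2
      (volume : Measure unitInterval)) : inner ℝ (pr b a) w = inner ℝ a w := by
  have : Fact (MeasurableSpace.comap (b : unitInterval → ℝ) inferInstance ≤
      (inferInstance : MeasurableSpace unitInterval)) :=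
      ⟨(Lp.stronglyMeasurable b).measurable.comap_le⟩
  rw [pr_eq_starProjection, Submodule.inner_starProjection_left_eq_right,
    Submodule.starProjection_eq_self_iff.2 hw]

theorem inner_pr_self (b a : L2) : inner ℝ a (pr b a) = ‖pr b a‖ ^ 2 := by
  rw [← inner_pr_eq_of_mem b a _ (pr_mem b a), real_inner_self_eq_norm_sq]

/-- On a level set of positive measure, the projection onto the `σ(b)`-measurable functions is the
average over the level set. -/
theorem norm_pr_sq_eq_integral {b : unitInterval → ℝ} (hb : Measurable b)
    (hbL : MemLp b 2 (volume : Measure unitInterval)) (g : L2)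
    (hpos : ∀ᵐ u : unitInterval, volume {v | b v = b u} ≠ 0) :
    ‖pr hbL.toLp g‖ ^ 2 = ∫ u : unitInterval, g u * ∫ v : unitInterval,
      g v * {v | b v = b u}.indicator (fun _ => (volume {w | b w = b u}).toReal⁻¹) v := by
  obtain ⟨K, hK, hKq⟩ := (mem_lpMeas_comap_iff hbL.coeFn_toLp.symm _).1 (pr_mem hbL.toLp g)
  rw [← inner_pr_self, L2.inner_def]
  refine integral_congr_ae ?_
  filter_upwards [hpos, hKq] with u hu hKu
  have hS : MeasurableSet {v | b v = b u} := hb (measurableSet_singleton (b u))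
  -- The indicator of the level set through `u` is itself in the range of the projection. Pairing
  -- with it shows that the value `K (b u)`, times the mass of the level set, is the integral of `g`
  -- over that set.
  have hw : indicatorConstLp 2 hS (measure_ne_top volume _) (1 : ℝ) ∈
      lpMeas ℝ ℝ (MeasurableSpace.comap ((hbL.toLp : L2) : unitInterval → ℝ) inferInstance) 2
      (volume : Measure unitInterval) := by
    rw [mem_lpMeas_comap_iff hbL.coeFn_toLp.symm]
    refine ⟨({b u} : Set ℝ).indicator fun _ => 1,
      measurable_const.indicator (measurableSet_singleton _), ?_⟩
    filter_upwards [indicatorConstLp_coeFn (p := 2) (hs := hS)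
      (hμs := measure_ne_top volume _) (c := (1 : ℝ))] with v hv
    rw [hv]
    by_cases hvu : b v = b u <;> simp [hvu]
  have h := inner_pr_eq_of_mem hbL.toLp g _ hw
  rw [real_inner_comm, real_inner_comm _ g, L2.inner_indicatorConstLp_one,
    L2.inner_indicatorConstLp_one] at h
  have h1 : ∫ v in {v | b v = b u}, (pr hbL.toLp g) v = volume.real {v | b v = b u} * K (b u) := by
    rw [setIntegral_congr_ae (g := fun _ => K (b u)) hS]
    · simp
    · filter_upwards [hKq] with v hv hvu
      rw [hv, Function.comp_apply, hvu]
  have h2 : ∫ v : unitInterval, g v * {v | b v = b u}.indicator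
      (fun _ => (volume {w | b w = b u}).toReal⁻¹) v =
      (∫ v in {v | b v = b u}, g v) * (volume {w | b w = b u}).toReal⁻¹ := by
    rw [← integral_mul_const, ← integral_indicator hS]
    congr 1; ext v
    by_cases hv : b v = b u <;> simp [indicator, hv]
  have hne : (volume {v | b v = b u}).toReal ≠ 0 :=
    ENNReal.toReal_ne_zero.2 ⟨hu, measure_ne_top _ _⟩
  rw [h2, ← h, h1, hKu, Measure.real]
  simp only [Function.comp_apply, RCLike.inner_apply, conj_trivial]
  field_simp

open BoundedContinuousFunction in
theorem memLp_boundedContinuous_comp (h : ℝ →ᵇ ℝ) (b : L2) :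
    MemLp (fun u => h (b u)) 2 (volume : Measure unitInterval) :=
  MemLp.of_bound (h.continuous.comp_aestronglyMeasurable (Lp.aestronglyMeasurable b)) ‖h‖
    (Eventually.of_forall fun _ => h.norm_coe_le_norm _)

open BoundedContinuousFunction in
-- L² convergence yields almost everywhere convergence along a subsequence of any subsequence, and
-- bounded convergence applies there.
theorem continuous_toLp_boundedContinuous_comp (h : ℝ →ᵇ ℝ) :
    Continuous fun b : L2 => (memLp_boundedContinuous_comp h b).toLp := by
  rw [continuous_iff_seqContinuous]
  intro x b hx
  refine tendsto_of_subseq_tendsto fun ns hns => ?_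
  obtain ⟨ms, -, hms⟩ := (tendstoInMeasure_of_tendsto_Lp (hx.comp hns)).exists_seq_tendsto_ae
  refine ⟨ms, tendsto_toLp_of_bounded (F := fun n u => h (x (ns (ms n)) u))
    (fun n => memLp_boundedContinuous_comp h _) (memLp_boundedContinuous_comp h b) ‖h‖
    (fun n => Eventually.of_forall fun _ => h.norm_coe_le_norm _) ?_⟩
  filter_upwards [hms] with u hu
  exact (h.continuous.tendsto _).comp hu

open BoundedContinuousFunction in
-- The projection is `K ∘ b` with `K` square integrable under the law of `b`, and bounded continuous
-- functions are dense in L² of that law.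
theorem exists_boundedContinuous_comp_near (b a : L2) {ε : ℝ} (hε : 0 < ε) :
    ∃ h : ℝ →ᵇ ℝ, ‖pr b a - (memLp_boundedContinuous_comp h b).toLp‖ ≤ ε := by
  have hbm : Measurable (b : unitInterval → ℝ) := (Lp.stronglyMeasurable b).measurable
  obtain ⟨K, hK, hKq⟩ := (mem_lpMeas_comap_iff EventuallyEq.rfl _).1 (pr_mem b a)
  have hKL : MemLp K 2 ((volume : Measure unitInterval).map b) := by
    rw [memLp_map_measure_iff hK.aestronglyMeasurable hbm.aemeasurable]
    exact (memLp_congr_ae hKq).1 (Lp.memLp _)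
  obtain ⟨h, hh, hhL⟩ := hKL.exists_boundedContinuous_eLpNorm_sub_le (by norm_num)
    (ε := ENNReal.ofReal ε) (by simpa using hε)
  refine ⟨h, ?_⟩
  rw [Lp.norm_def]
  refine ENNReal.toReal_le_of_le_ofReal hε.le (le_trans (le_of_eq ?_) hh)
  rw [eLpNorm_map_measure (hK.sub h.continuous.measurable).aestronglyMeasurable hbm.aemeasurable]
  refine eLpNorm_congr_ae ?_
  filter_upwards [hKq, Lp.coeFn_sub (pr b a) (memLp_boundedContinuous_comp h b).toLp,
    (memLp_boundedContinuous_comp h b).coeFn_toLp] with u h1 h2 h3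
  rw [h2, Pi.sub_apply, h1, h3]
  rfl

/-- `(b, a) ↦ ‖pr b a‖²` is a supremum of continuous functions. -/
theorem lowerSemicontinuous_sq_norm_pr :
    LowerSemicontinuous fun p : L2 × L2 => ‖pr p.1 p.2‖ ^ 2 := by
  intro p c hc
  -- Completing the square: the left side is continuous in the pair, lies below `‖pr b a‖²`, and is
  -- close to it when `h ∘ b` is close to the projection.
  have hle : ∀ (q : L2 × L2) (h : BoundedContinuousFunction ℝ ℝ),
      2 * inner ℝ q.2 (memLp_boundedContinuous_comp h q.1).toLp -
        ‖(memLp_boundedContinuous_comp h q.1).toLp‖ ^ 2 =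
      ‖pr q.1 q.2‖ ^ 2 - ‖pr q.1 q.2 - (memLp_boundedContinuous_comp h q.1).toLp‖ ^ 2 := by
    intro q h
    rw [← inner_pr_eq_of_mem q.1 q.2, norm_sub_sq_real]
    · ring
    · exact (mem_lpMeas_comap_iff EventuallyEq.rfl _).2
        ⟨h, h.continuous.measurable, MemLp.coeFn_toLp _⟩
  obtain ⟨ε, hε, hεc⟩ : ∃ ε : ℝ, 0 < ε ∧ ε ^ 2 < ‖pr p.1 p.2‖ ^ 2 - c := by
    have : 0 < ‖pr p.1 p.2‖ ^ 2 - c := by simpa using hc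
    refine ⟨Real.sqrt ((‖pr p.1 p.2‖ ^ 2 - c) / 2), by positivity, ?_⟩
    rw [Real.sq_sqrt (by positivity)]
    linarith
  obtain ⟨h, hh⟩ := exists_boundedContinuous_comp_near p.1 p.2 hε
  have hcont : Continuous fun q : L2 × L2 =>
      2 * inner ℝ q.2 (memLp_boundedContinuous_comp h q.1).toLp -
        ‖(memLp_boundedContinuous_comp h q.1).toLp‖ ^ 2 := by
    have := (continuous_toLp_boundedContinuous_comp h).comp (continuous_fst (X := L2) (Y := L2))
    exact (continuous_const.mul (continuous_snd.inner this)).sub (this.norm.pow 2)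
  have hp : c < 2 * inner ℝ p.2 (memLp_boundedContinuous_comp h p.1).toLp -
        ‖(memLp_boundedContinuous_comp h p.1).toLp‖ ^ 2 := by
    rw [hle]
    have : ‖pr p.1 p.2 - (memLp_boundedContinuous_comp h p.1).toLp‖ ^ 2 ≤ ε ^ 2 := by gcongr
    linarith
  filter_upwards [hcont.continuousAt.eventually (lt_mem_nhds hp)] with q hq
  refine hq.trans_le ?_
  rw [hle]
  linarith [sq_nonneg ‖pr q.1 q.2 - (memLp_boundedContinuous_comp h q.1).toLp‖]

/-- The projection is not continuous in `b`, since the σ-algebra can change abruptly, but a lower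
semicontinuous function of the pair is Borel. -/
theorem stronglyMeasurable_sq_norm_pr {α : Type*} [MeasurableSpace α] {b a : α → L2}
    (hb : StronglyMeasurable b) (ha : StronglyMeasurable a) :
    StronglyMeasurable fun x => ‖pr (b x) (a x)‖ ^ 2 := by
  let : MeasurableSpace (L2 × L2) := borel _
  have : BorelSpace (L2 × L2) := ⟨rfl⟩
  exact (lowerSemicontinuous_sq_norm_pr.measurable.comp
    (hb.prodMk ha).measurable).stronglyMeasurable

end Projection

/-! ### Uniform grids approximating starting points from the right. -/

section Grid

/-- The index of the cell of the uniform grid of mesh `1 / (n + 1)` which contains `u`. -/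
noncomputable def gridIndex (n : ℕ) (u : unitInterval) : ℕ := ⌊((n : ℝ) + 1) * (u : ℝ)⌋₊

/-- The right end point of the `k`-th cell of the uniform grid of mesh `1 / (n + 1)`. -/
noncomputable def gridPoint (n k : ℕ) : unitInterval :=
  Set.projIcc (0 : ℝ) 1 zero_le_one ((k + 1 : ℝ) / ((n : ℝ) + 1))

theorem measurable_gridIndex (n : ℕ) : Measurable (gridIndex n) :=
  Nat.measurable_floor.comp (measurable_subtype_coe.const_mul _)

/-- The bound is `n + 2` because the index `n + 1` occurs at `u = 1`. -/
theorem gridIndex_lt (n : ℕ) (u : unitInterval) : gridIndex n u < n + 2 := by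
  have hn : (0 : ℝ) < (n : ℝ) + 1 := by positivity
  have h : (gridIndex n u : ℝ) ≤ (n : ℝ) + 1 :=
    (Nat.floor_le (mul_nonneg hn.le u.2.1)).trans (mul_le_of_le_one_right hn.le u.2.2)
  have : gridIndex n u ≤ n + 1 := by exact_mod_cast h
  omega

theorem le_gridPoint (n : ℕ) (u : unitInterval) : u ≤ gridPoint n (gridIndex n u) := by
  have hn : (0 : ℝ) < (n : ℝ) + 1 := by positivity
  have h1 : (u : ℝ) ≤ (gridIndex n u + 1 : ℝ) / ((n : ℝ) + 1) := by
    rw [le_div_iff₀ hn, mul_comm]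
    exact (Nat.lt_floor_add_one _).le
  calc u = Set.projIcc (0 : ℝ) 1 zero_le_one (u : ℝ) := (Set.projIcc_val zero_le_one u).symm
    _ ≤ _ := Set.monotone_projIcc zero_le_one h1

/-- Càdlàg functions are continuous from the right only, so the approximating points must not lie to
the left of `u`. The projection to `[0,1]` clips the last ones to `1`. -/
theorem tendsto_gridPoint (u : unitInterval) :
    Tendsto (fun n => gridPoint n (gridIndex n u)) atTop (𝓝[≥] u) := by
  refine tendsto_nhdsWithin_iff.2 ⟨?_, Eventually.of_forall fun n => le_gridPoint n u⟩
  have h2 : Set.projIcc (0 : ℝ) 1 zero_le_one (u : ℝ) = u := Set.projIcc_val zero_le_one u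
  have hcont : Tendsto (Set.projIcc (0 : ℝ) 1 zero_le_one) (𝓝 (u : ℝ)) (𝓝 u) := by
    have := (continuous_projIcc (a := (0 : ℝ)) (b := 1) (h := zero_le_one)).tendsto (u : ℝ)
    rwa [h2] at this
  refine hcont.comp ?_
  have hlim : Tendsto (fun n : ℕ => (u : ℝ) + 1 / ((n : ℝ) + 1)) atTop (𝓝 ((u : ℝ) + 0)) :=
    tendsto_const_nhds.add tendsto_one_div_add_atTop_nhds_zero_nat
  rw [add_zero] at hlim
  refine tendsto_of_tendsto_of_tendsto_of_le_of_le tendsto_const_nhds hlim ?_ ?_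
  · intro n
    have hn : (0 : ℝ) < (n : ℝ) + 1 := by positivity
    simp only
    rw [le_div_iff₀ hn, mul_comm]
    exact (Nat.lt_floor_add_one _).le
  · intro n
    have hn : (0 : ℝ) < (n : ℝ) + 1 := by positivity
    simp only
    have h3 := Nat.floor_le (mul_nonneg hn.le u.2.1)
    rw [div_le_iff₀ hn]
    have h4 : ((u : ℝ) + 1 / ((n : ℝ) + 1)) * ((n : ℝ) + 1) = ((n : ℝ) + 1) * (u : ℝ) + 1 := by
      field_simp
    rw [h4]
    exact add_le_add_left h3 1

end Grid

/-! ### Measurability, adaptedness and continuity of `t ↦ y(t)` in L₂. -/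

namespace RandomFlow

variable {T : ℝ≥0} {Ω : Type*} [mΩ : MeasurableSpace Ω] (y : RandomFlow T Ω)

theorem tendsto_path_gridPoint (ω : Ω) (u : unitInterval) :
    Tendsto (fun n => y.path ω (gridPoint n (gridIndex n u))) atTop (𝓝 (y.path ω u)) :=
  (y.cadlag ω u).1.tendsto.comp (tendsto_gridPoint u)

/-- The sup norm in time is a real càdlàg function of `u`. The bound depends on `ω` and serves as
the dominating constant for L₂ limits along a fixed path. -/
theorem exists_path_bound (ω : Ω) : ∃ C, ∀ u t, ‖y.path ω u t‖ ≤ C := by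
  have h : IsCadlag fun u => ‖y.path ω u‖ := fun u =>
    ⟨(y.cadlag ω u).1.norm, _, (y.cadlag ω u).2.choose_spec.norm⟩
  obtain ⟨C, hC⟩ := h.exists_bound
  refine ⟨C, fun u t => ((y.path ω u).norm_coe_le_norm t).trans ?_⟩
  simpa using hC u

theorem stronglyMeasurable_path_filtration (u : unitInterval) {s t : TimeInterval T}
    (hst : s ≤ t) : StronglyMeasurable[y.filtration t] fun ω => y.path ω u s := by
  refine Measurable.stronglyMeasurable (Measurable.mono (comap_measurable _) ?_ le_rfl)
  exact le_iSup_of_le u (le_iSup_of_le s (le_iSup_of_le hst le_rfl))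

/-- On a grid cell the approximation is a single particle, which is jointly measurable because it is
continuous in time; right-continuity in `u` gives the limit. -/
theorem measurable_path :
    Measurable fun p : unitInterval × (TimeInterval T × Ω) => y.path p.2.2 p.1 p.2.1 := by
  refine measurable_of_tendsto_metrizable
    (f := fun n (p : unitInterval × (TimeInterval T × Ω)) =>
      y.path p.2.2 (gridPoint n (gridIndex n p.1)) p.2.1) (fun n => ?_) ?_
  · have h : Measurable fun q : ℕ × (TimeInterval T × Ω) =>
        y.path q.2.2 (gridPoint n q.1) q.2.1 := by
      refine measurable_from_prod_countable_right fun k => ?_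
      exact measurable_uncurry_of_continuous_of_measurable
        (u := fun (t : TimeInterval T) ω => y.path ω (gridPoint n k) t)
        (fun ω => (y.path ω (gridPoint n k)).continuous) fun t => y.measurable _ t
    exact h.comp (((measurable_gridIndex n).comp measurable_fst).prodMk measurable_snd)
  · rw [tendsto_pi_nhds]
    intro p
    have hev : Continuous fun g : C(TimeInterval T, ℝ) => g p.2.1 := continuous_eval_const _
    exact (hev.tendsto _).comp (y.tendsto_path_gridPoint p.2.2 p.1)

theorem coeFn_toL2 (t : TimeInterval T) (ω : Ω) :
    y.toL2 t ω =ᵐ[volume] fun u => y.path ω u t := MemLp.coeFn_toLp _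

/-- Dominated convergence in `u` with the bound of the path. No null set is excepted, so adaptedness
will imply progressive measurability. -/
theorem continuous_toL2 (ω : Ω) : Continuous fun t => y.toL2 t ω := by
  obtain ⟨C, hC⟩ := y.exists_path_bound ω
  rw [continuous_iff_seqContinuous]
  intro x t hx
  refine tendsto_toLp_of_bounded (F := fun n u => y.path ω u (x n))
    (fun n => (y.isCadlag_at (x n) ω).memLp) (y.isCadlag_at t ω).memLp C
    (fun n => Eventually.of_forall fun u => hC u _) (Eventually.of_forall fun u => ?_)
  exact ((y.path ω u).continuous.tendsto t).comp hx

/-- In L₂, `y(t)` is the limit of step functions on the grid cells, whose finitely many coefficients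
are positions of particles at time `t`. -/
theorem stronglyAdapted_toL2 : StronglyAdapted y.filtration y.toL2 := by
  intro t
  have hset : ∀ n k, MeasurableSet (gridIndex n ⁻¹' {k}) := fun n k =>
    measurable_gridIndex n (measurableSet_singleton k)
  refine stronglyMeasurable_of_tendsto (u := atTop) (f := fun n ω =>
    ∑ k ∈ Finset.range (n + 2), y.path ω (gridPoint n k) t •
      (indicatorConstLp 2 (hset n k) (measure_ne_top volume _) 1 : L2)) ?_ ?_
  · intro n
    refine Finset.stronglyMeasurable_fun_sum _ fun k _ => ?_
    exact (y.stronglyMeasurable_path_filtration _ le_rfl).smul_const _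
  · rw [tendsto_pi_nhds]
    intro ω
    obtain ⟨C, hC⟩ := y.exists_path_bound ω
    have hmeas : ∀ n, Measurable fun u => y.path ω (gridPoint n (gridIndex n u)) t := fun n =>
      (measurable_from_nat (f := fun k => y.path ω (gridPoint n k) t)).comp (measurable_gridIndex n)
    have hmem : ∀ n, MemLp (fun u => y.path ω (gridPoint n (gridIndex n u)) t) 2
        (volume : Measure unitInterval) := fun n =>
      MemLp.of_bound (hmeas n).aestronglyMeasurable C (Eventually.of_forall fun _ => hC _ _)
    have hev : Continuous fun g : C(TimeInterval T, ℝ) => g t := continuous_eval_const t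
    have key := tendsto_toLp_of_bounded hmem (y.isCadlag_at t ω).memLp C
      (fun n => Eventually.of_forall fun u => hC _ _) (Eventually.of_forall fun u =>
        (hev.tendsto _).comp (y.tendsto_path_gridPoint ω u))
    refine key.congr fun n => ?_
    refine Lp.ext ?_
    have h1 := Lp.coeFn_finsetSum (Finset.range (n + 2)) fun k => y.path ω (gridPoint n k) t •
      (indicatorConstLp 2 (hset n k) (measure_ne_top volume _) 1 : L2)
    have h2 : ∀ᵐ u : unitInterval, ∀ k, (y.path ω (gridPoint n k) t •
        (indicatorConstLp 2 (hset n k) (measure_ne_top volume _) 1 : L2)) u =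
        y.path ω (gridPoint n k) t * (gridIndex n ⁻¹' {k}).indicator (fun _ => 1) u := by
      refine ae_all_iff.2 fun k => ?_
      filter_upwards [Lp.coeFn_smul (y.path ω (gridPoint n k) t)
        (indicatorConstLp 2 (hset n k) (measure_ne_top volume _) 1 : L2),
        indicatorConstLp_coeFn (p := 2) (hs := hset n k)
        (hμs := measure_ne_top volume _) (c := (1 : ℝ))] with u hu1 hu2
      rw [hu1, Pi.smul_apply, hu2, smul_eq_mul]
    filter_upwards [(hmem n).coeFn_toLp, h1, h2] with u hu1 hu2 hu3
    rw [hu1, hu2, Finset.sum_apply]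
    simp only [hu3]
    rw [Finset.sum_eq_single (gridIndex n u)]
    · simp
    · intro k _ hk
      simp [indicator, hk.symm]
    · intro h
      exact absurd (Finset.mem_range.2 (gridIndex_lt n u)) h

theorem isStronglyProgressive_toL2 : IsStronglyProgressive y.filtration y.toL2 :=
  y.stronglyAdapted_toL2.isStronglyProgressive_of_continuous y.continuous_toL2

theorem stronglyMeasurable_toL2 :
    StronglyMeasurable fun p : TimeInterval T × Ω => y.toL2 p.1 p.2 :=
  stronglyMeasurable_uncurry_of_continuous_of_stronglyMeasurable y.continuous_toL2
    fun t => (y.stronglyAdapted_toL2 t).mono (y.filtration.le t)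

end RandomFlow

/-! ### Orthogonality of increments and Doob's maximal inequality. -/

section GeneralMartingales

variable {ι Ω : Type*} [LinearOrder ι] {mΩ : MeasurableSpace Ω} {P : Measure Ω}
  {𝓕 : Filtration ι mΩ}

theorem MeasureTheory.Martingale.eLpNorm_le {M : ι → Ω → ℝ} (hM : Martingale M 𝓕 P) {p : ℝ≥0∞}
    (hp : 1 ≤ p) {s t : ι} (hst : s ≤ t) : eLpNorm (M s) p P ≤ eLpNorm (M t) p P := by
  rw [← eLpNorm_congr_ae (hM.2 s t hst)]
  exact eLpNorm_condExp_le_eLpNorm _ hp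

theorem MeasureTheory.Martingale.submartingale_abs {M : ι → Ω → ℝ} (hM : Martingale M 𝓕 P) :
    Submartingale (fun t ω => |M t ω|) 𝓕 P :=
  hM.submartingale.sup hM.neg.submartingale

variable [IsFiniteMeasure P]

theorem martingale_of_setIntegral_eq {M : ι → Ω → ℝ} (hadp : StronglyAdapted 𝓕 M)
    (hint : ∀ t, Integrable (M t) P) (h : ∀ s t, s ≤ t → ∀ B, MeasurableSet[𝓕 s] B →
      ∫ ω in B, M s ω ∂P = ∫ ω in B, M t ω ∂P) : Martingale M 𝓕 P :=
  ⟨hadp, fun s t hst => (ae_eq_condExp_of_forall_setIntegral_eq (𝓕.le s) (hint t)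
    (fun _ _ _ => (hint s).integrableOn) (fun B hB _ => h s t hst B hB)
    (hadp s).aestronglyMeasurable).symm⟩

/-- Orthogonality of the increments of a square integrable martingale. -/
theorem MeasureTheory.Martingale.setIntegral_sq_sub {M : ι → Ω → ℝ} (hM : Martingale M 𝓕 P)
    (hL : ∀ t, MemLp (M t) 2 P) {s t : ι} (hst : s ≤ t) {B : Set Ω} (hB : MeasurableSet[𝓕 s] B) :
    ∫ ω in B, (M t ω - M s ω) ^ 2 ∂P = ∫ ω in B, (M t ω ^ 2 - M s ω ^ 2) ∂P := by
  have hint : ∀ a b, Integrable (M a * M b) P := fun a b => (hL a).integrable_mul (hL b)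
  have h1 : P[M s * M t | 𝓕 s] =ᵐ[P] M s * M s :=
    (condExp_mul_of_stronglyMeasurable_left (hM.1 s) (hint s t) (hM.integrable t)).trans
      (EventuallyEq.rfl.mul (hM.2 s t hst))
  have h2 : ∫ ω in B, (M s * M t) ω ∂P = ∫ ω in B, (M s * M s) ω ∂P := by
    rw [← setIntegral_condExp (𝓕.le s) (hint s t) hB]
    exact integral_congr_ae (ae_restrict_of_ae h1)
  have h3 : ∀ ω, (M t ω - M s ω) ^ 2 =
      (M t ω ^ 2 - M s ω ^ 2) - 2 * ((M s * M t) ω - (M s * M s) ω) := by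
    intro ω; simp only [Pi.mul_apply]; ring
  simp_rw [h3]
  have i1 : Integrable (fun ω => M t ω ^ 2 - M s ω ^ 2) P := by
    simp only [sq]
    exact (hint t t).sub (hint s s)
  have i2 : Integrable (fun ω => (M s * M t) ω - (M s * M s) ω) P := (hint s t).sub (hint s s)
  rw [integral_sub i1.integrableOn (i2.const_mul 2).integrableOn, integral_const_mul,
    integral_sub (hint s t).integrableOn (hint s s).integrableOn, h2]
  simp

theorem martingale_of_tendsto_eLpNorm_one {M : ℕ → ι → Ω → ℝ} {N : ι → Ω → ℝ}
    (hM : ∀ n, Martingale (M n) 𝓕 P) (hadp : StronglyAdapted 𝓕 N) (hint : ∀ t, Integrable (N t) P)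
    (h : ∀ t, Tendsto (fun n => eLpNorm (M n t - N t) 1 P) atTop (𝓝 0)) : Martingale N 𝓕 P := by
  refine martingale_of_setIntegral_eq hadp hint fun s t hst B hB => ?_
  have key : ∀ r, Tendsto (fun n => ∫ ω in B, M n r ω ∂P) atTop (𝓝 (∫ ω in B, N r ω ∂P)) :=
    fun r => tendsto_setIntegral_of_L1' (N r) (hint r).1
      (Eventually.of_forall fun n => (hM n).integrable r) (h r) B
  refine tendsto_nhds_unique (key s) ?_
  simp_rw [fun n => (hM n).setIntegral_eq hst hB]
  exact key t

/-- The times are added in increasing order. Paths which reach the level first at the new last time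
`a` form a set in `𝓕_a`, on which the submartingale property replaces `Z a` by `Z t`. Neither `c`
nor `Z` needs a sign. -/
theorem MeasureTheory.Submartingale.mul_measureReal_le_finset {Z : ι → Ω → ℝ}
    (hZ : Submartingale Z 𝓕 P) (c : ℝ) {t : ι} (S : Finset ι) (hS : ∀ s ∈ S, s ≤ t) :
    c * P.real {ω | ∃ s ∈ S, c ≤ Z s ω} ≤ ∫ ω in {ω | ∃ s ∈ S, c ≤ Z s ω}, Z t ω ∂P := by
  induction S using Finset.induction_on_max with
  | empty => simp
  | insert a S ha ih =>
    have hmeas : ∀ s ≤ a, MeasurableSet[𝓕 a] {ω | c ≤ Z s ω} := fun s hs =>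
      (stronglyMeasurable_const.measurableSet_le ((hZ.1 s).mono (𝓕.mono hs)))
    have hH : MeasurableSet[𝓕 a] {ω | ∃ s ∈ S, c ≤ Z s ω} := by
      have : {ω | ∃ s ∈ S, c ≤ Z s ω} = ⋃ s ∈ S, {ω | c ≤ Z s ω} := by ext; simp
      rw [this]
      exact Finset.measurableSet_biUnion S fun s hs => hmeas s (ha s hs).le
    have hD : MeasurableSet[𝓕 a] ({ω | c ≤ Z a ω} \ {ω | ∃ s ∈ S, c ≤ Z s ω}) :=
      MeasurableSet.diff (hmeas a le_rfl) hH
    have hU : {ω | ∃ s ∈ insert a S, c ≤ Z s ω} = {ω | ∃ s ∈ S, c ≤ Z s ω} ∪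
        ({ω | c ≤ Z a ω} \ {ω | ∃ s ∈ S, c ≤ Z s ω}) := by
      ext ω
      simp [or_comm]
    have hat : a ≤ t := hS a (Finset.mem_insert_self _ _)
    rw [hU, setIntegral_union disjoint_sdiff_right (𝓕.le a _ hD) (hZ.integrable t).integrableOn
      (hZ.integrable t).integrableOn, measureReal_union disjoint_sdiff_right (𝓕.le a _ hD), mul_add]
    refine add_le_add (ih fun s hs => hS s (Finset.mem_insert_of_mem hs)) ?_
    refine le_trans ?_ (hZ.setIntegral_le hat hD)
    rw [mul_comm, ← smul_eq_mul, ← setIntegral_const]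
    exact setIntegral_mono_on (integrable_const _).integrableOn (hZ.integrable a).integrableOn
      (𝓕.le a _ hD) fun ω hω => hω.1

/-- Doob's maximal inequality along a sequence of times. -/
theorem MeasureTheory.Submartingale.mul_measureReal_le {Z : ι → Ω → ℝ}
    (hZ : Submartingale Z 𝓕 P) (c : ℝ) {t : ι} (d : ℕ → ι) (hd : ∀ j, d j ≤ t) :
    c * P.real {ω | ∃ j, c ≤ Z (d j) ω} ≤ ∫ ω in {ω | ∃ j, c ≤ Z (d j) ω}, Z t ω ∂P := by
  classical
  let A : ℕ → Set Ω := fun n => {ω | ∃ s ∈ (Finset.range n).image d, c ≤ Z s ω}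
  have hA : ⋃ n, A n = {ω | ∃ j, c ≤ Z (d j) ω} := by
    ext ω
    simp only [A, mem_iUnion, mem_ofPred_eq, Finset.mem_image, Finset.mem_range]
    constructor
    · rintro ⟨n, s, ⟨j, -, rfl⟩, h⟩
      exact ⟨j, h⟩
    · rintro ⟨j, h⟩
      exact ⟨j + 1, d j, ⟨j, by omega, rfl⟩, h⟩
  have hmono : Monotone A := by
    intro m n hmn ω
    simp only [A, mem_ofPred_eq, Finset.mem_image, Finset.mem_range]
    rintro ⟨s, ⟨j, hj, rfl⟩, h⟩
    exact ⟨d j, ⟨j, by omega, rfl⟩, h⟩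
  have hmeas : ∀ n, MeasurableSet (A n) := by
    intro n
    have : A n = ⋃ s ∈ (Finset.range n).image d, {ω | c ≤ Z s ω} := by ext; simp [A]
    rw [this]
    exact Finset.measurableSet_biUnion _ fun s _ =>
      stronglyMeasurable_const.measurableSet_le ((hZ.1 s).mono (𝓕.le s))
  rw [← hA]
  refine le_of_tendsto_of_tendsto' ?_ (tendsto_setIntegral_of_monotone hmeas hmono
    (hZ.integrable t).integrableOn) (fun n => hZ.mul_measureReal_le_finset c
      ((Finset.range n).image d) (t := t) ?_)
  · refine Tendsto.const_mul _ ?_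
    exact (ENNReal.tendsto_toReal (measure_ne_top _ _)).comp (tendsto_measure_iUnion_atTop hmono)
  · intro s hs
    obtain ⟨j, -, rfl⟩ := Finset.mem_image.1 hs
    exact hd j

end GeneralMartingales

/-! ### Martingales on `[0,T]`: absorption at zero and uniform convergence. -/

section TimeIntervalMartingales

variable {T : ℝ≥0} {Ω : Type*} {mΩ : MeasurableSpace Ω} {P : Measure Ω}
  {𝓕 : Filtration (TimeInterval T) mΩ}

/-- A dense sequence in `[0, T]`. -/
noncomputable abbrev denseTime (T : ℝ≥0) : ℕ → TimeInterval T := TopologicalSpace.denseSeq (TimeInterval T)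

theorem exists_denseTime_mem {U : Set (TimeInterval T)} (hU : IsOpen U) (h : U.Nonempty) :
    ∃ k, denseTime T k ∈ U :=
  (TopologicalSpace.denseRange_denseSeq (TimeInterval T)).exists_mem_open hU h

/-- If a nonnegative path comes arbitrarily close to zero before `d j`, then it vanishes at `d j`,
where `d` is a dense sequence of times. -/
def AbsorbedAtZero (x : TimeInterval T → ℝ) : Prop :=
  ∀ j, (∀ n : ℕ, ∃ k, denseTime T k ≤ denseTime T j ∧ x (denseTime T k) < 1 / ((n : ℝ) + 1)) →
    x (denseTime T j) = 0

/-- The defining property involves countably many times, which keeps its event measurable;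
continuity restores the full statement. Just after `s` the path is small at dense times, so it
vanishes at all dense times of `(s,t)`, hence on the closure. -/
theorem AbsorbedAtZero.eq_zero {x : TimeInterval T → ℝ} (h : AbsorbedAtZero x)
    (hx : Continuous x) {s t : TimeInterval T} (hst : s ≤ t) (hs : x s = 0) : x t = 0 := by
  rcases hst.eq_or_lt with rfl | hlt
  · exact hs
  have h1 : ∀ j, denseTime T j ∈ Ioo s t → x (denseTime T j) = 0 := by
    intro j hj
    refine h j fun n => ?_
    obtain ⟨k, hk⟩ := exists_denseTime_mem (U := Iio (denseTime T j) ∩ x ⁻¹' Iio (1 / ((n : ℝ) + 1)))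
      (isOpen_Iio.inter (isOpen_Iio.preimage hx)) ⟨s, hj.1, by
        simp only [mem_preimage, hs, mem_Iio]; positivity⟩
    exact ⟨k, hk.1.le, hk.2⟩
  have h2 : Ioo s t ⊆ x ⁻¹' {0} := by
    have hcl : IsClosed (x ⁻¹' {0}) := isClosed_singleton.preimage hx
    have hd : Dense (range (denseTime T)) := TopologicalSpace.denseRange_denseSeq _
    refine (hd.open_subset_closure_inter isOpen_Ioo).trans (closure_minimal ?_ hcl)
    rintro r ⟨hr, j, rfl⟩
    exact h1 j hr
  have h3 : closure (Ioo s t) ⊆ x ⁻¹' {0} :=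
    closure_minimal h2 (isClosed_singleton.preimage hx)
  rw [closure_Ioo hlt.ne] at h3
  exact h3 ⟨hst, le_rfl⟩

/-- A nonnegative martingale is absorbed at zero. -/
theorem MeasureTheory.Martingale.ae_absorbedAtZero [IsProbabilityMeasure P]
    {X : TimeInterval T → Ω → ℝ} (hX : Martingale X 𝓕 P) (h0 : ∀ t, ∀ᵐ ω ∂P, 0 ≤ X t ω) :
    ∀ᵐ ω ∂P, AbsorbedAtZero fun t => X t ω := by
  refine ae_all_iff.2 fun j => ?_
  set t := denseTime T j
  let d : ℕ → TimeInterval T := fun k => min (denseTime T k) t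
  -- `Z = (1 - X)⁺` is a submartingale with values in `[0,1]` almost surely, and is close to one
  -- when `X` is close to zero. On the event that it reaches `1 - 1/(n+1)` before `t`, the maximal
  -- inequality bounds the integral of `1 - Z t` by `1/(n+1)`. On the intersection `H` of these
  -- events this leaves `Z t = 1`, that is `X t = 0`.
  let Z : TimeInterval T → Ω → ℝ := ((fun _ _ => (1 : ℝ)) - X)⁺
  have hZ : Submartingale Z 𝓕 P :=
    ((martingale_const 𝓕 P (1 : ℝ)).sub hX).submartingale.pos
  have hZval : ∀ s ω, Z s ω = max (1 - X s ω) 0 := fun s ω => rfl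
  let H : Set Ω := {ω | ∀ n : ℕ, ∃ k, 1 - 1 / ((n : ℝ) + 1) ≤ Z (d k) ω}
  let Hn : ℕ → Set Ω := fun n => {ω | ∃ k, 1 - 1 / ((n : ℝ) + 1) ≤ Z (d k) ω}
  have hHn : ∀ n, MeasurableSet (Hn n) := by
    intro n
    have : Hn n = ⋃ k, {ω | 1 - 1 / ((n : ℝ) + 1) ≤ Z (d k) ω} := by ext; simp [Hn]
    rw [this]
    exact MeasurableSet.iUnion fun k => stronglyMeasurable_const.measurableSet_le
      ((hZ.1 _).mono (𝓕.le _))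
  have hHeq : H = ⋂ n, Hn n := by ext; simp [H, Hn]
  have hH : MeasurableSet H := hHeq ▸ MeasurableSet.iInter hHn
  have hV0 : 0 ≤ᵐ[P] fun ω => 1 - Z t ω := by
    filter_upwards [h0 t] with ω hω
    simp only [hZval, Pi.zero_apply]
    have : max (1 - X t ω) 0 ≤ 1 := max_le (by linarith) zero_le_one
    linarith
  have hVi : Integrable (fun ω => 1 - Z t ω) P := (integrable_const _).sub (hZ.integrable t)
  have hle : ∀ n : ℕ, ∫ ω in H, (1 - Z t ω) ∂P ≤ 1 / ((n : ℝ) + 1) := by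
    intro n
    have h1 : ∫ ω in H, (1 - Z t ω) ∂P ≤ ∫ ω in Hn n, (1 - Z t ω) ∂P :=
      setIntegral_mono_set hVi.integrableOn (ae_restrict_of_ae hV0)
        (Eventually.of_forall fun ω hω => hω n)
    have h2 := hZ.mul_measureReal_le (1 - 1 / ((n : ℝ) + 1)) d (t := t) fun k => min_le_right _ _
    rw [integral_sub (μ := P.restrict (Hn n)) (integrable_const _).integrableOn
      (hZ.integrable t).integrableOn] at h1
    simp only [integral_const, MeasurableSet.univ, measureReal_restrict_apply, univ_inter,
      smul_eq_mul, mul_one] at h1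
    have h3 : P.real (Hn n) ≤ 1 := measureReal_le_one
    have h4 : (0 : ℝ) ≤ 1 / ((n : ℝ) + 1) := by positivity
    have h5 : (1 - 1 / ((n : ℝ) + 1)) * P.real (Hn n) ≤ ∫ ω in Hn n, Z t ω ∂P := h2
    nlinarith
  have hz : ∫ ω in H, (1 - Z t ω) ∂P = 0 := by
    refine le_antisymm ?_ (integral_nonneg_of_ae (ae_restrict_of_ae hV0))
    exact ge_of_tendsto' tendsto_one_div_add_atTop_nhds_zero_nat hle
  rw [integral_eq_zero_iff_of_nonneg_ae (ae_restrict_of_ae hV0) hVi.integrableOn,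
    EventuallyEq, ae_restrict_iff' hH] at hz
  filter_upwards [hz, h0 t] with ω hω h0ω hn
  have hωH : ω ∈ H := by
    intro n
    obtain ⟨k, hk, hk2⟩ := hn n
    refine ⟨k, ?_⟩
    have hdk : d k = denseTime T k := min_eq_left hk
    rw [hdk, hZval]
    exact le_trans (by linarith) (le_max_left _ _)
  have := hω hωH
  simp only [hZval, Pi.zero_apply] at this
  have h6 : max (1 - X t ω) 0 = 1 := by linarith
  rcases max_choice (1 - X t ω) 0 with h7 | h7
  · show X t ω = 0
    linarith
  · linarith

theorem le_of_forall_denseTime_le {x : TimeInterval T → ℝ} (hx : Continuous x) {c : ℝ}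
    (h : ∀ j, x (denseTime T j) ≤ c) (t : TimeInterval T) : x t ≤ c := by
  have hcl : IsClosed {t | x t ≤ c} := isClosed_le hx continuous_const
  have : closure (range (denseTime T)) ⊆ {t | x t ≤ c} :=
    closure_minimal (by rintro _ ⟨j, rfl⟩; exact h j) hcl
  exact this ((TopologicalSpace.denseRange_denseSeq (TimeInterval T)) t)

/-- Martingales whose terminal values tend to zero geometrically fast tend to zero uniformly. -/
theorem ae_eventually_forall_abs_le [IsProbabilityMeasure P] {N : ℕ → TimeInterval T → Ω → ℝ}
    (hN : ∀ n, Martingale (N n) 𝓕 P) (hc : ∀ n, ∀ᵐ ω ∂P, Continuous fun t => N n t ω) (C : ℝ≥0)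
    (h : ∀ n, eLpNorm (N n ⊤) 1 P ≤ C * (4⁻¹ : ℝ≥0) ^ n) :
    ∀ᵐ ω ∂P, ∀ᶠ n in atTop, ∀ t, |N n t ω| ≤ (1 / 2) ^ n := by
  -- The level `2⁻ⁿ` against the L¹ norm `C 4⁻ⁿ` gives probability at most `C 2⁻ⁿ`, which is
  -- summable, so Borel–Cantelli applies. Dense times suffice by continuity.
  let A : ℕ → Set Ω := fun n => {ω | ∃ j, (1 / 2 : ℝ) ^ n ≤ |N n (denseTime T j) ω|}
  have hA : ∀ n, P (A n) ≤ C * (2⁻¹ : ℝ≥0) ^ n := by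
    intro n
    have h1 := (hN n).submartingale_abs.mul_measureReal_le ((1 / 2 : ℝ) ^ n) (denseTime T)
      (t := ⊤) fun j => le_top
    have h2 : ∫ ω in A n, |N n ⊤ ω| ∂P ≤ C * (4⁻¹ : ℝ) ^ n := by
      have hi : Integrable (fun ω => |N n ⊤ ω|) P := ((hN n).integrable ⊤).abs
      refine (setIntegral_le_integral hi (Eventually.of_forall fun ω => abs_nonneg _)).trans ?_
      have h3 : ∫ ω, ‖N n ⊤ ω‖ ∂P = (eLpNorm (N n ⊤) 1 P).toReal := by
        rw [eLpNorm_one_eq_lintegral_enorm, integral_norm_eq_lintegral_enorm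
          ((hN n).integrable ⊤).1]
      simp_rw [← Real.norm_eq_abs]
      rw [h3]
      refine ENNReal.toReal_le_of_le_ofReal (by positivity) ((h n).trans (le_of_eq ?_))
      have : (C : ℝ) * (4⁻¹ : ℝ) ^ n = ((C * (4⁻¹ : ℝ≥0) ^ n : ℝ≥0) : ℝ) := by push_cast; rfl
      rw [this, ENNReal.ofReal_coe_nnreal]
      push_cast
      rfl
    have h4 : P.real (A n) ≤ C * (2⁻¹ : ℝ) ^ n := by
      have h5 : (1 / 2 : ℝ) ^ n * P.real (A n) ≤ (1 / 2 : ℝ) ^ n * (C * (2⁻¹ : ℝ) ^ n) := by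
        refine h1.trans (h2.trans (le_of_eq ?_))
        rw [mul_left_comm, ← mul_pow]
        norm_num
      exact le_of_mul_le_mul_left h5 (by positivity)
    rw [← ENNReal.ofReal_toReal (measure_ne_top P (A n))]
    refine (ENNReal.ofReal_le_ofReal h4).trans (le_of_eq ?_)
    have : (C : ℝ) * (2⁻¹ : ℝ) ^ n = ((C * (2⁻¹ : ℝ≥0) ^ n : ℝ≥0) : ℝ) := by push_cast; rfl
    rw [this, ENNReal.ofReal_coe_nnreal]
    push_cast
    rfl
  have hsum : ∑' n, P (A n) ≠ ∞ := by
    refine ne_top_of_le_ne_top ?_ (ENNReal.tsum_le_tsum hA)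
    have : Summable fun n : ℕ => C * (2⁻¹ : ℝ≥0) ^ n :=
      (NNReal.summable_geometric (by rw [← NNReal.coe_lt_coe]; norm_num)).mul_left C
    have h2 := ENNReal.tsum_coe_ne_top_iff_summable.2 this
    simpa only [ENNReal.coe_mul, ENNReal.coe_pow] using h2
  filter_upwards [ae_eventually_notMem hsum, ae_all_iff.2 hc] with ω hω hcω
  filter_upwards [hω] with n hn
  refine le_of_forall_denseTime_le (hcω n).abs fun j => ?_
  simp only [A, mem_ofPred_eq, not_exists, not_le] at hn
  exact (hn j).le

end TimeIntervalMartingales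

/-! ### Lebesgue measure on `[0,T]` is finite without atoms; absorption is a measurable event. -/

section TimeMeasure

variable {T : ℝ≥0}

instance isFiniteMeasure_timeLeb : IsFiniteMeasure (timeLeb T) := by
  refine ⟨?_⟩
  rw [timeLeb, (MeasurableEmbedding.subtype_coe measurableSet_Icc).comap_apply]
  exact (measure_mono (Subtype.coe_image_subset _ _)).trans_lt measure_Icc_lt_top

instance nullSingletonClass_timeLeb : NullSingletonClass (timeLeb T) := by
  refine ⟨fun t => ?_⟩
  rw [timeLeb, (MeasurableEmbedding.subtype_coe measurableSet_Icc).comap_apply]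
  simp

end TimeMeasure

theorem measurableSet_absorbedAtZero {T : ℝ≥0} {α : Type*} [MeasurableSpace α]
    {x : TimeInterval T → α → ℝ} (hx : ∀ t, Measurable (x t)) :
    MeasurableSet {a | AbsorbedAtZero fun t => x t a} := by
  have : {a | AbsorbedAtZero fun t => x t a} = ⋂ j, ((⋂ n : ℕ, ⋃ k, ⋃ (_ : denseTime T k ≤
      denseTime T j), {a | x (denseTime T k) a < 1 / ((n : ℝ) + 1)})ᶜ ∪
        {a | x (denseTime T j) a = 0}) := by
    ext a
    simp only [AbsorbedAtZero, mem_ofPred_eq, mem_iInter, mem_union, mem_compl_iff, mem_iUnion,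
      exists_prop, imp_iff_not_or]
  rw [this]
  refine MeasurableSet.iInter fun j => MeasurableSet.union (MeasurableSet.compl
    (MeasurableSet.iInter fun n => MeasurableSet.iUnion fun k => MeasurableSet.iUnion fun _ => ?_)) ?_
  · exact measurableSet_lt (hx _) measurable_const
  · exact measurableSet_eq_fun (hx _) measurable_const

/-! ### Coalescence of particles and the density of the mutual variation. -/

namespace RandomFlow

variable {T : ℝ≥0} {Ω : Type*} [mΩ : MeasurableSpace Ω] (y : RandomFlow T Ω)

/-- The mass at time `s` of the cluster of the particle started at `u`. -/
noncomputable def levelMass (u : unitInterval) (s : TimeInterval T) (ω : Ω) : ℝ≥0∞ :=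
  volume {v : unitInterval | y.path ω v s = y.path ω u s}

/-- The density of the mutual variation of two particles. -/
noncomputable def clusterKernel (p : unitInterval × unitInterval) (q : Ω × TimeInterval T) :
    ℝ≥0∞ :=
  {v | y.path q.1 v q.2 = y.path q.1 p.1 q.2}.indicator (fun _ => (y.levelMass p.1 q.2 q.1)⁻¹) p.2

theorem measurable_path_at (t : TimeInterval T) :
    Measurable fun p : unitInterval × Ω => y.path p.2 p.1 t :=
  y.measurable_path.comp (measurable_fst.prodMk (measurable_const.prodMk measurable_snd))

theorem measurable_path_initial (t : TimeInterval T) (ω : Ω) :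
    Measurable fun u => y.path ω u t := (y.isCadlag_at t ω).measurable

theorem measurable_levelMass :
    Measurable fun p : unitInterval × (Ω × TimeInterval T) => y.levelMass p.1 p.2.2 p.2.1 := by
  have h : MeasurableSet {x : (unitInterval × (Ω × TimeInterval T)) × unitInterval |
      y.path x.1.2.1 x.2 x.1.2.2 = y.path x.1.2.1 x.1.1 x.1.2.2} := by
    refine measurableSet_eq_fun ?_ ?_
    · exact y.measurable_path.comp (f := fun x : (unitInterval × (Ω × TimeInterval T)) ×
        unitInterval => (x.2, (x.1.2.2, x.1.2.1))) (by fun_prop)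
    · exact y.measurable_path.comp (f := fun x : (unitInterval × (Ω × TimeInterval T)) ×
        unitInterval => (x.1.1, (x.1.2.2, x.1.2.1))) (by fun_prop)
  exact measurable_measure_prodMk_left (ν := (volume : Measure unitInterval)) h

theorem measurable_clusterKernel : Measurable fun x : (unitInterval × unitInterval) ×
    (Ω × TimeInterval T) => y.clusterKernel x.1 x.2 := by
  have h : MeasurableSet {x : (unitInterval × unitInterval) × (Ω × TimeInterval T) |
      y.path x.2.1 x.1.2 x.2.2 = y.path x.2.1 x.1.1 x.2.2} := by
    refine measurableSet_eq_fun ?_ ?_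
    · exact y.measurable_path.comp (f := fun x : (unitInterval × unitInterval) ×
        (Ω × TimeInterval T) => (x.1.2, (x.2.2, x.2.1))) (by fun_prop)
    · exact y.measurable_path.comp (f := fun x : (unitInterval × unitInterval) ×
        (Ω × TimeInterval T) => (x.1.1, (x.2.2, x.2.1))) (by fun_prop)
  have h2 := ((y.measurable_levelMass.comp (f := fun x : (unitInterval × unitInterval) ×
        (Ω × TimeInterval T) => (x.1.1, x.2)) (by fun_prop)).inv).indicator h
  exact h2

/-- The second particle enters only through an indicator. Domination by the diagonal reduces
integrability of the kernel to the quadratic variation of one particle. -/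
theorem clusterKernel_le (u v : unitInterval) (q : Ω × TimeInterval T) :
    y.clusterKernel (u, v) q ≤ y.clusterKernel (u, u) q := by
  simp only [clusterKernel]
  refine (indicator_le_self' (fun _ _ => zero_le) v).trans (le_of_eq ?_)
  rw [indicator_of_mem]
  rfl

theorem clusterKernel_self (u : unitInterval) (q : Ω × TimeInterval T) :
    y.clusterKernel (u, u) q = (y.levelMass u q.2 q.1)⁻¹ := by
  simp only [clusterKernel]
  rw [indicator_of_mem]
  rfl

variable {y} {P : Measure Ω}

namespace IsModifiedArratiaFlow


/-- By the order, the difference of two particles, taken with the right sign, is a nonnegative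
martingale. -/
theorem ae_absorbedAtZero [IsProbabilityMeasure P] (hy : y.IsModifiedArratiaFlow P)
    (u v : unitInterval) :
    ∀ᵐ ω ∂P, AbsorbedAtZero fun t => |y.path ω u t - y.path ω v t| := by
  have key : ∀ u v : unitInterval, u < v →
      ∀ᵐ ω ∂P, AbsorbedAtZero fun t => |y.path ω u t - y.path ω v t| := by
    intro u v huv
    have h := ((hy.martingale v).martingale.sub (hy.martingale u).martingale).ae_absorbedAtZero
      fun t => by
        filter_upwards [hy.order] with ω hω
        simpa using hω u v huv t
    filter_upwards [h, hy.order] with ω hω hω2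
    have : (fun t => |y.path ω u t - y.path ω v t|) =
        fun t => y.path ω v t - y.path ω u t := by
      funext t
      rw [abs_sub_comm, abs_of_nonneg (sub_nonneg.2 (hω2 u v huv t))]
    rw [this]
    exact hω
  rcases lt_trichotomy u v with h | rfl | h
  · exact key u v h
  · refine Eventually.of_forall fun ω j _ => ?_
    simp
  · simp_rw [abs_sub_comm (y.path _ u _)]
    exact key v u h

/-- The mass of a cluster involves uncountably many `v` at once, while absorption is known almost
surely for each `v`. Fubini exchanges the two quantifiers up to a null set of `v`, which does not
change the mass. -/
theorem ae_ae_absorbedAtZero [IsProbabilityMeasure P] (hy : y.IsModifiedArratiaFlow P)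
    (u : unitInterval) : ∀ᵐ ω ∂P, ∀ᵐ v : unitInterval,
    AbsorbedAtZero fun t => |y.path ω u t - y.path ω v t| := by
  rw [Measure.ae_ae_comm]
  · exact Eventually.of_forall fun v => hy.ae_absorbedAtZero u v
  · refine measurableSet_absorbedAtZero
      (x := fun t (a : Ω × unitInterval) => |y.path a.1 u t - y.path a.1 a.2 t|) fun t => ?_
    refine Measurable.abs (Measurable.sub ?_ ?_)
    · exact (y.measurable u t).comp measurable_fst
    · exact (y.measurable_path_at t).comp measurable_swap

theorem path_eq_of_absorbed {u v : unitInterval} {ω : Ω}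
    (h : AbsorbedAtZero fun t => |y.path ω u t - y.path ω v t|) {s t : TimeInterval T}
    (hst : s ≤ t) (hs : y.path ω v s = y.path ω u s) : y.path ω v t = y.path ω u t := by
  have := h.eq_zero (by fun_prop) hst (by simp [hs])
  rw [abs_eq_zero, sub_eq_zero] at this
  exact this.symm

/-- The meeting set is closed, so the infimum is attained, and after it the particles stay together.
The time `⊤` is excluded because the meeting time is capped at `T` even when the particles never
meet. -/
theorem meetingTime_le_iff {u v : unitInterval} {ω : Ω}
    (h : AbsorbedAtZero fun t => |y.path ω u t - y.path ω v t|) {s : TimeInterval T}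
    (hs : s ≠ ⊤) : y.meetingTime u v ω ≤ s ↔ y.path ω v s = y.path ω u s := by
  have hsT : (s : ℝ) < T := lt_of_le_of_ne s.2.2 fun h' => hs (Subtype.ext h')
  have hbdd : BddBelow (insert (T : ℝ)
      {t : ℝ | ∃ h : t ∈ Icc (0 : ℝ) T, y.path ω u ⟨t, h⟩ = y.path ω v ⟨t, h⟩}) := by
    refine ⟨0, ?_⟩
    rintro t (rfl | ⟨ht, -⟩)
    · exact T.2
    · exact ht.1
  constructor
  · intro hle
    have hcl : IsClosed (insert (T : ℝ)
        {t : ℝ | ∃ h : t ∈ Icc (0 : ℝ) T, y.path ω u ⟨t, h⟩ = y.path ω v ⟨t, h⟩}) := by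
      have h1 : {t : ℝ | ∃ h : t ∈ Icc (0 : ℝ) T, y.path ω u ⟨t, h⟩ = y.path ω v ⟨t, h⟩} =
          Subtype.val '' {t : TimeInterval T | y.path ω u t = y.path ω v t} := by
        ext t
        simp
      rw [h1, insert_eq]
      exact isClosed_singleton.union ((isClosed_Icc.isClosedEmbedding_subtypeVal).isClosedMap _
        (isClosed_eq (y.path ω u).continuous (y.path ω v).continuous))
    have hmem := hcl.csInf_mem ⟨_, mem_insert _ _⟩ hbdd
    rcases hmem with h' | ⟨h', heq⟩
    · rw [meetingTime, h'] at hle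
      exact absurd hle (not_le.2 hsT)
    · exact path_eq_of_absorbed h (s := ⟨_, h'⟩) hle heq.symm
  · intro heq
    exact csInf_le hbdd (mem_insert_of_mem _ ⟨s.2, heq.symm⟩)

/-- With coalescence, "met before `s`" becomes "together at `s`" both in the indicator and in the
mass. The exceptional time `⊤` is a null set. -/
theorem ae_covariationDensity_eq [IsProbabilityMeasure P] (hy : y.IsModifiedArratiaFlow P)
    (u v : unitInterval) : ∀ᵐ ω ∂P, ∀ᵐ s ∂timeLeb T,
    {s : TimeInterval T | y.meetingTime u v ω ≤ (s : ℝ)}.indicator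
        (fun s => (y.mass u s ω)⁻¹) s = y.clusterKernel (u, v) (ω, s) := by
  filter_upwards [hy.ae_absorbedAtZero u v, hy.ae_ae_absorbedAtZero u] with ω h1 h2
  have h3 : ∀ᵐ s ∂timeLeb T, s ≠ ⊤ := by
    rw [ae_iff]
    simp
  filter_upwards [h3] with s hs
  have hm : y.mass u s ω = y.levelMass u s ω := by
    refine measure_congr ?_
    filter_upwards [h2] with w hw
    refine propext ⟨?_, fun h => ⟨s, le_rfl, h⟩⟩
    rintro ⟨r, hr, heq⟩
    exact path_eq_of_absorbed hw hr heq
  simp only [clusterKernel, indicator, mem_ofPred_eq, meetingTime_le_iff h1 hs, hm]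

/-- The increments of the mutual variation of two particles. -/
theorem exists_covariation [IsProbabilityMeasure P] (hy : y.IsModifiedArratiaFlow P)
    (u v : unitInterval) : ∃ A : TimeInterval T → Ω → ℝ,
    IsCovariation y.filtration P (fun t ω => y.path ω u t) (fun t ω => y.path ω v t) A ∧
    ∀ᵐ ω ∂P, ∀ t, ∫⁻ s in Iic t, y.clusterKernel (u, v) (ω, s) ∂timeLeb T ≠ ∞ ∧
      A t ω = ∫ s in Iic t, (y.clusterKernel (u, v) (ω, s)).toReal ∂timeLeb T := by
  obtain ⟨A, hA, hA2⟩ := hy.covariation u v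
  refine ⟨A, hA, ?_⟩
  filter_upwards [hA2, hy.ae_covariationDensity_eq u v] with ω h1 h2 t
  have h3 := h1 t
  rw [lintegral_congr_ae (ae_restrict_of_ae h2)] at h3
  have hm : Measurable fun s : TimeInterval T => y.clusterKernel (u, v) (ω, s) :=
    y.measurable_clusterKernel.comp (f := fun s : TimeInterval T => ((u, v), (ω, s))) (by fun_prop)
  -- The mutual variation is real-valued, so the identity in `EReal` excludes the value `∞`. The
  -- positivity of the cluster masses comes from this finiteness.
  have hfin : ∫⁻ s in Iic t, y.clusterKernel (u, v) (ω, s) ∂timeLeb T ≠ ∞ := by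
    intro htop
    rw [htop] at h3
    exact EReal.coe_ne_top _ h3
  refine ⟨hfin, ?_⟩
  rw [integral_toReal hm.aemeasurable (ae_lt_top hm hfin)]
  have := congrArg EReal.toReal h3
  simpa using this

theorem integral_mul_sub [IsProbabilityMeasure P] (hy : y.IsModifiedArratiaFlow P)
    (u v : unitInterval) {s t : TimeInterval T} (hst : s ≤ t) {B : Set Ω}
    (hB : MeasurableSet[y.filtration s] B) :
    ∫ ω in B, (y.path ω u t * y.path ω v t - y.path ω u s * y.path ω v s) ∂P =
      ∫ ω in B, ∫ r in Ioc s t, (y.clusterKernel (u, v) (ω, r)).toReal ∂timeLeb T ∂P := by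
  obtain ⟨A, hA, hA2⟩ := hy.exists_covariation u v
  have hint : ∀ t, Integrable (fun ω => y.path ω u t * y.path ω v t) P := fun t =>
    ((hy.martingale u).memLp t).integrable_mul ((hy.martingale v).memLp t)
  have hAi : ∀ t, Integrable (A t) P := fun t => by
    refine ((hint t).sub (hA.martingale.integrable t)).congr (Eventually.of_forall fun ω => ?_)
    simp
  have h1 := hA.martingale.setIntegral_eq hst hB
  rw [integral_sub (hint s).integrableOn (hAi s).integrableOn,
    integral_sub (hint t).integrableOn (hAi t).integrableOn] at h1
  rw [integral_sub (hint t).integrableOn (hint s).integrableOn]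
  have h2 : ∫ ω in B, (A t ω - A s ω) ∂P =
      ∫ ω in B, ∫ r in Ioc s t, (y.clusterKernel (u, v) (ω, r)).toReal ∂timeLeb T ∂P := by
    refine integral_congr_ae (ae_restrict_of_ae ?_)
    filter_upwards [hA2] with ω hω
    have hm : Measurable fun s : TimeInterval T => y.clusterKernel (u, v) (ω, s) :=
      y.measurable_clusterKernel.comp (f := fun s : TimeInterval T => ((u, v), (ω, s)))
        (by fun_prop)
    have hi : IntegrableOn (fun r => (y.clusterKernel (u, v) (ω, r)).toReal) (Iic t) (timeLeb T) :=
      integrable_toReal_of_lintegral_ne_top hm.aemeasurable (hω t).1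
    rw [(hω t).2, (hω s).2, ← Iic_union_Ioc_eq_Iic hst, setIntegral_union
      (by rw [Set.disjoint_left]; intro a ha ha2; exact absurd ha (not_le.2 ha2.1))
      measurableSet_Ioc (hi.mono_set (Iic_subset_Iic.2 hst))
      (hi.mono_set Ioc_subset_Iic_self), add_sub_cancel_left]
  rw [← h2, integral_sub (hAi t).integrableOn (hAi s).integrableOn]
  linarith

end IsModifiedArratiaFlow

end RandomFlow

/-! ### From pairs of particles to the quadratic variation of `(g, y)`. -/

namespace RandomFlow

variable {T : ℝ≥0} {Ω : Type*} [mΩ : MeasurableSpace Ω] {y : RandomFlow T Ω} {P : Measure Ω}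

theorem inner_toL2_eq_integral (g : L2) (t : TimeInterval T) (ω : Ω) :
    inner ℝ g (y.toL2 t ω) = ∫ u, g u * y.path ω u t := by
  rw [L2.inner_def]
  refine integral_congr_ae ?_
  filter_upwards [y.coeFn_toL2 t ω] with u hu
  rw [hu]
  simp [mul_comm]

namespace IsModifiedArratiaFlow

/-- Every particle is trapped between the two extreme ones. This gives a square integrable envelope
uniform in `u`, which justifies the uses of Fubini on particle positions below. -/
theorem ae_abs_path_le (hy : y.IsModifiedArratiaFlow P) : ∀ᵐ ω ∂P, ∀ u t,
    |y.path ω u t| ≤ |y.path ω 0 t| + |y.path ω 1 t| := by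
  filter_upwards [hy.order] with ω hω u t
  have h0 : y.path ω 0 t ≤ y.path ω u t := by
    rcases (unitInterval.nonneg' (t := u)).eq_or_lt with h | h
    · rw [← h]
    · exact hω _ _ h t
  have h1 : y.path ω u t ≤ y.path ω 1 t := by
    rcases (unitInterval.le_one' (t := u)).eq_or_lt with h | h
    · rw [h]
    · exact hω _ _ h t
  rw [abs_le]
  constructor
  · linarith [neg_abs_le (y.path ω 0 t), abs_nonneg (y.path ω 1 t)]
  · linarith [le_abs_self (y.path ω 1 t), abs_nonneg (y.path ω 0 t)]

theorem memLp_envelope (hy : y.IsModifiedArratiaFlow P) (t : TimeInterval T) :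
    MemLp (fun ω => |y.path ω 0 t| + |y.path ω 1 t|) 2 P :=
  ((hy.martingale 0).memLp t).abs.add ((hy.martingale 1).memLp t).abs

theorem memLp_toL2 (hy : y.IsModifiedArratiaFlow P) (t : TimeInterval T) :
    MemLp (y.toL2 t) 2 P := by
  refine (hy.memLp_envelope t).of_le
    ((y.stronglyAdapted_toL2 t).mono (y.filtration.le t)).aestronglyMeasurable ?_
  filter_upwards [hy.ae_abs_path_le] with ω hω
  rw [Real.norm_of_nonneg (by positivity)]
  have h := Lp.norm_le_of_ae_bound (f := y.toL2 t ω)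
    (C := |y.path ω 0 t| + |y.path ω 1 t|) (by positivity) (by
      filter_upwards [y.coeFn_toL2 t ω] with u hu
      rw [hu]
      exact hω u t)
  simpa [measureUnivNNReal] using h

theorem integrable_envelope_mul (hy : y.IsModifiedArratiaFlow P) (g : L2) (t : TimeInterval T) :
    Integrable (fun x : (unitInterval × unitInterval) × Ω =>
      g x.1.1 * g x.1.2 * (y.path x.2 x.1.1 t * y.path x.2 x.1.2 t))
      ((volume.prod volume).prod P) := by
  have hg : Measurable (g : unitInterval → ℝ) := (Lp.stronglyMeasurable g).measurable
  have hgi : Integrable (g : unitInterval → ℝ) := (Lp.memLp g).integrable one_le_two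
  have hE := (hy.memLp_envelope t).integrable_sq
  refine ((hgi.mul_prod hgi).mul_prod hE).mono ?_ ?_
  · refine Measurable.aestronglyMeasurable ?_
    refine ((hg.comp (by fun_prop)).mul (hg.comp (by fun_prop))).mul (Measurable.mul ?_ ?_)
    · exact (y.measurable_path_at t).comp (f := fun x : (unitInterval × unitInterval) × Ω =>
        (x.1.1, x.2)) (by fun_prop)
    · exact (y.measurable_path_at t).comp (f := fun x : (unitInterval × unitInterval) × Ω =>
        (x.1.2, x.2)) (by fun_prop)
  · have := (Measure.quasiMeasurePreserving_snd (μ := (volume : Measure unitInterval).prod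
      (volume : Measure unitInterval)) (ν := P)).ae hy.ae_abs_path_le
    filter_upwards [this] with x hx
    rw [norm_mul, norm_mul _ ((|y.path x.2 0 t| + |y.path x.2 1 t|) ^ 2)]
    gcongr
    rw [norm_mul, norm_pow, sq]
    have h0 : ‖|y.path x.2 0 t| + |y.path x.2 1 t|‖ = |y.path x.2 0 t| + |y.path x.2 1 t| :=
      Real.norm_of_nonneg (by positivity)
    rw [h0]
    exact mul_le_mul (hx _ t) (hx _ t) (norm_nonneg _) (by positivity)

variable [IsProbabilityMeasure P]

/-- The mean quadratic variation of a particle up to `T` is at most its second moment at `T`, and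
the envelope bounds the latter uniformly in `u`. -/
theorem exists_energy_bound (hy : y.IsModifiedArratiaFlow P) : ∃ C : ℝ≥0, ∀ u,
    ∫⁻ ω, ∫⁻ s, y.clusterKernel (u, u) (ω, s) ∂timeLeb T ∂P ≤ C := by
  refine ⟨Real.toNNReal (∫ ω, (|y.path ω 0 ⊤| + |y.path ω 1 ⊤|) ^ 2 ∂P), fun u => ?_⟩
  obtain ⟨A, hA, hA2⟩ := hy.exists_covariation u u
  have hint : ∀ t, Integrable (fun ω => y.path ω u t * y.path ω u t) P := fun t =>
    ((hy.martingale u).memLp t).integrable_mul ((hy.martingale u).memLp t)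
  have hAi : ∀ t, Integrable (A t) P := fun t => by
    refine ((hint t).sub (hA.martingale.integrable t)).congr (Eventually.of_forall fun ω => ?_)
    simp
  have h1 : ∀ᵐ ω ∂P, ∫⁻ s, y.clusterKernel (u, u) (ω, s) ∂timeLeb T = ENNReal.ofReal (A ⊤ ω) := by
    filter_upwards [hA2] with ω hω
    have hm : Measurable fun s : TimeInterval T => y.clusterKernel (u, u) (ω, s) :=
      y.measurable_clusterKernel.comp (f := fun s : TimeInterval T => ((u, u), (ω, s)))
        (by fun_prop)
    obtain ⟨h1, h2⟩ := hω ⊤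
    rw [h2, integral_toReal hm.aemeasurable (ae_lt_top hm h1), ENNReal.ofReal_toReal h1]
    simp
  have hA0 : 0 ≤ᵐ[P] A ⊤ := by
    filter_upwards [hA2] with ω hω
    rw [(hω ⊤).2]
    exact integral_nonneg fun _ => ENNReal.toReal_nonneg
  rw [lintegral_congr_ae h1, ← ofReal_integral_eq_lintegral_ofReal (hAi ⊤) hA0]
  refine ENNReal.ofReal_le_ofReal ?_
  have h2 := hA.martingale.setIntegral_eq (bot_le (a := ⊤)) MeasurableSet.univ
  simp only [Measure.restrict_univ] at h2
  rw [integral_sub (hint _) (hAi _), integral_sub (hint _) (hAi _)] at h2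
  have h3 : ∫ ω, A ⊥ ω ∂P = 0 := by
    rw [integral_congr_ae hA.zero]; simp
  have h4 : 0 ≤ ∫ ω, y.path ω u ⊥ * y.path ω u ⊥ ∂P := integral_nonneg fun ω => mul_self_nonneg _
  have h5 : ∫ ω, y.path ω u ⊤ * y.path ω u ⊤ ∂P ≤
      ∫ ω, (|y.path ω 0 ⊤| + |y.path ω 1 ⊤|) ^ 2 ∂P := by
    refine integral_mono_ae (hint ⊤) (hy.memLp_envelope ⊤).integrable_sq ?_
    filter_upwards [hy.ae_abs_path_le] with ω hω
    have := hω u ⊤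
    rw [← abs_mul_abs_self (y.path ω u ⊤), ← sq]
    gcongr
  linarith

theorem lintegral_clusterKernel_lt_top (hy : y.IsModifiedArratiaFlow P) (u : unitInterval) :
    ∫⁻ q, y.clusterKernel (u, u) q ∂P.prod (timeLeb T) < ∞ := by
  obtain ⟨C, hC⟩ := hy.exists_energy_bound
  have hm : Measurable fun q : Ω × TimeInterval T => y.clusterKernel (u, u) q :=
    y.measurable_clusterKernel.comp (f := fun q : Ω × TimeInterval T => ((u, u), q)) (by fun_prop)
  rw [lintegral_prod _ hm.aemeasurable]
  exact (hC u).trans_lt ENNReal.coe_lt_top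

/-- The diagonal kernel is the inverse mass, equal to `∞` at mass zero, and it has a finite integral
over `(ω, s)`. Fubini then moves the statement from each `u` to almost every `(ω, s)`. -/
theorem ae_levelMass_ne_zero (hy : y.IsModifiedArratiaFlow P) :
    ∀ᵐ q ∂P.prod (timeLeb T), ∀ᵐ u, y.levelMass u q.2 q.1 ≠ 0 := by
  rw [Measure.ae_ae_comm]
  · refine Eventually.of_forall fun u => ?_
    have hm : Measurable fun q : Ω × TimeInterval T => y.clusterKernel (u, u) q :=
      y.measurable_clusterKernel.comp (f := fun q : Ω × TimeInterval T => ((u, u), q)) (by fun_prop)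
    filter_upwards [ae_lt_top hm (hy.lintegral_clusterKernel_lt_top u).ne] with q hq h0
    rw [clusterKernel_self, h0] at hq
    simp at hq
  · have h := y.measurable_levelMass.comp (f := fun x : (Ω × TimeInterval T) × unitInterval =>
      (x.2, x.1)) measurable_swap
    exact (h (measurableSet_singleton 0)).compl

/-- Integrating over `(ω, s)` first and dominating by the diagonal leaves the uniform energy bound
times the integral of `|g(u) g(v)|`, finite because `g` is integrable on a space of finite measure.
-/
theorem integrable_mul_clusterKernel (hy : y.IsModifiedArratiaFlow P) (g : L2) :
    Integrable (fun x : (unitInterval × unitInterval) × (Ω × TimeInterval T) =>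
      g x.1.1 * g x.1.2 * (y.clusterKernel x.1 x.2).toReal)
      ((volume.prod volume).prod (P.prod (timeLeb T))) := by
  have hg : Measurable (g : unitInterval → ℝ) := (Lp.stronglyMeasurable g).measurable
  have hgi : Integrable (g : unitInterval → ℝ) := (Lp.memLp g).integrable one_le_two
  have hmeas : Measurable fun x : (unitInterval × unitInterval) × (Ω × TimeInterval T) =>
      g x.1.1 * g x.1.2 * (y.clusterKernel x.1 x.2).toReal :=
    ((hg.comp (by fun_prop)).mul (hg.comp (by fun_prop))).mul
      y.measurable_clusterKernel.ennreal_toReal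
  refine ⟨hmeas.aestronglyMeasurable, ?_⟩
  obtain ⟨C, hC⟩ := hy.exists_energy_bound
  have hle : ∀ p : unitInterval × unitInterval,
      ∫⁻ q, ‖g p.1 * g p.2 * (y.clusterKernel p q).toReal‖ₑ ∂P.prod (timeLeb T) ≤
      ‖g p.1 * g p.2‖ₑ * C := by
    rintro ⟨u, v⟩
    have hm : Measurable fun q : Ω × TimeInterval T => y.clusterKernel (u, u) q :=
      y.measurable_clusterKernel.comp (f := fun q : Ω × TimeInterval T => ((u, u), q))
        (by fun_prop)
    calc ∫⁻ q, ‖g u * g v * (y.clusterKernel (u, v) q).toReal‖ₑ ∂P.prod (timeLeb T)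
        ≤ ∫⁻ q, ‖g u * g v‖ₑ * y.clusterKernel (u, u) q ∂P.prod (timeLeb T) := by
          refine lintegral_mono fun q => ?_
          rw [enorm_mul]
          gcongr
          rw [Real.enorm_of_nonneg ENNReal.toReal_nonneg]
          exact ENNReal.ofReal_toReal_le.trans (y.clusterKernel_le u v q)
      _ ≤ ‖g u * g v‖ₑ * C := by
          rw [lintegral_const_mul _ hm, lintegral_prod _ hm.aemeasurable]
          gcongr
          exact hC u
  rw [HasFiniteIntegral, lintegral_prod _ hmeas.enorm.aemeasurable]
  refine (lintegral_mono hle).trans_lt ?_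
  rw [lintegral_mul_const' _ _ ENNReal.coe_ne_top]
  exact ENNReal.mul_lt_top (hgi.mul_prod hgi).2 ENNReal.coe_lt_top

/-- For almost all `(ω, s)` almost every level set has positive mass, so the level-set formula for
the projection applies; its kernel is exactly `clusterKernel`. -/
theorem ae_sq_norm_pr_eq (hy : y.IsModifiedArratiaFlow P) (g : L2) :
    ∀ᵐ q ∂P.prod (timeLeb T), ‖pr (y.toL2 q.2 q.1) g‖ ^ 2 =
      ∫ p : unitInterval × unitInterval,
        g p.1 * g p.2 * (y.clusterKernel p q).toReal ∂volume.prod volume := by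
  filter_upwards [hy.ae_levelMass_ne_zero, (hy.integrable_mul_clusterKernel g).prod_left_ae]
    with q h1 h2
  rw [integral_prod _ h2]
  refine (norm_pr_sq_eq_integral (y.measurable_path_initial q.2 q.1)
    (y.isCadlag_at q.2 q.1).memLp g h1).trans ?_
  refine integral_congr_ae (Eventually.of_forall fun u => ?_)
  simp only
  rw [← integral_const_mul]
  refine integral_congr_ae (Eventually.of_forall fun v => ?_)
  simp only [clusterKernel, levelMass]
  by_cases h : y.path q.1 v q.2 = y.path q.1 u q.2
  · simp only [indicator, mem_ofPred_eq, h, if_true, ENNReal.toReal_inv]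
    ring
  · simp [indicator, h]

theorem setIntegral_sq_inner (hy : y.IsModifiedArratiaFlow P) (g : L2) (t : TimeInterval T)
    (B : Set Ω) : ∫ ω in B, inner ℝ g (y.toL2 t ω) ^ 2 ∂P =
      ∫ p : unitInterval × unitInterval, g p.1 * g p.2 *
        ∫ ω in B, y.path ω p.1 t * y.path ω p.2 t ∂P ∂volume.prod volume := by
  have hi : Integrable (fun x : (unitInterval × unitInterval) × Ω =>
      g x.1.1 * g x.1.2 * (y.path x.2 x.1.1 t * y.path x.2 x.1.2 t))
      ((volume.prod volume).prod (P.restrict B)) :=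
    (hy.integrable_envelope_mul g t).mono_measure
      (Measure.prod_mono le_rfl Measure.restrict_le_self)
  simp_rw [← integral_const_mul]
  rw [integral_integral_swap (f := fun (p : unitInterval × unitInterval) ω =>
    g p.1 * g p.2 * (y.path ω p.1 t * y.path ω p.2 t)) hi]
  refine integral_congr_ae (Eventually.of_forall fun ω => ?_)
  simp only
  rw [inner_toL2_eq_integral, sq, ← integral_prod_mul]
  refine integral_congr_ae (Eventually.of_forall fun p => ?_)
  simp only
  ring

/-- The quadratic variation of `(g, y)` in integrated form. -/
theorem setIntegral_sq_inner_sub (hy : y.IsModifiedArratiaFlow P) (g : L2)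
    {s t : TimeInterval T} (hst : s ≤ t) {B : Set Ω} (hB : MeasurableSet[y.filtration s] B) :
    ∫ ω in B, (inner ℝ g (y.toL2 t ω) ^ 2 - inner ℝ g (y.toL2 s ω) ^ 2) ∂P =
      ∫ ω in B, ∫ r in Ioc s t, ‖pr (y.toL2 r ω) g‖ ^ 2 ∂timeLeb T ∂P := by
  have hsq : ∀ t, Integrable (fun ω => inner ℝ g (y.toL2 t ω) ^ 2) P := fun t =>
    ((hy.memLp_toL2 t).const_inner g).integrable_sq
  have hint : ∀ (p : unitInterval × unitInterval) t,
      Integrable (fun ω => y.path ω p.1 t * y.path ω p.2 t) P := fun p t =>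
    ((hy.martingale p.1).memLp t).integrable_mul ((hy.martingale p.2).memLp t)
  have hpi : ∀ t, Integrable (fun p : unitInterval × unitInterval => g p.1 * g p.2 *
        ∫ ω in B, y.path ω p.1 t * y.path ω p.2 t ∂P) (volume.prod volume) := fun t => by
    have := ((hy.integrable_envelope_mul g t).mono_measure
      (Measure.prod_mono le_rfl (Measure.restrict_le_self (s := B)))).integral_prod_left
    simpa only [integral_const_mul] using this
  have hν : (P.restrict B).prod ((timeLeb T).restrict (Ioc s t)) ≤ P.prod (timeLeb T) :=
    Measure.prod_mono Measure.restrict_le_self Measure.restrict_le_self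
  have hF := (hy.integrable_mul_clusterKernel g).mono_measure (Measure.prod_mono le_rfl hν)
  have hae : ∀ᵐ q ∂(P.restrict B).prod ((timeLeb T).restrict (Ioc s t)),
      ‖pr (y.toL2 q.2 q.1) g‖ ^ 2 = ∫ p : unitInterval × unitInterval,
        g p.1 * g p.2 * (y.clusterKernel p q).toReal ∂volume.prod volume :=
    (Measure.absolutelyContinuous_of_le hν).ae_le (hy.ae_sq_norm_pr_eq g)
  have hR : ∫ ω in B, ∫ r in Ioc s t, ‖pr (y.toL2 r ω) g‖ ^ 2 ∂timeLeb T ∂P =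
      ∫ q, ‖pr (y.toL2 q.2 q.1) g‖ ^ 2 ∂(P.restrict B).prod ((timeLeb T).restrict (Ioc s t)) := by
    rw [integral_prod]
    refine (hF.integral_prod_right).congr ?_
    filter_upwards [hae] with q hq using hq.symm
  -- After Fubini both sides are integrals over pairs of starting points weighted by `g(u) g(v)`,
  -- and for each pair the identity is the one for the mutual variation.
  rw [hR, integral_congr_ae hae, ← integral_integral_swap (f := fun (p : unitInterval ×
    unitInterval) (q : Ω × TimeInterval T) => g p.1 * g p.2 * (y.clusterKernel p q).toReal) hF,
    integral_sub (hsq t).integrableOn (hsq s).integrableOn, hy.setIntegral_sq_inner,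
    hy.setIntegral_sq_inner, ← integral_sub (hpi t) (hpi s)]
  refine integral_congr_ae (Eventually.of_forall fun p => ?_)
  simp only
  rw [integral_const_mul, ← mul_sub, ← integral_sub (hint p t).integrableOn
    (hint p s).integrableOn, hy.integral_mul_sub p.1 p.2 hst hB, integral_prod]
  have hm : Measurable fun q : Ω × TimeInterval T => y.clusterKernel p q :=
    y.measurable_clusterKernel.comp (f := fun q : Ω × TimeInterval T => (p, q)) (by fun_prop)
  refine Integrable.mono_measure ?_ hν
  refine integrable_toReal_of_lintegral_ne_top hm.aemeasurable (ne_of_lt ?_)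
  exact (lintegral_mono fun q => y.clusterKernel_le p.1 p.2 q).trans_lt
    (hy.lintegral_clusterKernel_lt_top p.1)

/-- The martingale property holds for each particle and is integrated against `g` by Fubini, with
the envelope as dominating function. -/
theorem isContSqMartingale_inner (hy : y.IsModifiedArratiaFlow P) (g : L2) :
    IsContSqMartingale y.filtration P fun t ω => inner ℝ g (y.toL2 t ω) := by
  have hL : ∀ t, MemLp (fun ω => inner ℝ g (y.toL2 t ω)) 2 P := fun t =>
    (hy.memLp_toL2 t).const_inner g
  refine ⟨martingale_of_setIntegral_eq (fun t => ?_) (fun t => (hL t).integrable one_le_two) ?_, hL,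
    Eventually.of_forall fun ω => continuous_const.inner (y.continuous_toL2 ω)⟩
  · exact stronglyMeasurable_const.inner (y.stronglyAdapted_toL2 t)
  · intro s t hst B hB
    have hg : Measurable (g : unitInterval → ℝ) := (Lp.stronglyMeasurable g).measurable
    have hgi : Integrable (g : unitInterval → ℝ) := (Lp.memLp g).integrable one_le_two
    have key : ∀ t, ∫ ω in B, inner ℝ g (y.toL2 t ω) ∂P =
        ∫ u, g u * ∫ ω in B, y.path ω u t ∂P := by
      intro t
      have hi : Integrable (fun x : unitInterval × Ω => g x.1 * y.path x.2 x.1 t)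
          (volume.prod (P.restrict B)) := by
        have hE := ((hy.memLp_envelope t).integrable one_le_two).integrableOn (s := B)
        refine (hgi.mul_prod hE).mono ?_ ?_
        · exact ((hg.comp measurable_fst).mul (y.measurable_path_at t)).aestronglyMeasurable
        · have := (Measure.quasiMeasurePreserving_snd (μ := (volume : Measure unitInterval))
            (ν := P.restrict B)).ae (ae_restrict_of_ae hy.ae_abs_path_le)
          filter_upwards [this] with x hx
          rw [norm_mul, norm_mul _ (|y.path x.2 0 t| + |y.path x.2 1 t|)]
          gcongr
          rw [Real.norm_of_nonneg (r := |y.path x.2 0 t| + _) (by positivity)]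
          exact hx _ t
      simp_rw [← integral_const_mul]
      rw [integral_integral_swap (f := fun (u : unitInterval) ω => g u * y.path ω u t) hi]
      simp_rw [inner_toL2_eq_integral]
    rw [key, key]
    congr 1
    ext u
    rw [(hy.martingale u).martingale.setIntegral_eq hst hB]

/-- The isometry for a deterministic direction. -/
theorem setIntegral_sq_inner_increment (hy : y.IsModifiedArratiaFlow P) (g : L2)
    {s t : TimeInterval T} (hst : s ≤ t) {B : Set Ω} (hB : MeasurableSet[y.filtration s] B) :
    ∫ ω in B, inner ℝ g (y.toL2 t ω - y.toL2 s ω) ^ 2 ∂P =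
      ∫ ω in B, ∫ r in Ioc s t, ‖pr (y.toL2 r ω) g‖ ^ 2 ∂timeLeb T ∂P := by
  have h := hy.isContSqMartingale_inner g
  rw [← hy.setIntegral_sq_inner_sub g hst hB, ← h.martingale.setIntegral_sq_sub h.memLp hst hB]
  simp_rw [inner_sub_right]

end IsModifiedArratiaFlow

end RandomFlow

/-! ### The Itô isometry for one increment. -/

theorem enorm_sq_eq_ofReal {E : Type*} [SeminormedAddCommGroup E] (x : E) :
    ‖x‖ₑ ^ 2 = ENNReal.ofReal (‖x‖ ^ 2) := by
  rw [← ofReal_norm, ENNReal.ofReal_pow (norm_nonneg _)]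

theorem enorm_pr_le (b a : L2) : ‖pr b a‖ₑ ≤ ‖a‖ₑ := by
  rw [← ofReal_norm, ← ofReal_norm]
  exact ENNReal.ofReal_le_ofReal (norm_pr_le b a)

namespace RandomFlow

variable {T : ℝ≥0} {Ω : Type*} [mΩ : MeasurableSpace Ω] {y : RandomFlow T Ω} {P : Measure Ω}

theorem measurable_sq_enorm_pr (y : RandomFlow T Ω) {α : Type*} [MeasurableSpace α]
    {r : α → TimeInterval T} {w : α → Ω}
    (hr : Measurable r) (hw : Measurable w) {f : α → L2} (hf : StronglyMeasurable f) :
    Measurable fun x => ‖pr (y.toL2 (r x) (w x)) (f x)‖ₑ ^ 2 := by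
  simp_rw [enorm_sq_eq_ofReal]
  exact (stronglyMeasurable_sq_norm_pr (y.stronglyMeasurable_toL2.comp_measurable (hr.prodMk hw))
    hf).measurable.ennreal_ofReal

namespace IsModifiedArratiaFlow

theorem memLp_increment (hy : y.IsModifiedArratiaFlow P) (s t : TimeInterval T) :
    MemLp (fun ω => y.toL2 t ω - y.toL2 s ω) 2 P :=
  (hy.memLp_toL2 t).sub (hy.memLp_toL2 s)

variable [IsProbabilityMeasure P]

/-- Testing against every `g` gives the vector-valued statement. It is needed to pull a random
direction out of the conditional expectation of an increment. -/
theorem martingale_toL2 (hy : y.IsModifiedArratiaFlow P) : Martingale y.toL2 y.filtration P := by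
  have hint : ∀ t, Integrable (y.toL2 t) P := fun t => (hy.memLp_toL2 t).integrable one_le_two
  refine ⟨y.stronglyAdapted_toL2, fun s t hst => (ae_eq_condExp_of_forall_setIntegral_eq
    (y.filtration.le s) (hint t) (fun _ _ _ => (hint s).integrableOn) (fun B hB _ => ?_)
    (y.stronglyAdapted_toL2 s).aestronglyMeasurable).symm⟩
  refine ext_inner_left ℝ fun g => ?_
  rw [← integral_inner (hint s).integrableOn, ← integral_inner (hint t).integrableOn]
  exact (hy.isContSqMartingale_inner g).martingale.setIntegral_eq hst hB

theorem setIntegral_inner_increment (hy : y.IsModifiedArratiaFlow P) {s t : TimeInterval T}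
    (hst : s ≤ t) {φ : Ω → L2} (hφ : StronglyMeasurable[y.filtration s] φ) (hL : MemLp φ 2 P)
    {B : Set Ω} (hB : MeasurableSet[y.filtration s] B) :
    ∫ ω in B, inner ℝ (φ ω) (y.toL2 t ω - y.toL2 s ω) ∂P = 0 := by
  have hi : Integrable (fun ω => inner ℝ (φ ω) (y.toL2 t ω - y.toL2 s ω)) P :=
    memLp_one_iff_integrable.1 ((innerSL ℝ (E := L2)).memLp_of_bilin 1 hL
      (hy.memLp_increment s t))
  have hΔ : Integrable (fun ω => y.toL2 t ω - y.toL2 s ω) P :=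
    (hy.memLp_increment s t).integrable one_le_two
  have h0 : P[fun ω => y.toL2 t ω - y.toL2 s ω | y.filtration s] =ᵐ[P] 0 := by
    have h1 := condExp_sub (hy.martingale_toL2.integrable t) (hy.martingale_toL2.integrable s)
      (y.filtration s)
    refine h1.trans ?_
    filter_upwards [hy.martingale_toL2.2 s t hst, hy.martingale_toL2.2 s s le_rfl] with ω h2 h3
    rw [Pi.sub_apply, h2, h3, sub_self, Pi.zero_apply]
  have h2 := condExp_bilin_of_aestronglyMeasurable_left (innerSL ℝ (E := L2))
    hφ.aestronglyMeasurable (m := y.filtration s) (μ := P)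
    (g := fun ω => y.toL2 t ω - y.toL2 s ω) hi hΔ
  rw [← setIntegral_condExp (y.filtration.le s) hi hB]
  refine (integral_congr_ae (g := fun _ => 0) (ae_restrict_of_ae ?_)).trans (integral_zero _ _)
  filter_upwards [h0, h2] with ω h3 h4
  refine h4.trans ?_
  rw [h3]
  simp

/-- The isometry is moved to integrals in `[0,∞]`, where it makes sense for any direction, even
before `(φ, y(t) - y(s))` is known to be square integrable. -/
theorem setLIntegral_sq_inner_const (hy : y.IsModifiedArratiaFlow P) (g : L2)
    {s t : TimeInterval T} (hst : s ≤ t) {B : Set Ω} (hB : MeasurableSet[y.filtration s] B) :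
    ∫⁻ ω in B, ‖inner ℝ g (y.toL2 t ω - y.toL2 s ω)‖ₑ ^ 2 ∂P =
      ∫⁻ ω in B, ∫⁻ r in Ioc s t, ‖pr (y.toL2 r ω) g‖ₑ ^ 2 ∂timeLeb T ∂P := by
  have h := hy.setIntegral_sq_inner_increment g hst hB
  have hi : Integrable (fun ω => inner ℝ g (y.toL2 t ω - y.toL2 s ω) ^ 2) P :=
    ((hy.memLp_increment s t).const_inner g).integrable_sq
  have hm : StronglyMeasurable fun q : Ω × TimeInterval T => ‖pr (y.toL2 q.2 q.1) g‖ ^ 2 :=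
    stronglyMeasurable_sq_norm_pr (y.stronglyMeasurable_toL2.comp_measurable measurable_swap)
      stronglyMeasurable_const
  have hb : ∀ q : Ω × TimeInterval T, ‖‖pr (y.toL2 q.2 q.1) g‖ ^ 2‖ ≤ ‖g‖ ^ 2 := fun q => by
    rw [norm_pow, norm_norm]
    gcongr
    exact norm_pr_le _ _
  have hin : ∀ ω, Integrable (fun r => ‖pr (y.toL2 r ω) g‖ ^ 2) ((timeLeb T).restrict (Ioc s t)) :=
    fun ω => Integrable.of_bound (hm.comp_measurable (measurable_prodMk_left
      (x := ω))).aestronglyMeasurable (‖g‖ ^ 2) (Eventually.of_forall fun r => hb (ω, r))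
  have hout : Integrable (fun ω => ∫ r in Ioc s t, ‖pr (y.toL2 r ω) g‖ ^ 2 ∂timeLeb T) P := by
    have : Integrable (fun q : Ω × TimeInterval T => ‖pr (y.toL2 q.2 q.1) g‖ ^ 2)
        (P.prod ((timeLeb T).restrict (Ioc s t))) :=
      Integrable.of_bound hm.aestronglyMeasurable (‖g‖ ^ 2) (Eventually.of_forall hb)
    exact this.integral_prod_left
  have h1 : ∀ ω, ∫⁻ r in Ioc s t, ‖pr (y.toL2 r ω) g‖ₑ ^ 2 ∂timeLeb T =
      ENNReal.ofReal (∫ r in Ioc s t, ‖pr (y.toL2 r ω) g‖ ^ 2 ∂timeLeb T) := fun ω => by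
    rw [ofReal_integral_eq_lintegral_ofReal (hin ω) (Eventually.of_forall fun _ => sq_nonneg _)]
    simp_rw [enorm_sq_eq_ofReal]
  simp_rw [h1, enorm_sq_eq_ofReal, Real.norm_eq_abs, sq_abs]
  rw [← ofReal_integral_eq_lintegral_ofReal hi.integrableOn
      (Eventually.of_forall fun _ => sq_nonneg _),
    ← ofReal_integral_eq_lintegral_ofReal hout.integrableOn
      (Eventually.of_forall fun _ => integral_nonneg fun _ => sq_nonneg _), h]

/-- On each of the finitely many level sets of `φ`, which belong to `𝓕_s`, the direction is frozen.
-/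
theorem setLIntegral_sq_inner_simpleFunc (hy : y.IsModifiedArratiaFlow P) {s t : TimeInterval T}
    (hst : s ≤ t) (φ : @SimpleFunc Ω (y.filtration s) L2) {B : Set Ω}
    (hB : MeasurableSet[y.filtration s] B) :
    ∫⁻ ω in B, ‖inner ℝ (φ ω) (y.toL2 t ω - y.toL2 s ω)‖ₑ ^ 2 ∂P =
      ∫⁻ ω in B, ∫⁻ r in Ioc s t, ‖pr (y.toL2 r ω) (φ ω)‖ₑ ^ 2 ∂timeLeb T ∂P := by
  have hm : ∀ x, MeasurableSet[y.filtration s] (B ∩ φ ⁻¹' {x}) := fun x =>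
    MeasurableSet.inter hB (@SimpleFunc.measurableSet_fiber _ _ (y.filtration s) φ x)
  have hU : B = ⋃ x ∈ @SimpleFunc.range _ _ (y.filtration s) φ, B ∩ φ ⁻¹' {x} := by
    ext ω
    simp
  have hd : Set.PairwiseDisjoint
      (↑(@SimpleFunc.range _ _ (y.filtration s) φ) : Set L2) fun x => B ∩ φ ⁻¹' {x} := by
    intro a _ b _ hab
    refine Set.disjoint_left.2 fun ω h1 h2 => hab ?_
    rw [← h1.2, ← h2.2]
  rw [hU, lintegral_biUnion_finset hd fun x _ => y.filtration.le s _ (hm x),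
    lintegral_biUnion_finset hd fun x _ => y.filtration.le s _ (hm x)]
  refine Finset.sum_congr rfl fun x _ => ?_
  have h1 := hy.setLIntegral_sq_inner_const x hst (hm x)
  rw [setLIntegral_congr_fun (g := fun ω => ‖inner ℝ x (y.toL2 t ω - y.toL2 s ω)‖ₑ ^ 2)
      (y.filtration.le s _ (hm x)), h1]
  · refine setLIntegral_congr_fun (y.filtration.le s _ (hm x)) fun ω hω => ?_
    have : φ ω = x := hω.2
    simp only [this]
  · intro ω hω
    have : φ ω = x := hω.2
    simp only [this]

/-- The Itô isometry for one increment. -/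
theorem setLIntegral_sq_inner_increment (hy : y.IsModifiedArratiaFlow P) {s t : TimeInterval T}
    (hst : s ≤ t) {φ : Ω → L2} (hφ : StronglyMeasurable[y.filtration s] φ) {B : Set Ω}
    (hB : MeasurableSet[y.filtration s] B) :
    ∫⁻ ω in B, ‖inner ℝ (φ ω) (y.toL2 t ω - y.toL2 s ω)‖ₑ ^ 2 ∂P =
      ∫⁻ ω in B, ∫⁻ r in Ioc s t, ‖pr (y.toL2 r ω) (φ ω)‖ₑ ^ 2 ∂timeLeb T ∂P := by
  have hle := y.filtration.le s
  -- Cutting `B` according to the integer part of `‖φ‖` makes the direction bounded by `N + 1` on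
  -- each piece. Simple approximations with the same bound then pass to the limit by dominated
  -- convergence on both sides, and the pieces are summed.
  let D : ℕ → Set Ω := fun N => B ∩ {ω | ⌊‖φ ω‖⌋₊ = N}
  have hD : ∀ N, MeasurableSet[y.filtration s] (D N) := fun N => by
    refine MeasurableSet.inter hB ?_
    exact (Nat.measurable_floor.comp hφ.norm.measurable) (measurableSet_singleton N)
  have hU : B = ⋃ N, D N := by ext; simp [D]
  have hd : Pairwise (Function.onFun Disjoint D) := by
    intro a b hab
    refine Set.disjoint_left.2 fun ω h1 h2 => hab ?_
    rw [← h1.2, ← h2.2]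
  rw [hU, lintegral_iUnion (fun N => hle _ (hD N)) hd, lintegral_iUnion (fun N => hle _ (hD N)) hd]
  refine tsum_congr fun N => ?_
  set c : ℝ := N + 1 with hc
  have hc0 : 0 ≤ c := by positivity
  let ψ : ℕ → @SimpleFunc Ω (y.filtration s) L2 := hφ.approxBounded c
  have hψc : ∀ n ω, ‖ψ n ω‖ ≤ c := fun n ω => hφ.norm_approxBounded_le hc0 n ω
  have hψt : ∀ ω ∈ D N, Tendsto (fun n => ψ n ω) atTop (𝓝 (φ ω)) := fun ω hω => by
    refine hφ.tendsto_approxBounded_of_norm_le ?_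
    have h1 : ⌊‖φ ω‖⌋₊ = N := hω.2
    have h2 := (Nat.lt_floor_add_one ‖φ ω‖).le
    rwa [h1] at h2
  have hψm : ∀ n, StronglyMeasurable (ψ n) := fun n =>
    (@SimpleFunc.stronglyMeasurable _ _ (y.filtration s) _ (ψ n)).mono hle
  have hφm := hφ.mono hle
  have hΔm : StronglyMeasurable fun ω => y.toL2 t ω - y.toL2 s ω :=
    ((y.stronglyAdapted_toL2 t).mono (y.filtration.le t)).sub
      ((y.stronglyAdapted_toL2 s).mono (y.filtration.le s))
  have hL : Tendsto (fun n => ∫⁻ ω in D N, ‖inner ℝ (ψ n ω) (y.toL2 t ω - y.toL2 s ω)‖ₑ ^ 2 ∂P)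
      atTop (𝓝 (∫⁻ ω in D N, ‖inner ℝ (φ ω) (y.toL2 t ω - y.toL2 s ω)‖ₑ ^ 2 ∂P)) := by
    refine tendsto_lintegral_of_dominated_convergence
      (fun ω => ENNReal.ofReal c ^ 2 * ‖y.toL2 t ω - y.toL2 s ω‖ₑ ^ 2) ?_ ?_ ?_ ?_
    · intro n
      exact ((hψm n).inner hΔm).enorm.pow_const 2
    · intro n
      refine Eventually.of_forall fun ω => ?_
      simp only
      rw [← mul_pow, ← ofReal_norm, ← ofReal_norm (y.toL2 t ω - _), ← ENNReal.ofReal_mul hc0]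
      gcongr
      exact (norm_inner_le_norm _ _).trans (by gcongr; exact hψc n ω)
    · rw [lintegral_const_mul _ (hΔm.enorm.pow_const 2)]
      refine (ENNReal.mul_lt_top (by simp) ?_).ne
      rw [← sq_eLpNorm_two]
      exact ENNReal.pow_lt_top ((hy.memLp_increment s t).restrict _).2
    · refine (ae_restrict_iff' (hle _ (hD N))).2 (Eventually.of_forall fun ω hω => ?_)
      exact ENNReal.Tendsto.pow (((hψt ω hω).inner tendsto_const_nhds).enorm)
  have hR : Tendsto (fun n => ∫⁻ ω in D N, ∫⁻ r in Ioc s t,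
        ‖pr (y.toL2 r ω) (ψ n ω)‖ₑ ^ 2 ∂timeLeb T ∂P) atTop
      (𝓝 (∫⁻ ω in D N, ∫⁻ r in Ioc s t, ‖pr (y.toL2 r ω) (φ ω)‖ₑ ^ 2 ∂timeLeb T ∂P)) := by
    have hmeas : ∀ {ξ : Ω → L2}, StronglyMeasurable ξ → Measurable fun q : Ω × TimeInterval T =>
        ‖pr (y.toL2 q.2 q.1) (ξ q.1)‖ₑ ^ 2 := fun hξ =>
      y.measurable_sq_enorm_pr measurable_snd measurable_fst (hξ.comp_measurable measurable_fst)
    rw [lintegral_lintegral (f := fun ω r => ‖pr (y.toL2 r ω) (φ ω)‖ₑ ^ 2) (hmeas hφm).aemeasurable]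
    simp_rw [fun n => lintegral_lintegral (f := fun ω r => ‖pr (y.toL2 r ω) (ψ n ω)‖ₑ ^ 2)
      (μ := P.restrict (D N)) (ν := (timeLeb T).restrict (Ioc s t)) (hmeas (hψm n)).aemeasurable]
    refine tendsto_lintegral_of_dominated_convergence (fun _ => ENNReal.ofReal c ^ 2)
      (fun n => hmeas (hψm n)) (fun n => Eventually.of_forall fun q => ?_) ?_ ?_
    · simp only
      gcongr
      refine (enorm_pr_le _ _).trans ?_
      rw [← ofReal_norm]
      exact ENNReal.ofReal_le_ofReal (hψc n _)
    · simp [ENNReal.mul_eq_top]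
    · have h1 : ∀ᵐ ω ∂P.restrict (D N), Tendsto (fun n => ψ n ω) atTop (𝓝 (φ ω)) :=
        (ae_restrict_iff' (hle _ (hD N))).2 (Eventually.of_forall hψt)
      filter_upwards [Measure.quasiMeasurePreserving_fst.ae h1] with q hq
      exact ENNReal.Tendsto.pow ((((pr (y.toL2 q.2 q.1)).continuous.tendsto _).comp hq).enorm)
  refine tendsto_nhds_unique hL ?_
  simp_rw [fun n => hy.setLIntegral_sq_inner_simpleFunc hst (ψ n) (hD N)]
  exact hR

end IsModifiedArratiaFlow

end RandomFlow

/-! ### Integrals of processes that are constant between finitely many times. -/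

/-- A transitive relation between times which holds on all intervals without interior points in
a finite set holds on all intervals. -/
theorem forall_le_of_forall_free {ι : Type*} [LinearOrder ι] {R : ι → ι → Prop} (S : Finset ι)
    (h : ∀ s t, s ≤ t → (∀ c ∈ S, c ∉ Ioo s t) → R s t)
    (trans : ∀ s c t, s ≤ c → c ≤ t → R s c → R c t → R s t) : ∀ s t, s ≤ t → R s t := by
  -- Induction on the number of points of `S` inside the open interval; splitting at one of them
  -- lowers the number for both halves.
  have key : ∀ (n : ℕ) s t, s ≤ t → (S.filter (· ∈ Ioo s t)).card = n → R s t := by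
    intro n
    induction n using Nat.strong_induction_on with
    | _ n ih =>
      intro s t hst hn
      by_cases hfree : ∀ c ∈ S, c ∉ Ioo s t
      · exact h s t hst hfree
      push Not at hfree
      obtain ⟨c, hcS, hc⟩ := hfree
      have hlt : ∀ a b, Ioo a b ⊆ Ioo s t → c ∉ Ioo a b →
          (S.filter (· ∈ Ioo a b)).card < n := by
        intro a b hab hcab
        rw [← hn]
        refine Finset.card_lt_card (Finset.ssubset_iff_of_subset ?_ |>.2 ⟨c, ?_, ?_⟩)
        · intro x hx
          rw [Finset.mem_filter] at hx ⊢
          exact ⟨hx.1, hab hx.2⟩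
        · exact Finset.mem_filter.2 ⟨hcS, hc⟩
        · exact fun h => hcab (Finset.mem_filter.1 h).2
      refine trans s c t hc.1.le hc.2.le (ih _ (hlt s c ?_ ?_) s c hc.1.le rfl)
        (ih _ (hlt c t ?_ ?_) c t hc.2.le rfl)
      · exact Ioo_subset_Ioo_right hc.2.le
      · simp
      · exact Ioo_subset_Ioo_left hc.1.le
      · simp
  exact fun s t hst => key _ s t hst rfl

theorem MeasureTheory.Martingale.setLIntegral_sq_eq_add {ι Ω : Type*} [LinearOrder ι]
    {mΩ : MeasurableSpace Ω} {P : Measure Ω} [IsFiniteMeasure P] {𝓕 : Filtration ι mΩ}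
    {M : ι → Ω → ℝ} (hM : Martingale M 𝓕 P)
    (hL : ∀ t, MemLp (M t) 2 P) {s t : ι} (hst : s ≤ t) {B : Set Ω} (hB : MeasurableSet[𝓕 s] B) :
    ∫⁻ ω in B, ‖M t ω‖ₑ ^ 2 ∂P =
      ∫⁻ ω in B, ‖M s ω‖ₑ ^ 2 ∂P + ∫⁻ ω in B, ‖M t ω - M s ω‖ₑ ^ 2 ∂P := by
  have h := hM.setIntegral_sq_sub hL hst hB
  rw [integral_sub (hL t).integrable_sq.integrableOn (hL s).integrable_sq.integrableOn] at h
  have key : ∀ {X : Ω → ℝ}, MemLp X 2 P →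
      ∫⁻ ω in B, ‖X ω‖ₑ ^ 2 ∂P = ENNReal.ofReal (∫ ω in B, X ω ^ 2 ∂P) := fun hX => by
    rw [ofReal_integral_eq_lintegral_ofReal hX.integrable_sq.integrableOn
      (Eventually.of_forall fun _ => sq_nonneg _)]
    simp_rw [enorm_sq_eq_ofReal, Real.norm_eq_abs, sq_abs]
  have hsub : ∫⁻ ω in B, ‖M t ω - M s ω‖ₑ ^ 2 ∂P =
      ENNReal.ofReal (∫ ω in B, (M t ω - M s ω) ^ 2 ∂P) := key ((hL t).sub (hL s))
  rw [key (hL t), key (hL s), hsub, ← ENNReal.ofReal_add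
    (integral_nonneg fun _ => sq_nonneg _) (integral_nonneg fun _ => sq_nonneg _)]
  congr 1
  linarith

namespace RandomFlow

variable {T : ℝ≥0} {Ω : Type*} [mΩ : MeasurableSpace Ω] {y : RandomFlow T Ω} {P : Measure Ω}

/-- `M` is the integral of the integrand `f`, which is constant in time on the intervals cut out by
a finite set of times. -/
structure IsStepIntegral (y : RandomFlow T Ω) (P : Measure Ω) (f : TimeInterval T → Ω → L2)
    (M : TimeInterval T → Ω → ℝ) : Prop where
  zero : ∀ ω, M ⊥ ω = 0
  continuous : ∀ ω, Continuous fun t => M t ω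
  step : ∃ S : Finset (TimeInterval T), ∀ s t, s ≤ t → (∀ c ∈ S, c ∉ Ioo s t) →
    ∃ φ : Ω → L2, StronglyMeasurable[y.filtration s] φ ∧ MemLp φ 2 P ∧
      (∀ r ∈ Ioc s t, ∀ ω, f r ω = φ ω) ∧
      ∀ ω, M t ω - M s ω = inner ℝ (φ ω) (y.toL2 t ω - y.toL2 s ω)

/-- The increments of `M²` and of `∫ ‖pr_y f‖²` have the same conditional expectations. -/
def HasEnergy (y : RandomFlow T Ω) (P : Measure Ω) (f : TimeInterval T → Ω → L2)
    (M : TimeInterval T → Ω → ℝ) : Prop :=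
  ∀ s t, s ≤ t → ∀ B, MeasurableSet[y.filtration s] B →
    ∫⁻ ω in B, ‖M t ω‖ₑ ^ 2 ∂P = ∫⁻ ω in B, ‖M s ω‖ₑ ^ 2 ∂P +
      ∫⁻ ω in B, ∫⁻ r in Ioc s t, ‖pr (y.toL2 r ω) (f r ω)‖ₑ ^ 2 ∂timeLeb T ∂P

theorem measurable_lintegral_sq_pr (y : RandomFlow T Ω) {f : TimeInterval T → Ω → L2}
    (hf : StronglyMeasurable (Function.uncurry f)) (I : Set (TimeInterval T)) :
    Measurable fun ω => ∫⁻ r in I, ‖pr (y.toL2 r ω) (f r ω)‖ₑ ^ 2 ∂timeLeb T := by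
  have h := y.measurable_sq_enorm_pr (α := Ω × TimeInterval T) (f := fun q => f q.2 q.1)
    measurable_snd measurable_fst (hf.comp_measurable measurable_swap)
  exact h.lintegral_prod_right'

namespace IsStepIntegral

variable {f f' : TimeInterval T → Ω → L2} {M M' : TimeInterval T → Ω → ℝ}

/-- Two simple processes have different partitions. Here the finite set of times is not part of the
data, so the union of the two sets serves for the difference. -/
theorem sub (h : y.IsStepIntegral P f M) (h' : y.IsStepIntegral P f' M') :
    y.IsStepIntegral P (fun t ω => f t ω - f' t ω) (fun t ω => M t ω - M' t ω) := by
  classical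
  obtain ⟨S, hS⟩ := h.step
  obtain ⟨S', hS'⟩ := h'.step
  refine ⟨fun ω => by rw [h.zero, h'.zero, sub_zero], fun ω => (h.continuous ω).sub
    (h'.continuous ω), S ∪ S', fun s t hst hfree => ?_⟩
  obtain ⟨φ, h1, h2, h3, h4⟩ := hS s t hst fun c hc => hfree c (Finset.mem_union_left _ hc)
  obtain ⟨φ', h1', h2', h3', h4'⟩ := hS' s t hst fun c hc => hfree c (Finset.mem_union_right _ hc)
  refine ⟨fun ω => φ ω - φ' ω, h1.sub h1', h2.sub h2', fun r hr ω => ?_, fun ω => ?_⟩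
  · rw [h3 r hr, h3' r hr]
  · rw [inner_sub_left, ← h4, ← h4']
    ring

theorem stronglyAdapted (h : y.IsStepIntegral P f M) : StronglyAdapted y.filtration M := by
  obtain ⟨S, hS⟩ := h.step
  have h1 : ∀ s t, s ≤ t → StronglyMeasurable[y.filtration s] (M s) →
      StronglyMeasurable[y.filtration t] (M t) := by
    refine forall_le_of_forall_free S (fun s t hst hfree hs => ?_)
      (fun s c t _ _ h1 h2 h3 => h2 (h1 h3))
    obtain ⟨φ, h1, h2, h3, h4⟩ := hS s t hst hfree
    have : M t = fun ω => M s ω + inner ℝ (φ ω) (y.toL2 t ω - y.toL2 s ω) := by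
      funext ω
      rw [← h4]
      ring
    rw [this]
    exact (hs.mono (y.filtration.mono hst)).add ((h1.mono (y.filtration.mono hst)).inner
      ((y.stronglyAdapted_toL2 t).sub ((y.stronglyAdapted_toL2 s).mono (y.filtration.mono hst))))
  intro t
  refine h1 ⊥ t bot_le ?_
  have : M ⊥ = fun _ => 0 := funext h.zero
  rw [this]
  exact stronglyMeasurable_const

variable [IsProbabilityMeasure P]

/-- The product of two square integrable factors is only integrable in general. Here the isometry
and the contraction `pr` bound its second moment by that of `φ` times the length of the interval. -/
theorem _root_.RandomFlow.IsModifiedArratiaFlow.memLp_inner_increment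
    (hy : y.IsModifiedArratiaFlow P) {s t : TimeInterval T}
    (hst : s ≤ t) {φ : Ω → L2} (hφ : StronglyMeasurable[y.filtration s] φ) (hL : MemLp φ 2 P) :
    MemLp (fun ω => inner ℝ (φ ω) (y.toL2 t ω - y.toL2 s ω)) 2 P := by
  have hΔm : StronglyMeasurable fun ω => y.toL2 t ω - y.toL2 s ω :=
    ((y.stronglyAdapted_toL2 t).mono (y.filtration.le t)).sub
      ((y.stronglyAdapted_toL2 s).mono (y.filtration.le s))
  refine ⟨((hφ.mono (y.filtration.le s)).inner hΔm).aestronglyMeasurable, ?_⟩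
  refine (ENNReal.pow_lt_top_iff (n := 2).1 ?_).resolve_right two_ne_zero
  rw [sq_eLpNorm_two]
  have h := hy.setLIntegral_sq_inner_increment hst hφ MeasurableSet.univ
  rw [Measure.restrict_univ] at h
  rw [h]
  calc ∫⁻ ω, ∫⁻ r in Ioc s t, ‖pr (y.toL2 r ω) (φ ω)‖ₑ ^ 2 ∂timeLeb T ∂P
      ≤ ∫⁻ ω, ‖φ ω‖ₑ ^ 2 * timeLeb T (Ioc s t) ∂P := by
        refine lintegral_mono fun ω => ?_
        rw [← setLIntegral_const]
        refine lintegral_mono fun r => ?_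
        gcongr
        exact enorm_pr_le _ _
    _ = (∫⁻ ω, ‖φ ω‖ₑ ^ 2 ∂P) * timeLeb T (Ioc s t) :=
        lintegral_mul_const' _ _ (measure_ne_top _ _)
    _ < ∞ := by
        refine ENNReal.mul_lt_top ?_ (measure_lt_top _ _)
        rw [← sq_eLpNorm_two]
        exact ENNReal.pow_lt_top hL.2

theorem isContSqMartingale (h : y.IsStepIntegral P f M) (hy : y.IsModifiedArratiaFlow P) :
    IsContSqMartingale y.filtration P M := by
  obtain ⟨S, hS⟩ := h.step
  have hL : ∀ t, MemLp (M t) 2 P := by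
    have h1 : ∀ s t, s ≤ t → MemLp (M s) 2 P → MemLp (M t) 2 P := by
      refine forall_le_of_forall_free S (fun s t hst hfree hs => ?_)
        (fun s c t _ _ h1 h2 h3 => h2 (h1 h3))
      obtain ⟨φ, h1, h2, h3, h4⟩ := hS s t hst hfree
      have : M t = fun ω => M s ω + inner ℝ (φ ω) (y.toL2 t ω - y.toL2 s ω) := by
        funext ω
        rw [← h4]
        ring
      rw [this]
      exact hs.add (hy.memLp_inner_increment hst h1 h2)
    intro t
    refine h1 ⊥ t bot_le ?_
    have : M ⊥ = fun _ => 0 := funext h.zero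
    rw [this]
    exact memLp_const 0
  have hint : ∀ t, Integrable (M t) P := fun t => (hL t).integrable one_le_two
  refine ⟨martingale_of_setIntegral_eq h.stronglyAdapted hint ?_, hL,
    Eventually.of_forall h.continuous⟩
  refine forall_le_of_forall_free S (fun s t hst hfree B hB => ?_)
    (fun s c t hsc hct h1 h2 B hB => (h1 B hB).trans (h2 B (y.filtration.mono hsc _ hB)))
  obtain ⟨φ, h1, h2, h3, h4⟩ := hS s t hst hfree
  have h5 := hy.setIntegral_inner_increment hst h1 h2 hB
  simp_rw [← h4] at h5
  rw [integral_sub (hint t).integrableOn (hint s).integrableOn] at h5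
  linarith

/-- On an interval without breakpoints this is orthogonality of increments followed by the isometry;
over adjacent intervals the energies add up. -/
theorem hasEnergy (h : y.IsStepIntegral P f M) (hy : y.IsModifiedArratiaFlow P)
    (hf : StronglyMeasurable (Function.uncurry f)) : y.HasEnergy P f M := by
  obtain ⟨S, hS⟩ := h.step
  have hM := h.isContSqMartingale hy
  refine forall_le_of_forall_free S (fun s t hst hfree B hB => ?_)
    (fun s c t hsc hct h1 h2 B hB => ?_)
  · obtain ⟨φ, h1, h2, h3, h4⟩ := hS s t hst hfree
    rw [hM.martingale.setLIntegral_sq_eq_add hM.memLp hst hB]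
    congr 1
    simp_rw [h4]
    rw [hy.setLIntegral_sq_inner_increment hst h1 hB]
    refine lintegral_congr fun ω => ?_
    refine setLIntegral_congr_fun measurableSet_Ioc fun r hr => ?_
    simp only [h3 r hr]
  · rw [h2 B (y.filtration.mono hsc _ hB), h1 B hB, add_assoc,
      ← lintegral_add_left (y.measurable_lintegral_sq_pr hf _)]
    congr 1
    refine lintegral_congr fun ω => ?_
    rw [← Ioc_union_Ioc_eq_Ioc hsc hct, lintegral_union measurableSet_Ioc
      (by rw [Set.disjoint_left]; intro a ha ha2; exact absurd ha.2 (not_le.2 ha2.1))]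

end IsStepIntegral

/-- As `pr` is a contraction, the energy identity makes the integral operator bounded with norm at
most one from `𝓐²` to `𝓜₂`. -/
theorem HasEnergy.sqNormM2_le {f : TimeInterval T → Ω → L2} {M : TimeInterval T → Ω → ℝ}
    (h : y.HasEnergy P f M) (h0 : ∀ᵐ ω ∂P, M ⊥ ω = 0) : sqNormM2 P M ≤ sqNormA2 P f := by
  have h1 := h ⊥ ⊤ bot_le univ MeasurableSet.univ
  simp only [Measure.restrict_univ] at h1
  have h2 : ∫⁻ ω, ‖M ⊥ ω‖ₑ ^ 2 ∂P = 0 := by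
    rw [lintegral_congr_ae (g := fun _ => 0)]
    · simp
    · filter_upwards [h0] with ω hω
      simp [hω]
  rw [sqNormM2, h1, h2, zero_add]
  refine lintegral_mono fun ω => ?_
  refine (setLIntegral_le_lintegral _ _).trans (lintegral_mono fun r => ?_)
  gcongr
  exact enorm_pr_le _ _

end RandomFlow

/-! ### Predictability of simple processes. -/

theorem MeasureTheory.stronglyMeasurable_indicator_prod {α Ω E : Type*} [TopologicalSpace E]
    [Zero E] {m : MeasurableSpace Ω} {m' : MeasurableSpace (α × Ω)} {J : Set α}
    (hJ : ∀ A, MeasurableSet[m] A → MeasurableSet[m'] (J ×ˢ A)) {φ : Ω → E}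
    (hφ : StronglyMeasurable φ) :
    StronglyMeasurable fun p : α × Ω => J.indicator (fun _ => φ p.2) p.1 := by
  classical
  -- The predictable σ-algebra is not a product, so only rectangles over `J` are available. For a
  -- simple approximation of `φ` every preimage is such a rectangle, together with the complement of
  -- the strip over `J` when the set contains zero.
  have hset : ∀ n (B : Set E), MeasurableSet
      ((fun p : α × Ω => J.indicator (fun _ => hφ.approx n p.2) p.1) ⁻¹' B) := by
    intro n B
    have hA : MeasurableSet (hφ.approx n ⁻¹' B) := (hφ.approx n).measurableSet_preimage B
    have h1 : MeasurableSet (J ×ˢ (univ : Set Ω)) := hJ _ MeasurableSet.univ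
    by_cases h0 : (0 : E) ∈ B
    · have : ((fun p : α × Ω => J.indicator (fun _ => hφ.approx n p.2) p.1) ⁻¹' B) =
          J ×ˢ (hφ.approx n ⁻¹' B) ∪ (J ×ˢ (univ : Set Ω))ᶜ := by
        ext p
        by_cases hp : p.1 ∈ J <;> simp [hp, h0]
      rw [this]
      exact (hJ _ hA).union h1.compl
    · have : ((fun p : α × Ω => J.indicator (fun _ => hφ.approx n p.2) p.1) ⁻¹' B) =
          J ×ˢ (hφ.approx n ⁻¹' B) := by
        ext p
        by_cases hp : p.1 ∈ J <;> simp [hp, h0]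
      rw [this]
      exact hJ _ hA
  refine ⟨fun n => ⟨fun p => J.indicator (fun _ => hφ.approx n p.2) p.1, fun x => hset n {x}, ?_⟩,
    fun p => ?_⟩
  · refine ((hφ.approx n).finite_range.insert 0).subset ?_
    rintro _ ⟨p, rfl⟩
    by_cases hp : p.1 ∈ J
    · exact Or.inr ⟨p.2, by simp [hp]⟩
    · exact Or.inl (by simp [hp])
  · by_cases hp : p.1 ∈ J
    · simpa [hp] using hφ.tendsto_approx p.2
    · simpa [hp] using tendsto_const_nhds

section Predictable

variable {T : ℝ≥0} {Ω : Type*} {mΩ : MeasurableSpace Ω} {𝓕 : Filtration (TimeInterval T) mΩ}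
  {P : Measure Ω}

theorem predictable_le_prod : 𝓕.predictable ≤ (inferInstance : MeasurableSpace (TimeInterval T × Ω)) :=
  measurableSpace_le_predictable_of_measurableSet
    (fun A hA => (measurableSet_singleton _).prod (𝓕.le _ A hA))
    (fun _ A hA => measurableSet_Ioi.prod (𝓕.le _ A hA))

theorem MeasureTheory.IsStronglyPredictable.stronglyMeasurable_uncurry {E : Type*}
    [TopologicalSpace E] {f : TimeInterval T → Ω → E} (hf : IsStronglyPredictable 𝓕 f) :
    StronglyMeasurable (Function.uncurry f) :=
  StronglyMeasurable.mono hf predictable_le_prod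

theorem sqNormA2_eq_eLpNorm [SFinite P] {f : TimeInterval T → Ω → L2}
    (hf : StronglyMeasurable (Function.uncurry f)) :
    sqNormA2 P f = eLpNorm (Function.uncurry f) 2 ((timeLeb T).prod P) ^ 2 := by
  rw [sq_eLpNorm_two, lintegral_prod_symm]
  · rfl
  · exact (hf.enorm.pow_const 2).aemeasurable

theorem MemA2.memLp [SFinite P] {f : TimeInterval T → Ω → L2} (hf : MemA2 𝓕 P f) :
    MemLp (Function.uncurry f) 2 ((timeLeb T).prod P) := by
  have h := hf.1.stronglyMeasurable_uncurry
  refine ⟨h.aestronglyMeasurable, (ENNReal.pow_lt_top_iff (n := 2).1 ?_).resolve_right two_ne_zero⟩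
  rw [← sqNormA2_eq_eLpNorm h]
  exact hf.2

namespace SimpleIntegrand

variable (g : SimpleIntegrand 𝓕 P)

theorem t_le {i j : ℕ} (hij : i ≤ j) (hj : j ≤ g.n) : g.t i ≤ g.t j := by
  induction j, hij using Nat.le_induction with
  | base => exact le_rfl
  | succ k _ ih => exact (ih (by omega)).trans (g.t_lt k (by omega)).le

/-- With `n = 0` the partition would force `T = 0`. Positivity matters because `φ 0` is the value at
time zero while its measurability is assumed only for `0 < n`. -/
theorem n_pos (hT : 0 < T) : 0 < g.n := by
  rcases Nat.eq_zero_or_pos g.n with h | h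
  · have h1 := g.t_zero
    rw [← h, g.t_last] at h1
    have h2 : (T : ℝ) = 0 := congrArg Subtype.val h1
    exact absurd h2 (by exact_mod_cast hT.ne')
  · exact h

theorem exists_mem_Ioc {r : TimeInterval T} (hr : ⊥ < r) :
    ∃ k < g.n, r ∈ Ioc (g.t k) (g.t (k + 1)) := by
  classical
  have hex : ∃ j, r ≤ g.t j := ⟨g.n, by rw [g.t_last]; exact le_top⟩
  have h0 : Nat.find hex ≠ 0 := fun h => by
    have := Nat.find_spec hex
    rw [h, g.t_zero] at this
    exact absurd this (not_le.2 hr)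
  obtain ⟨k, hk⟩ := Nat.exists_eq_succ_of_ne_zero h0
  have hle : Nat.find hex ≤ g.n := Nat.find_min' hex (by rw [g.t_last]; exact le_top)
  refine ⟨k, by omega, not_le.1 (Nat.find_min hex (m := k) (by omega)), ?_⟩
  have := Nat.find_spec hex
  rwa [hk] at this

theorem process_eq {k : ℕ} (hk : k < g.n) {r : TimeInterval T}
    (hr : r ∈ Ioc (g.t k) (g.t (k + 1))) (ω : Ω) : g.process r ω = g.φ k ω := by
  have h0 : r ∉ ({⊥} : Set (TimeInterval T)) := fun h => by
    rw [mem_singleton_iff.1 h] at hr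
    exact not_lt_bot hr.1
  rw [process, indicator_of_notMem h0, zero_add, Finset.sum_eq_single k]
  · rw [indicator_of_mem hr]
  · intro j hj hjk
    refine indicator_of_notMem (fun h => ?_) _
    rcases lt_or_gt_of_ne hjk with h1 | h1
    · exact absurd (hr.1.trans_le (h.2.trans (g.t_le h1 hk.le))) (lt_irrefl _)
    · exact absurd (h.1.trans_le (hr.2.trans (g.t_le h1 (Finset.mem_range.1 hj).le))) (lt_irrefl _)
  · exact fun h => absurd (Finset.mem_range.2 hk) h

theorem isStronglyPredictable (hT : 0 < T) : IsStronglyPredictable 𝓕 g.process := by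
  have h1 : StronglyMeasurable[𝓕.predictable] fun p : TimeInterval T × Ω =>
      ({⊥} : Set (TimeInterval T)).indicator (fun _ => g.φ 0 p.2) p.1 := by
    refine stronglyMeasurable_indicator_prod (m := 𝓕 ⊥)
      (fun A hA => measurableSet_predictable_singleton_bot_prod hA) ?_
    have := g.measurable 0 (g.n_pos hT)
    rwa [g.t_zero] at this
  have h2 : ∀ k ∈ Finset.range g.n, StronglyMeasurable[𝓕.predictable]
      fun p : TimeInterval T × Ω =>
        (Ioc (g.t k) (g.t (k + 1))).indicator (fun _ => g.φ k p.2) p.1 := fun k hk =>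
    stronglyMeasurable_indicator_prod (m := 𝓕 (g.t k))
      (fun A hA => measurableSet_predictable_Ioc_prod _ _ hA)
      (g.measurable k (Finset.mem_range.1 hk))
  exact h1.add (Finset.stronglyMeasurable_fun_sum _ h2)

theorem memA2 (hT : 0 < T) [IsFiniteMeasure P] : MemA2 𝓕 P g.process := by
  refine ⟨g.isStronglyPredictable hT, ?_⟩
  have hN : MemLp (fun ω => ‖g.φ 0 ω‖ + ∑ k ∈ Finset.range g.n, ‖g.φ k ω‖) 2 P :=
    (g.memLp 0 (g.n_pos hT)).norm.add (memLp_finsetSum _ fun k hk =>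
      (g.memLp k (Finset.mem_range.1 hk)).norm)
  have hle : ∀ t ω, ‖g.process t ω‖ ≤ ‖‖g.φ 0 ω‖ + ∑ k ∈ Finset.range g.n, ‖g.φ k ω‖‖ := by
    intro t ω
    rw [Real.norm_of_nonneg (by positivity)]
    refine (norm_add_le _ _).trans (add_le_add (norm_indicator_le_norm_self _ _)
      ((norm_sum_le _ _).trans (Finset.sum_le_sum fun k _ => norm_indicator_le_norm_self _ _)))
  calc sqNormA2 P g.process
      ≤ ∫⁻ ω, ‖‖g.φ 0 ω‖ + ∑ k ∈ Finset.range g.n, ‖g.φ k ω‖‖ₑ ^ 2 * timeLeb T univ ∂P := by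
        refine lintegral_mono fun ω => ?_
        rw [← lintegral_const]
        refine lintegral_mono fun t => ?_
        gcongr
        exact enorm_le_iff_norm_le.2 (hle t ω)
    _ = (∫⁻ ω, ‖‖g.φ 0 ω‖ + ∑ k ∈ Finset.range g.n, ‖g.φ k ω‖‖ₑ ^ 2 ∂P) * timeLeb T univ :=
        lintegral_mul_const' _ _ (measure_ne_top _ _)
    _ < ∞ := by
        refine ENNReal.mul_lt_top ?_ (measure_lt_top _ _)
        rw [← sq_eLpNorm_two]
        exact ENNReal.pow_lt_top hN.2

end SimpleIntegrand

/-- `f` is constant in time on the intervals cut out by a finite set of times; its values are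
square integrable and known at the beginning of these intervals. -/
def IsPiecewiseConstant (𝓕 : Filtration (TimeInterval T) mΩ) (P : Measure Ω)
    (f : TimeInterval T → Ω → L2) : Prop :=
  ∃ S : Finset (TimeInterval T), ∀ s t, s ≤ t → (∀ c ∈ S, c ∉ Ioo s t) →
    ∃ φ : Ω → L2, StronglyMeasurable[𝓕 s] φ ∧ MemLp φ 2 P ∧ ∀ r ∈ Ioc s t, ∀ ω, f r ω = φ ω

theorem SimpleIntegrand.mem_Ioc_of_free (g : SimpleIntegrand 𝓕 P) {s t : TimeInterval T}
    (hst : s < t) (hfree : ∀ c ∈ (Finset.range (g.n + 1)).image g.t, c ∉ Ioo s t) :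
    ∃ k < g.n, g.t k ≤ s ∧ t ≤ g.t (k + 1) := by
  obtain ⟨k, hk, hkt⟩ := g.exists_mem_Ioc (bot_le.trans_lt hst)
  refine ⟨k, hk, not_lt.1 fun h => ?_, hkt.2⟩
  exact hfree _ (Finset.mem_image_of_mem _ (Finset.mem_range.2 (by omega))) ⟨h, hkt.1⟩

theorem SimpleIntegrand.isPiecewiseConstant (g : SimpleIntegrand 𝓕 P) : IsPiecewiseConstant 𝓕 P g.process := by
  refine ⟨(Finset.range (g.n + 1)).image g.t, fun s t hst hfree => ?_⟩
  rcases hst.eq_or_lt with rfl | hlt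
  · exact ⟨fun _ => 0, stronglyMeasurable_const, MemLp.zero', fun r hr => by simp at hr⟩
  obtain ⟨k, hk, h1, h2⟩ := g.mem_Ioc_of_free hlt hfree
  exact ⟨g.φ k, (g.measurable k hk).mono (𝓕.mono h1), g.memLp k hk, fun r hr ω =>
    g.process_eq hk ⟨h1.trans_lt hr.1, hr.2.trans h2⟩ ω⟩

namespace IsPiecewiseConstant

variable {f f' : TimeInterval T → Ω → L2}

theorem sub (h : IsPiecewiseConstant 𝓕 P f) (h' : IsPiecewiseConstant 𝓕 P f') :
    IsPiecewiseConstant 𝓕 P fun t ω => f t ω - f' t ω := by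
  classical
  obtain ⟨S, hS⟩ := h
  obtain ⟨S', hS'⟩ := h'
  refine ⟨S ∪ S', fun s t hst hfree => ?_⟩
  obtain ⟨φ, h1, h2, h3⟩ := hS s t hst fun c hc => hfree c (Finset.mem_union_left _ hc)
  obtain ⟨φ', h1', h2', h3'⟩ := hS' s t hst fun c hc => hfree c (Finset.mem_union_right _ hc)
  exact ⟨fun ω => φ ω - φ' ω, h1.sub h1', h2.sub h2', fun r hr ω => by
    simp only [h3 r hr, h3' r hr]⟩

/-- The breakpoints together with both end points, listed in increasing order, form the partition.
Time zero is excluded because piecewise constancy says nothing about the value there; it is a null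
time. -/
theorem exists_simpleIntegrand (h : IsPiecewiseConstant 𝓕 P f) (hT : 0 < T) :
    ∃ g : SimpleIntegrand 𝓕 P, ∀ r, ⊥ < r → ∀ ω, g.process r ω = f r ω := by
  classical
  obtain ⟨S, hS⟩ := h
  have hbt : (⊥ : TimeInterval T) ≠ ⊤ := fun h => by
    have h2 : (0 : ℝ) = T := congrArg Subtype.val h
    exact absurd h2 (by exact_mod_cast hT.ne)
  set S' := insert ⊥ (insert ⊤ S) with hS'
  have hcard : 0 < S'.card := Finset.card_pos.2 ⟨⊥, by simp [hS']⟩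
  obtain ⟨n, hn⟩ := Nat.exists_eq_succ_of_ne_zero hcard.ne'
  let e := S'.orderEmbOfFin hn
  let τ : ℕ → TimeInterval T := fun k => if h : k < n + 1 then e ⟨k, h⟩ else ⊤
  have hτ : ∀ k (h : k < n + 1), τ k = e ⟨k, h⟩ := fun k h => dif_pos h
  have hmem : ∀ c ∈ S', ∃ j : Fin (n + 1), e j = c := fun c hc => by
    have : c ∈ Set.range e := by rw [Finset.range_orderEmbOfFin]; exact hc
    exact this
  have hlt : ∀ k < n, τ k < τ (k + 1) := fun k hk => by
    rw [hτ k (by omega), hτ (k + 1) (by omega)]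
    exact e.strictMono (by simp)
  have hfree : ∀ k < n, ∀ c ∈ S, c ∉ Ioo (τ k) (τ (k + 1)) := fun k hk c hc hmid => by
    obtain ⟨j, rfl⟩ := hmem c (by simp [hS', hc])
    rw [hτ k (by omega), hτ (k + 1) (by omega)] at hmid
    have h1 := e.lt_iff_lt.1 hmid.1
    have h2 := e.lt_iff_lt.1 hmid.2
    rw [Fin.lt_def] at h1 h2
    simp only at h1 h2
    omega
  have hch : ∀ k, ∃ φ : Ω → L2, k < n → (StronglyMeasurable[𝓕 (τ k)] φ ∧ MemLp φ 2 P ∧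
      ∀ r ∈ Ioc (τ k) (τ (k + 1)), ∀ ω, f r ω = φ ω) := fun k => by
    by_cases hk : k < n
    · obtain ⟨φ, hφ⟩ := hS _ _ (hlt k hk).le (hfree k hk)
      exact ⟨φ, fun _ => hφ⟩
    · exact ⟨0, fun h => absurd h hk⟩
  choose φ hφ using hch
  let g : SimpleIntegrand 𝓕 P :=
    { n := n
      t := τ
      φ := φ
      t_zero := by
        obtain ⟨j, hj⟩ := hmem ⊥ (by simp [hS'])
        rw [hτ 0 (by omega)]
        refine le_antisymm ?_ bot_le
        rw [← hj]
        exact e.monotone (Fin.zero_le j)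
      t_last := by
        obtain ⟨j, hj⟩ := hmem ⊤ (by simp [hS'])
        rw [hτ n (by omega)]
        refine le_antisymm le_top ?_
        rw [← hj]
        exact e.monotone (Fin.le_last j)
      t_lt := hlt
      measurable := fun k hk => (hφ k hk).1
      memLp := fun k hk => (hφ k hk).2.1 }
  refine ⟨g, fun r hr ω => ?_⟩
  obtain ⟨k, hk, hkr⟩ := g.exists_mem_Ioc hr
  rw [g.process_eq hk hkr, (hφ k hk).2.2 r hkr]

end IsPiecewiseConstant

end Predictable

/-! ### Integrals of simple processes are step integrals. -/

namespace RandomFlow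

variable {T : ℝ≥0} {Ω : Type*} [mΩ : MeasurableSpace Ω] {y : RandomFlow T Ω} {P : Measure Ω}

theorem isStepIntegral_simpleIntegral (g : SimpleIntegrand y.filtration P) :
    y.IsStepIntegral P g.process (y.simpleIntegral g) := by
  refine ⟨fun ω => ?_, fun ω => ?_, (Finset.range (g.n + 1)).image g.t, fun s t hst hfree => ?_⟩
  · simp [simpleIntegral]
  · refine continuous_finsetSum _ fun k _ => continuous_const.inner ?_
    exact ((y.continuous_toL2 ω).comp (continuous_const.min continuous_id)).sub
      ((y.continuous_toL2 ω).comp (continuous_const.min continuous_id))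
  rcases hst.eq_or_lt with rfl | hlt
  · exact ⟨fun _ => 0, stronglyMeasurable_const, MemLp.zero', fun r hr => by simp at hr,
      fun ω => by simp⟩
  obtain ⟨k, hk, h1, h2⟩ := g.mem_Ioc_of_free hlt hfree
  refine ⟨g.φ k, (g.measurable k hk).mono (y.filtration.mono h1), g.memLp k hk, fun r hr ω =>
    g.process_eq hk ⟨h1.trans_lt hr.1, hr.2.trans h2⟩ ω, fun ω => ?_⟩
  -- An interval without partition points lies in one cell `k`; every other summand has the same
  -- value at both of its ends.
  rw [simpleIntegral, simpleIntegral, ← Finset.sum_sub_distrib, Finset.sum_eq_single k]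
  · rw [← inner_sub_right, min_eq_right h2, min_eq_right (hst.trans h2), min_eq_left h1,
      min_eq_left (h1.trans hst)]
    congr 1
    abel
  · intro j hj hjk
    have hj' := Finset.mem_range.1 hj
    rw [← inner_sub_right]
    rcases lt_or_gt_of_ne hjk with h3 | h3
    · have h4 : g.t (j + 1) ≤ s := (g.t_le h3 hk.le).trans h1
      have h5 : g.t j ≤ s := (g.t_lt j hj').le.trans h4
      rw [min_eq_left h4, min_eq_left (h4.trans hst), min_eq_left h5, min_eq_left (h5.trans hst),
        sub_self, inner_zero_right]
    · have h5 : t ≤ g.t j := h2.trans (g.t_le h3 hj'.le)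
      have h4 : t ≤ g.t (j + 1) := h5.trans (g.t_lt j hj').le
      rw [min_eq_right h4, min_eq_right (hst.trans h4), min_eq_right h5, min_eq_right (hst.trans h5)]
      simp
  · exact fun h => absurd (Finset.mem_range.2 hk) h

end RandomFlow

/-! ### Simple processes are dense in `𝓐²`. -/

section Density

variable {T : ℝ≥0} {Ω : Type*} {mΩ : MeasurableSpace Ω} {𝓕 : Filtration (TimeInterval T) mΩ}
  {P : Measure Ω}

theorem ae_prod_bot_lt [SFinite P] : ∀ᵐ p ∂(timeLeb T).prod P, (⊥ : TimeInterval T) < p.1 := by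
  rw [ae_iff]
  have : {p : TimeInterval T × Ω | ¬ ⊥ < p.1} = {⊥} ×ˢ univ := by
    ext p
    simp [bot_lt_iff_ne_bot]
  rw [this, Measure.prod_prod, measure_singleton, zero_mul]

/-- `F` is a limit of simple processes in `L²(dt ⊗ P)`. -/
def IsSimpleLimit (𝓕 : Filtration (TimeInterval T) mΩ) (P : Measure Ω)
    (F : TimeInterval T × Ω → L2) : Prop :=
  AEStronglyMeasurable F ((timeLeb T).prod P) ∧ ∀ ε : ℝ≥0∞, ε ≠ 0 →
    ∃ g : SimpleIntegrand 𝓕 P,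
      eLpNorm (F - Function.uncurry g.process) 2 ((timeLeb T).prod P) ≤ ε

namespace IsSimpleLimit

variable {F G : TimeInterval T × Ω → L2}

theorem congr (h : IsSimpleLimit 𝓕 P F) (hFG : F =ᵐ[(timeLeb T).prod P] G) :
    IsSimpleLimit 𝓕 P G := by
  refine ⟨h.1.congr hFG, fun ε hε => ?_⟩
  obtain ⟨g, hg⟩ := h.2 ε hε
  refine ⟨g, ?_⟩
  rwa [← eLpNorm_congr_ae (hFG.sub (EventuallyEq.refl _ _))]

theorem of_forall_near (hF : AEStronglyMeasurable F ((timeLeb T).prod P)) (hT : 0 < T)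
    (h : ∀ ε : ℝ≥0∞, ε ≠ 0 → ∃ G, IsSimpleLimit 𝓕 P G ∧
      eLpNorm (F - G) 2 ((timeLeb T).prod P) ≤ ε) : IsSimpleLimit 𝓕 P F := by
  refine ⟨hF, fun ε hε => ?_⟩
  obtain ⟨G, hG, hFG⟩ := h (ε / 2) (ENNReal.half_pos hε).ne'
  obtain ⟨g, hg⟩ := hG.2 (ε / 2) (ENNReal.half_pos hε).ne'
  refine ⟨g, ?_⟩
  have hgm := (g.isStronglyPredictable hT).stronglyMeasurable_uncurry
  calc eLpNorm (F - Function.uncurry g.process) 2 ((timeLeb T).prod P)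
      = eLpNorm ((F - G) + (G - Function.uncurry g.process)) 2 ((timeLeb T).prod P) := by
        rw [sub_add_sub_cancel]
    _ ≤ ε / 2 + ε / 2 := (eLpNorm_add_le (hF.sub hG.1) (hG.1.sub hgm.aestronglyMeasurable)
        one_le_two).trans (add_le_add hFG hg)
    _ = ε := ENNReal.add_halves ε

variable [SFinite P]

theorem of_isPiecewiseConstant {f : TimeInterval T → Ω → L2} (hT : 0 < T)
    (hf : IsPiecewiseConstant 𝓕 P f) : IsSimpleLimit 𝓕 P (Function.uncurry f) := by
  obtain ⟨g, hg⟩ := hf.exists_simpleIntegrand hT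
  have h : Function.uncurry g.process =ᵐ[(timeLeb T).prod P] Function.uncurry f := by
    filter_upwards [ae_prod_bot_lt] with p hp using hg p.1 hp p.2
  have hgm := (g.isStronglyPredictable hT).stronglyMeasurable_uncurry
  refine IsSimpleLimit.congr ⟨hgm.aestronglyMeasurable, fun ε _ => ⟨g, ?_⟩⟩ h
  simp

theorem sub (hT : 0 < T) (hF : IsSimpleLimit 𝓕 P F) (hG : IsSimpleLimit 𝓕 P G) :
    IsSimpleLimit 𝓕 P (F - G) := by
  refine of_forall_near (hF.1.sub hG.1) hT fun ε hε => ?_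
  obtain ⟨f, hf⟩ := hF.2 (ε / 2) (ENNReal.half_pos hε).ne'
  obtain ⟨g, hg⟩ := hG.2 (ε / 2) (ENNReal.half_pos hε).ne'
  refine ⟨_, of_isPiecewiseConstant hT (f.isPiecewiseConstant.sub g.isPiecewiseConstant), ?_⟩
  have hfm := (f.isStronglyPredictable hT).stronglyMeasurable_uncurry.aestronglyMeasurable
    (μ := (timeLeb T).prod P)
  have hgm := (g.isStronglyPredictable hT).stronglyMeasurable_uncurry.aestronglyMeasurable
    (μ := (timeLeb T).prod P)
  have : F - G - (Function.uncurry fun t ω => f.process t ω - g.process t ω) =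
      (F - Function.uncurry f.process) - (G - Function.uncurry g.process) := by
    funext p
    simp only [Pi.sub_apply, Function.uncurry]
    abel
  rw [this]
  calc _ ≤ ε / 2 + ε / 2 := (eLpNorm_sub_le (hF.1.sub hfm) (hG.1.sub hgm) one_le_two).trans
        (add_le_add hf hg)
    _ = ε := ENNReal.add_halves ε

theorem zero (hT : 0 < T) : IsSimpleLimit 𝓕 P (0 : TimeInterval T × Ω → L2) :=
  of_isPiecewiseConstant (f := fun _ _ => 0) hT
    ⟨∅, fun _ _ _ _ => ⟨fun _ => 0, stronglyMeasurable_const, MemLp.zero', fun _ _ _ => rfl⟩⟩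

theorem add (hT : 0 < T) (hF : IsSimpleLimit 𝓕 P F) (hG : IsSimpleLimit 𝓕 P G) :
    IsSimpleLimit 𝓕 P (F + G) := by
  have := hF.sub hT ((zero hT).sub hT hG)
  rwa [zero_sub, sub_neg_eq_add] at this

/-- Finite unions are handled by additivity. The remainder of the countable union has measure
tending to zero because `dt ⊗ P` is finite. -/
theorem indicator_iUnion (hT : 0 < T) [IsFiniteMeasure P] (c : L2) {s : ℕ → Set (TimeInterval T × Ω)}
    (hd : Pairwise (Function.onFun Disjoint s)) (hs : ∀ i, MeasurableSet (s i))
    (h : ∀ i, IsSimpleLimit 𝓕 P ((s i).indicator fun _ => c)) :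
    IsSimpleLimit 𝓕 P ((⋃ i, s i).indicator fun _ => c) := by
  set ν := (timeLeb T).prod P
  let A : ℕ → Set (TimeInterval T × Ω) := fun n => ⋃ i ∈ Finset.range n, s i
  have hA : ∀ n, MeasurableSet (A n) := fun n => Finset.measurableSet_biUnion _ fun i _ => hs i
  have hAl : ∀ n, IsSimpleLimit 𝓕 P ((A n).indicator fun _ => c) := fun n => by
    induction n with
    | zero =>
      have : (A 0).indicator (fun _ => c) = 0 := by
        funext p
        simp [A]
      rw [this]
      exact zero hT
    | succ n ih =>
      have : (A (n + 1)).indicator (fun _ => c) =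
          (A n).indicator (fun _ => c) + (s n).indicator fun _ => c := by
        have hAn : A (n + 1) = A n ∪ s n := by
          ext p
          simp only [A, mem_iUnion, Finset.mem_range, mem_union, Nat.lt_succ_iff_lt_or_eq]
          constructor
          · rintro ⟨i, hi | rfl, hp⟩
            · exact Or.inl ⟨i, hi, hp⟩
            · exact Or.inr hp
          · rintro (⟨i, hi, hp⟩ | hp)
            · exact ⟨i, Or.inl hi, hp⟩
            · exact ⟨n, Or.inr rfl, hp⟩
        rw [hAn]
        refine Set.indicator_union_of_disjoint (Set.disjoint_left.2 fun p hp hp' => ?_) _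
        simp only [A, mem_iUnion, Finset.mem_range] at hp
        obtain ⟨i, hi, hpi⟩ := hp
        exact Set.disjoint_left.1 (hd hi.ne) hpi hp'
      rw [this]
      exact ih.add hT (h n)
  have hU : MeasurableSet (⋃ i, s i) := MeasurableSet.iUnion hs
  have hAU : ∀ n, A n ⊆ ⋃ i, s i := fun n => iUnion₂_subset fun i _ => subset_iUnion s i
  have hlim : Tendsto (fun n => ν ((⋃ i, s i) \ A n)) atTop (𝓝 0) := by
    have h1 := tendsto_measure_iInter_atTop (μ := ν) (s := fun n => (⋃ i, s i) \ A n)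
      (fun n => (hU.diff (hA n)).nullMeasurableSet)
      (fun m n hmn => sdiff_subset_sdiff_right (biUnion_subset_biUnion_left fun i hi =>
        Finset.mem_range.2 ((Finset.mem_range.1 hi).trans_le hmn))) ⟨0, measure_ne_top _ _⟩
    have h2 : (⋂ n, (⋃ i, s i) \ A n) = ∅ := by
      rw [eq_empty_iff_forall_notMem]
      intro p hp
      rw [mem_iInter] at hp
      obtain ⟨i, hi⟩ := mem_iUnion.1 (hp 0).1
      exact (hp (i + 1)).2 (mem_iUnion₂.2 ⟨i, by simp, hi⟩)
    rw [h2, measure_empty] at h1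
    exact h1
  have hnorm : Tendsto (fun n => ‖c‖ₑ * ν ((⋃ i, s i) \ A n) ^ (1 / (2 : ℝ))) atTop (𝓝 0) := by
    have h1 := (ENNReal.continuous_rpow_const (y := 1 / (2 : ℝ))).tendsto 0 |>.comp hlim
    rw [ENNReal.zero_rpow_of_pos (by norm_num)] at h1
    simpa using ENNReal.Tendsto.const_mul h1 (Or.inr (enorm_ne_top (x := c)))
  refine of_forall_near (stronglyMeasurable_const.indicator hU).aestronglyMeasurable hT
    fun ε hε => ?_
  obtain ⟨n, hn⟩ := (hnorm.eventually (gt_mem_nhds (pos_iff_ne_zero.2 hε))).exists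
  refine ⟨_, hAl n, ?_⟩
  have : ((⋃ i, s i).indicator fun _ => c) - (A n).indicator (fun _ => c) =
      ((⋃ i, s i) \ A n).indicator fun _ => c := (Set.indicator_sdiff (hAU n) _).symm
  rw [this, eLpNorm_indicator_const (hU.diff (hA n)) two_ne_zero ENNReal.ofNat_ne_top]
  simpa using hn.le

/-- A π-λ argument on the generating rectangles. Those over `{0}` are null for `dt ⊗ P`, and those
over `(i, T]` give integrands with the single breakpoint `i`. Rectangles of different kinds do not
meet. -/
theorem indicator_const (hT : 0 < T) [IsFiniteMeasure P] (c : L2) {s : Set (TimeInterval T × Ω)}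
    (hs : MeasurableSet[𝓕.predictable] s) : IsSimpleLimit 𝓕 P (s.indicator fun _ => c) := by
  refine MeasurableSpace.induction_on_inter
    (C := fun s _ => IsSimpleLimit 𝓕 P (s.indicator fun _ => c)) rfl ?_ ?_ ?_ ?_ ?_ s hs
  · rintro _ (⟨A, hA, rfl⟩ | ⟨i, A, hA, rfl⟩) _ (⟨B, hB, rfl⟩ | ⟨j, B, hB, rfl⟩) hne
    · exact Or.inl ⟨A ∩ B, hA.inter hB, by rw [prod_inter_prod, inter_self]⟩
    · obtain ⟨p, hp⟩ := hne
      have h1 := hp.1.1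
      have h2 := hp.2.1
      rw [mem_singleton_iff.1 h1] at h2
      exact absurd (mem_Ioi.1 h2) not_lt_bot
    · obtain ⟨p, hp⟩ := hne
      have h1 := hp.2.1
      have h2 := hp.1.1
      rw [mem_singleton_iff.1 h1] at h2
      exact absurd (mem_Ioi.1 h2) not_lt_bot
    · exact Or.inr ⟨max i j, A ∩ B, (𝓕.mono (le_max_left i j) _ hA).inter
        (𝓕.mono (le_max_right i j) _ hB), by rw [prod_inter_prod, Ioi_inter_Ioi]⟩
  · rw [Set.indicator_empty]
    exact zero hT
  · rintro _ (⟨A, hA, rfl⟩ | ⟨i, A, hA, rfl⟩)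
    · refine (zero hT).congr ?_
      filter_upwards [ae_prod_bot_lt] with p hp
      rw [indicator_of_notMem]
      · rfl
      · exact fun h => absurd (mem_singleton_iff.1 h.1) hp.ne'
    · refine (of_isPiecewiseConstant (f := fun t ω => (Ioi i ×ˢ A).indicator (fun _ => c) (t, ω)) hT
        ⟨{i}, fun s t hst hfree => ?_⟩)
      by_cases his : i ≤ s
      · have hAs := 𝓕.mono his _ hA
        refine ⟨A.indicator fun _ => c, stronglyMeasurable_const.indicator hAs,
          (memLp_const c).indicator (𝓕.le _ _ hAs), fun r hr ω => ?_⟩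
        have : i < r := his.trans_lt hr.1
        by_cases hω : ω ∈ A <;> simp [hω, this]
      · refine ⟨fun _ => 0, stronglyMeasurable_const, MemLp.zero', fun r hr ω => ?_⟩
        have : ¬ i < r := fun h => hfree i (by simp) ⟨not_le.1 his, h.trans_le hr.2⟩
        simp [this]
  · intro s hsm h
    have hc : IsSimpleLimit 𝓕 P (fun _ : TimeInterval T × Ω => c) :=
      of_isPiecewiseConstant (f := fun _ _ => c) hT
        ⟨∅, fun _ _ _ _ => ⟨fun _ => c, stronglyMeasurable_const, memLp_const c, fun _ _ _ => rfl⟩⟩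
    have := hc.sub hT h
    rwa [← Set.indicator_compl] at this
  · exact fun f hd hfm h => indicator_iUnion hT c hd (fun i => predictable_le_prod _ (hfm i)) h

end IsSimpleLimit

/-- Induction in L² over predictable functions, from indicators through sums and L² limits. Running
it with the predictable σ-algebra keeps the approximants adapted. -/
theorem MemA2.isSimpleLimit [IsFiniteMeasure P] (hT : 0 < T) {f : TimeInterval T → Ω → L2}
    (hf : MemA2 𝓕 P f) : IsSimpleLimit 𝓕 P (Function.uncurry f) := by
  have : Fact ((1 : ℝ≥0∞) ≤ 2) := ⟨one_le_two⟩
  refine MemLp.induction_stronglyMeasurable (m := 𝓕.predictable) predictable_le_prod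
    ENNReal.ofNat_ne_top (IsSimpleLimit 𝓕 P) (fun c s hs _ => .indicator_const hT c hs)
    (fun F G _ _ _ _ _ hF hG => hF.add hT hG) ?_ (fun F G hFG _ hF => hF.congr hFG) hf.memLp
    (StronglyMeasurable.aestronglyMeasurable hf.1)
  refine isClosed_of_closure_subset fun F hF => ?_
  refine IsSimpleLimit.of_forall_near (Lp.aestronglyMeasurable _) hT fun ε hε => ?_
  obtain ⟨G, hG, hFG⟩ := EMetric.mem_closure_iff.1 hF ε (pos_iff_ne_zero.2 hε)
  refine ⟨_, hG, ?_⟩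
  rw [← Lp.edist_def]
  exact hFG.le

theorem MemA2.exists_simpleIntegrand [IsFiniteMeasure P] (hT : 0 < T) {f : TimeInterval T → Ω → L2}
    (hf : MemA2 𝓕 P f) {ε : ℝ≥0∞} (hε : ε ≠ 0) : ∃ g : SimpleIntegrand 𝓕 P,
      eLpNorm (Function.uncurry f - Function.uncurry g.process) 2 ((timeLeb T).prod P) ≤ ε :=
  (hf.isSimpleLimit hT).2 ε hε

end Density

/-! ### L^p limits and geometrically convergent sequences. -/

section Limits

variable {α E : Type*} {mα : MeasurableSpace α} {μ : Measure α} [NormedAddCommGroup E]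

theorem tendsto_eLpNorm_of_tendsto_sub {f : ℕ → α → E} {g : α → E} (hf : ∀ n, AEStronglyMeasurable (f n) μ)
    (hg : AEStronglyMeasurable g μ) {p : ℝ≥0∞} (hp : 1 ≤ p)
    (h : Tendsto (fun n => eLpNorm (f n - g) p μ) atTop (𝓝 0)) :
    Tendsto (fun n => eLpNorm (f n) p μ) atTop (𝓝 (eLpNorm g p μ)) := by
  have h1 : Tendsto (fun n => eLpNorm g p μ - eLpNorm (f n - g) p μ) atTop (𝓝 (eLpNorm g p μ)) := by
    simpa using ENNReal.Tendsto.sub (tendsto_const_nhds (x := eLpNorm g p μ)) h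
      (Or.inr ENNReal.zero_ne_top)
  have h2 : Tendsto (fun n => eLpNorm g p μ + eLpNorm (f n - g) p μ) atTop (𝓝 (eLpNorm g p μ)) := by
    simpa using (tendsto_const_nhds (x := eLpNorm g p μ)).add h
  refine tendsto_of_tendsto_of_tendsto_of_le_of_le h1 h2 (fun n => ?_) fun n => ?_
  · refine tsub_le_iff_right.2 ?_
    calc eLpNorm g p μ = eLpNorm (f n - (f n - g)) p μ := by rw [sub_sub_cancel]
      _ ≤ _ := eLpNorm_sub_le (hf n) ((hf n).sub hg) hp
  · calc eLpNorm (f n) p μ = eLpNorm (g + (f n - g)) p μ := by rw [add_sub_cancel]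
      _ ≤ _ := eLpNorm_add_le hg ((hf n).sub hg) hp

/-- By Fatou the distance between the two limits is at most the lower limit of a sequence tending to
zero. -/
theorem ae_eq_of_tendsto_eLpNorm {f : ℕ → α → E} {g g' : α → E}
    (hf : ∀ n, AEStronglyMeasurable (f n) μ) {p : ℝ≥0∞} (hp : 1 ≤ p)
    (hg : AEStronglyMeasurable g μ)
    (h : Tendsto (fun n => eLpNorm (f n - g) p μ) atTop (𝓝 0))
    (h' : ∀ᵐ x ∂μ, Tendsto (fun n => f n x) atTop (𝓝 (g' x))) : g =ᵐ[μ] g' := by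
  have h1 := Lp.eLpNorm_lim_le_liminf_eLpNorm (p := p) (fun n => (hf n).sub hg) (fun x => g' x - g x)
    (by filter_upwards [h'] with x hx using hx.sub tendsto_const_nhds)
  rw [h.liminf_eq, nonpos_iff_eq_zero, eLpNorm_eq_zero_iff] at h1
  · filter_upwards [h1] with x hx using (sub_eq_zero.1 hx).symm
  · exact (aestronglyMeasurable_of_tendsto_ae atTop hf h').sub hg
  · exact (zero_lt_one.trans_le hp).ne'

/-- The candidate `z` is required to be the limit only where a limit exists, which is what
`limUnder` provides. Existence follows from the geometric increments. -/
theorem tendstoUniformly_of_geometric {ι : Type*} {x : ℕ → ι → ℝ} {z : ι → ℝ}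
    (h : ∀ᶠ n in atTop, ∀ t, |x n t - x (n + 1) t| ≤ (1 / 2) ^ n)
    (hz : ∀ t, (∃ l, Tendsto (fun n => x n t) atTop (𝓝 l)) →
      Tendsto (fun n => x n t) atTop (𝓝 (z t))) :
    TendstoUniformly x z atTop := by
  obtain ⟨N, hN⟩ := eventually_atTop.1 h
  have hd : ∀ t n, dist (x (n + N) t) (x (n + 1 + N) t) ≤ (1 / 2) ^ N * (1 / 2) ^ n := fun t n => by
    rw [Real.dist_eq, ← pow_add, add_comm N n, show n + 1 + N = n + N + 1 by ring]
    exact hN _ (by omega) t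
  have hz' : ∀ t, Tendsto (fun n => x n t) atTop (𝓝 (z t)) := fun t => hz t (by
    obtain ⟨l, hl⟩ := cauchySeq_tendsto_of_complete
      (cauchySeq_of_le_geometric (1 / 2) ((1 / 2) ^ N) (by norm_num) (hd t))
    exact ⟨l, (tendsto_add_atTop_iff_nat N).1 hl⟩)
  rw [Metric.tendstoUniformly_iff]
  intro ε hε
  have hlim : Tendsto (fun n : ℕ => (1 / 2 : ℝ) ^ N * (1 / 2) ^ (n - N) / (1 - 1 / 2)) atTop (𝓝 0) := by
    have h1 : Tendsto (fun n : ℕ => (1 / 2 : ℝ) ^ (n - N)) atTop (𝓝 0) :=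
      (tendsto_pow_atTop_nhds_zero_of_lt_one (by norm_num) (by norm_num)).comp
        (tendsto_sub_atTop_nat N)
    simpa using (h1.const_mul ((1 / 2 : ℝ) ^ N)).div_const (1 - 1 / 2)
  filter_upwards [hlim.eventually (gt_mem_nhds hε), eventually_ge_atTop N] with n hn hnN t
  have h2 := dist_le_of_le_geometric_of_tendsto (1 / 2) ((1 / 2) ^ N) (by norm_num) (hd t)
    ((tendsto_add_atTop_iff_nat N).2 (hz' t)) (n - N)
  rw [Nat.sub_add_cancel hnN] at h2
  rw [dist_comm]
  exact h2.trans_lt hn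

end Limits

/-! ### Limits of continuous square integrable martingales. -/

section MartingaleLimits

variable {T : ℝ≥0} {Ω : Type*} {mΩ : MeasurableSpace Ω} {𝓕 : Filtration (TimeInterval T) mΩ}
  {P : Measure Ω}

theorem IsContSqMartingale.sub {M N : TimeInterval T → Ω → ℝ} (hM : IsContSqMartingale 𝓕 P M)
    (hN : IsContSqMartingale 𝓕 P N) : IsContSqMartingale 𝓕 P fun t ω => M t ω - N t ω :=
  ⟨hM.martingale.sub hN.martingale, fun t => (hM.memLp t).sub (hN.memLp t), by
    filter_upwards [hM.continuous, hN.continuous] with ω h1 h2 using h1.sub h2⟩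

theorem forall_eq_of_forall_denseTime_eq {x z : TimeInterval T → ℝ} (hx : Continuous x)
    (hz : Continuous z) (h : ∀ j, x (denseTime T j) = z (denseTime T j)) (t : TimeInterval T) :
    x t = z t := by
  have := Continuous.ext_on (TopologicalSpace.denseRange_denseSeq (TimeInterval T)) hx hz
    (by rintro _ ⟨j, rfl⟩; exact h j)
  exact congrFun this t

/-- A martingale is determined by its terminal value at each time up to a null set; dense times and
continuity make the null set independent of time. -/
theorem IsContSqMartingale.ae_forall_eq {M N : TimeInterval T → Ω → ℝ}
    (hM : IsContSqMartingale 𝓕 P M) (hN : IsContSqMartingale 𝓕 P N) (h : M ⊤ =ᵐ[P] N ⊤) :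
    ∀ᵐ ω ∂P, ∀ t, M t ω = N t ω := by
  have h1 : ∀ t, M t =ᵐ[P] N t := fun t =>
    (hM.martingale.2 t ⊤ le_top).symm.trans ((condExp_congr_ae h).trans
      (hN.martingale.2 t ⊤ le_top))
  filter_upwards [hM.continuous, hN.continuous, ae_all_iff.2 fun j => h1 (denseTime T j)]
    with ω h2 h3 h4 using forall_eq_of_forall_denseTime_eq h2 h3 h4

theorem IsContSqMartingale.congr {M N : TimeInterval T → Ω → ℝ} (hM : IsContSqMartingale 𝓕 P M)
    (hN : StronglyAdapted 𝓕 N) (h : ∀ᵐ ω ∂P, ∀ t, M t ω = N t ω) : IsContSqMartingale 𝓕 P N := by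
  have h1 : ∀ t, M t =ᵐ[P] N t := fun t => h.mono fun ω hω => hω t
  refine ⟨⟨hN, fun s t hst => (condExp_congr_ae (h1 t)).symm.trans
    ((hM.martingale.2 s t hst).trans (h1 s))⟩, fun t => (hM.memLp t).ae_eq (h1 t), ?_⟩
  filter_upwards [hM.continuous, h] with ω h2 h3
  have : (fun t => N t ω) = fun t => M t ω := funext fun t => (h3 t).symm
  rwa [this]

/-- The limit is defined for every `ω`, with a default value where the sequence diverges.
Measurability with respect to `𝓕_t` thus survives although null sets need not belong to `𝓕_t`. -/
theorem IsStronglyProgressive.limUnder {X : ℕ → TimeInterval T → Ω → ℝ}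
    (hX : ∀ n, IsStronglyProgressive 𝓕 (X n)) :
    IsStronglyProgressive 𝓕 fun t ω => limUnder atTop fun n => X n t ω :=
  fun t => @StronglyMeasurable.limUnder _ _ _ (Subtype.instMeasurableSpace.prod (𝓕 t)) _ _ _ _ _ _ _
    fun n => hX n t

variable [IsProbabilityMeasure P]

/-- A sequence in `𝓜₂` which converges geometrically fast converges almost surely uniformly. -/
theorem ae_eventually_forall_abs_sub_le {X : ℕ → TimeInterval T → Ω → ℝ}
    (hX : ∀ n, IsContSqMartingale 𝓕 P (X n)) (C : ℝ≥0)
    (h : ∀ n, eLpNorm (X n ⊤ - X (n + 1) ⊤) 2 P ≤ C * (4⁻¹ : ℝ≥0) ^ n) :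
    ∀ᵐ ω ∂P, ∀ᶠ n in atTop, ∀ t, |X n t ω - X (n + 1) t ω| ≤ (1 / 2) ^ n := by
  refine ae_eventually_forall_abs_le (N := fun n t ω => X n t ω - X (n + 1) t ω)
    (fun n => ((hX n).sub (hX (n + 1))).martingale) (fun n => ((hX n).sub (hX (n + 1))).continuous)
    C fun n => le_trans ?_ (h n)
  exact eLpNorm_le_eLpNorm_of_exponent_le one_le_two
    (((hX n).sub (hX (n + 1))).memLp ⊤).aestronglyMeasurable

theorem exists_limit_isContSqMartingale {X : ℕ → TimeInterval T → Ω → ℝ}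
    (hX : ∀ n, IsContSqMartingale 𝓕 P (X n)) (hprog : ∀ n, IsStronglyProgressive 𝓕 (X n)) (C : ℝ≥0)
    (h : ∀ n, eLpNorm (X n ⊤ - X (n + 1) ⊤) 2 P ≤ C * (4⁻¹ : ℝ≥0) ^ n) :
    ∃ M, IsContSqMartingale 𝓕 P M ∧ IsStronglyProgressive 𝓕 M ∧
      (∀ t, Tendsto (fun n => eLpNorm (X n t - M t) 2 P) atTop (𝓝 0)) := by
  let M : TimeInterval T → Ω → ℝ := fun t ω => limUnder atTop fun n => X n t ω
  have hM : IsStronglyProgressive 𝓕 M := IsStronglyProgressive.limUnder hprog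
  have hunif : ∀ᵐ ω ∂P, TendstoUniformly (fun n t => X n t ω) (fun t => M t ω) atTop := by
    filter_upwards [ae_eventually_forall_abs_sub_le hX C h] with ω hω
    exact tendstoUniformly_of_geometric hω fun t => fun ⟨l, hl⟩ => by
      simp only [M]
      rwa [hl.limUnder_eq]
  have hXm : ∀ n t, AEStronglyMeasurable (X n t) P := fun n t => ((hX n).memLp t).1
  have hMm : ∀ t, AEStronglyMeasurable (M t) P := fun t =>
    ((hM.stronglyAdapted t).mono (𝓕.le t)).aestronglyMeasurable
  let b : ℕ → ℝ≥0 := fun n => C * (4⁻¹ : ℝ≥0) ^ n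
  have hb : ∀ n, eLpNorm (X n ⊤ - X (n + 1) ⊤) 2 P ≤ b n := fun n => by
    simpa only [b, ENNReal.coe_mul, ENNReal.coe_pow] using h n
  -- Telescoping: the bound at `n` plus twice the bound at `n + 1` is at most twice the bound at
  -- `n`, since the ratio is `1/4`.
  have htri : ∀ k n, eLpNorm (X n ⊤ - X (n + k) ⊤) 2 P ≤ ((2 * b n : ℝ≥0) : ℝ≥0∞) := by
    intro k
    induction k with
    | zero => simp
    | succ k ih =>
      intro n
      have h1 : X n ⊤ - X (n + (k + 1)) ⊤ =
          (X n ⊤ - X (n + 1) ⊤) + (X (n + 1) ⊤ - X (n + 1 + k) ⊤) := by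
        rw [sub_add_sub_cancel, show n + 1 + k = n + (k + 1) by ring]
      rw [h1]
      refine (eLpNorm_add_le ((hXm _ _).sub (hXm _ _)) ((hXm _ _).sub (hXm _ _)) one_le_two).trans
        ((add_le_add (hb n) (ih (n + 1))).trans ?_)
      rw [← ENNReal.coe_add, ENNReal.coe_le_coe, ← NNReal.coe_le_coe]
      have : (0 : ℝ) ≤ C * (4⁻¹ : ℝ) ^ n := by positivity
      simp only [b]
      push_cast
      rw [pow_succ]
      linarith
  have htri' : ∀ t k n, eLpNorm (X n t - X (n + k) t) 2 P ≤ ((2 * b n : ℝ≥0) : ℝ≥0∞) :=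
    fun t k n => (((hX n).sub (hX (n + k))).martingale.eLpNorm_le one_le_two le_top).trans
      (htri k n)
  -- Fatou as `k → ∞` turns the Cauchy estimate into a distance to the pathwise limit.
  have hlim : ∀ t n, eLpNorm (X n t - M t) 2 P ≤ ((2 * b n : ℝ≥0) : ℝ≥0∞) := fun t n => by
    refine (Lp.eLpNorm_lim_le_liminf_eLpNorm (f := fun k => X n t - X (n + k) t)
      (fun k => (hXm n t).sub (hXm (n + k) t)) (X n t - M t) ?_).trans
      (liminf_le_of_frequently_le' (Eventually.of_forall fun k => htri' t k n).frequently)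
    filter_upwards [hunif] with ω hω
    refine tendsto_const_nhds.sub ?_
    have := (tendsto_add_atTop_iff_nat n).2 (hω.tendsto_at t)
    simpa only [add_comm] using this
  have hb0 : Tendsto (fun n => ((2 * b n : ℝ≥0) : ℝ≥0∞)) atTop (𝓝 0) := by
    have h1 : Tendsto (fun n => 2 * b n) atTop (𝓝 (2 * (C * 0))) :=
      ((tendsto_pow_atTop_nhds_zero_of_lt_one (r := (4⁻¹ : ℝ≥0)) zero_le
        (by rw [← NNReal.coe_lt_coe]; norm_num)).const_mul C).const_mul 2
    rw [mul_zero, mul_zero] at h1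
    exact ENNReal.tendsto_coe.2 h1
  have hL2 : ∀ t, Tendsto (fun n => eLpNorm (X n t - M t) 2 P) atTop (𝓝 0) := fun t =>
    tendsto_of_tendsto_of_tendsto_of_le_of_le tendsto_const_nhds hb0 (fun _ => zero_le) (hlim t)
  have hmem : ∀ t, MemLp (M t) 2 P := fun t => by
    have h1 : MemLp (X 0 t - M t) 2 P :=
      ⟨(hXm 0 t).sub (hMm t), (hlim t 0).trans_lt ENNReal.coe_lt_top⟩
    simpa using ((hX 0).memLp t).sub h1
  refine ⟨M, ⟨martingale_of_tendsto_eLpNorm_one (fun n => (hX n).martingale) hM.stronglyAdapted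
    (fun t => (hmem t).integrable one_le_two) fun t => ?_, hmem, ?_⟩, hM, hL2⟩
  · refine tendsto_of_tendsto_of_tendsto_of_le_of_le tendsto_const_nhds (hL2 t) (fun _ => zero_le)
      fun n => ?_
    exact eLpNorm_le_eLpNorm_of_exponent_le one_le_two ((hXm n t).sub (hMm t))
  · filter_upwards [hunif, ae_all_iff.2 fun n => (hX n).continuous] with ω h1 h2
    exact h1.continuous (Frequently.of_forall h2)

end MartingaleLimits

/-! ### Adaptedness and continuity of running time integrals. -/

section TimeIntegrals

variable {T : ℝ≥0} {Ω : Type*} {mΩ : MeasurableSpace Ω} {𝓕 : Filtration (TimeInterval T) mΩ}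

/-- Freezing the process at time `t` extends it from `[0,t]` to `[0,T]` without leaving `𝓕_t`, so
integrals over `Iic t` can be treated on the fixed space `[0,T]`. -/
theorem MeasureTheory.IsStronglyProgressive.stronglyMeasurable_comp_min {E : Type*} [TopologicalSpace E]
    {h : TimeInterval T → Ω → E} (hh : IsStronglyProgressive 𝓕 h) (t : TimeInterval T) :
    StronglyMeasurable[MeasurableSpace.prod inferInstance (𝓕 t)]
      fun p : TimeInterval T × Ω => h (min p.1 t) p.2 := by
  let m : MeasurableSpace Ω := 𝓕 t
  have hm : @Measurable (TimeInterval T × Ω) (Iic t × Ω) (MeasurableSpace.prod inferInstance m)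
      (Subtype.instMeasurableSpace.prod m) fun p =>
        (⟨min p.1 t, mem_Iic.2 (min_le_right _ _)⟩, p.2) :=
    (Measurable.subtype_mk ((@measurable_fst _ _ _ m).min measurable_const)).prodMk
      (@measurable_snd _ _ _ m)
  exact @StronglyMeasurable.comp_measurable _ _ _ _ (MeasurableSpace.prod inferInstance m)
    (Subtype.instMeasurableSpace.prod m) _ _ (hh t) hm

theorem MeasureTheory.IsStronglyProgressive.stronglyAdapted_setIntegral_Iic
    {h : TimeInterval T → Ω → ℝ} (hh : IsStronglyProgressive 𝓕 h) :
    StronglyAdapted 𝓕 fun t ω => ∫ s in Iic t, h s ω ∂timeLeb T := by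
  intro t
  have h1 : (fun ω => ∫ s in Iic t, h s ω ∂timeLeb T) =
      fun ω => ∫ s in Iic t, h (min s t) ω ∂timeLeb T := by
    funext ω
    refine setIntegral_congr_fun measurableSet_Iic fun s hs => ?_
    simp only [min_eq_left (mem_Iic.1 hs)]
  simp only [h1]
  exact @StronglyMeasurable.integral_prod_left _ _ _ _ (𝓕 t) _ _ _ _ _
    (hh.stronglyMeasurable_comp_min t)

/-- At `t₀` the indicators converge for every `s ≠ t₀`, and `timeLeb` has no atoms. -/
theorem continuous_setIntegral_Iic {h : TimeInterval T → ℝ} (hh : Integrable h (timeLeb T)) :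
    Continuous fun t => ∫ s in Iic t, h s ∂timeLeb T := by
  rw [continuous_iff_continuousAt]
  intro t₀
  simp_rw [← integral_indicator (measurableSet_Iic (α := TimeInterval T))]
  refine continuousAt_of_dominated (bound := fun s => ‖h s‖) (Eventually.of_forall fun t =>
    hh.1.indicator measurableSet_Iic) (Eventually.of_forall fun t => Eventually.of_forall fun s =>
    norm_indicator_le_norm_self _ _) hh.norm ?_
  filter_upwards [compl_mem_ae_iff.2 (measure_singleton (μ := timeLeb T) t₀)] with s hs
  have hne : s ≠ t₀ := hs
  rcases lt_or_gt_of_ne hne with h1 | h1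
  · refine (continuousAt_const (y := h s)).congr ?_
    filter_upwards [eventually_gt_nhds h1] with t ht
    rw [indicator_of_mem (mem_Iic.2 ht.le)]
  · refine (continuousAt_const (y := 0)).congr ?_
    filter_upwards [eventually_lt_nhds h1] with t ht
    rw [indicator_of_notMem fun h => absurd (mem_Iic.1 h) (not_le.2 ht)]

theorem monotone_setIntegral_Iic {h : TimeInterval T → ℝ} (hh : Integrable h (timeLeb T))
    (h0 : ∀ s, 0 ≤ h s) : Monotone fun t => ∫ s in Iic t, h s ∂timeLeb T := fun _ _ hst =>
  setIntegral_mono_set hh.integrableOn (Eventually.of_forall h0)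
    (Eventually.of_forall (Iic_subset_Iic.2 hst))

theorem setIntegral_Iic_bot (h : TimeInterval T → ℝ) : ∫ s in Iic ⊥, h s ∂timeLeb T = 0 := by
  rw [Iic_bot]
  exact setIntegral_measure_zero _ (measure_singleton _)

theorem lintegral_Iic_add_lintegral_Ioc (h : TimeInterval T → ℝ≥0∞) {s t : TimeInterval T} (hst : s ≤ t) :
    ∫⁻ r in Iic t, h r ∂timeLeb T = ∫⁻ r in Iic s, h r ∂timeLeb T + ∫⁻ r in Ioc s t, h r ∂timeLeb T := by
  rw [← Iic_union_Ioc_eq_Iic hst, lintegral_union measurableSet_Ioc (Iic_disjoint_Ioc le_rfl)]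

end TimeIntegrals

/-! ### The energy identity: quadratic variation and stability under limits. -/

namespace RandomFlow

variable {T : ℝ≥0} {Ω : Type*} [mΩ : MeasurableSpace Ω] {y : RandomFlow T Ω} {P : Measure Ω}
  {f : TimeInterval T → Ω → L2}

theorem isStronglyProgressive_sq_norm_pr (y : RandomFlow T Ω) (hf : IsStronglyProgressive y.filtration f) :
    IsStronglyProgressive y.filtration fun s ω => ‖pr (y.toL2 s ω) (f s ω)‖ ^ 2 := fun t =>
  @stronglyMeasurable_sq_norm_pr _ (Subtype.instMeasurableSpace.prod (y.filtration t)) _ _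
    (y.isStronglyProgressive_toL2 t) (hf t)

theorem stronglyMeasurable_sq_norm_pr_path (y : RandomFlow T Ω)
    (hf : StronglyMeasurable (Function.uncurry f)) (ω : Ω) :
    StronglyMeasurable fun s => ‖pr (y.toL2 s ω) (f s ω)‖ ^ 2 :=
  stronglyMeasurable_sq_norm_pr (y.stronglyMeasurable_toL2.comp_measurable measurable_prodMk_right)
    (hf.comp_measurable measurable_prodMk_right)

theorem projectedEnergy_eq_toReal (y : RandomFlow T Ω) (hf : StronglyMeasurable (Function.uncurry f))
    (t : TimeInterval T) (ω : Ω) : y.projectedEnergy f t ω =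
      (∫⁻ r in Iic t, ‖pr (y.toL2 r ω) (f r ω)‖ₑ ^ 2 ∂timeLeb T).toReal := by
  rw [projectedEnergy, integral_eq_lintegral_of_nonneg_ae
    (Eventually.of_forall fun _ => sq_nonneg _)
    (y.stronglyMeasurable_sq_norm_pr_path hf ω).aestronglyMeasurable]
  simp_rw [enorm_sq_eq_ofReal]

theorem integrable_sq_norm_pr (y : RandomFlow T Ω) (hf : StronglyMeasurable (Function.uncurry f)) {ω : Ω}
    (h : ∫⁻ s, ‖f s ω‖ₑ ^ 2 ∂timeLeb T < ∞) :
    Integrable (fun s => ‖pr (y.toL2 s ω) (f s ω)‖ ^ 2) (timeLeb T) := by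
  refine ⟨(y.stronglyMeasurable_sq_norm_pr_path hf ω).aestronglyMeasurable, ?_⟩
  rw [hasFiniteIntegral_iff_ofReal (Eventually.of_forall fun _ => sq_nonneg _)]
  refine lt_of_le_of_lt (lintegral_mono fun s => ?_) h
  rw [← enorm_sq_eq_ofReal]
  gcongr
  exact enorm_pr_le _ _

theorem stronglyAdapted_projectedEnergy (y : RandomFlow T Ω)
    (hf : IsStronglyPredictable y.filtration f) :
    StronglyAdapted y.filtration (y.projectedEnergy f) :=
  (y.isStronglyProgressive_sq_norm_pr hf.isStronglyProgressive).stronglyAdapted_setIntegral_Iic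

theorem ae_lintegral_lt_top_of_memA2 (hf : MemA2 y.filtration P f) :
    ∀ᵐ ω ∂P, ∫⁻ s, ‖f s ω‖ₑ ^ 2 ∂timeLeb T < ∞ := by
  have hm : Measurable fun ω => ∫⁻ s, ‖f s ω‖ₑ ^ 2 ∂timeLeb T :=
    Measurable.lintegral_prod_left' (f := fun p : TimeInterval T × Ω => ‖f p.1 p.2‖ₑ ^ 2)
      (hf.1.stronglyMeasurable_uncurry.enorm.pow_const 2)
  exact ae_lt_top hm hf.2.ne

/-- The energy identity is additive in `[0,∞]`. Once all terms are known to be finite it can be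
subtracted, and it becomes equality of the integrals of `M² - ∫‖pr_y f‖²` over sets of `𝓕_s`, the
martingale property. -/
theorem HasEnergy.isQuadraticVariation [IsFiniteMeasure P] {M : TimeInterval T → Ω → ℝ}
    (h : y.HasEnergy P f M) (hM : IsContSqMartingale y.filtration P M)
    (hf : MemA2 y.filtration P f) :
    IsQuadraticVariation y.filtration P M (y.projectedEnergy f) := by
  have hfm := hf.1.stronglyMeasurable_uncurry
  have hfin := ae_lintegral_lt_top_of_memA2 hf
  have hadp := y.stronglyAdapted_projectedEnergy hf.1
  let q : TimeInterval T → Ω → ℝ≥0∞ := fun t ω =>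
    ∫⁻ r in Iic t, ‖pr (y.toL2 r ω) (f r ω)‖ₑ ^ 2 ∂timeLeb T
  have hq : ∀ t, Measurable (q t) := fun t => y.measurable_lintegral_sq_pr hfm _
  have hqle : ∀ t ω, q t ω ≤ ∫⁻ s, ‖f s ω‖ₑ ^ 2 ∂timeLeb T := fun t ω =>
    (setLIntegral_le_lintegral _ _).trans (lintegral_mono fun r => by
      gcongr
      exact enorm_pr_le _ _)
  have hqfin : ∀ t, ∀ᵐ ω ∂P, q t ω < ∞ := fun t => hfin.mono fun ω hω => (hqle t ω).trans_lt hω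
  have hqint : ∀ t B, ∫⁻ ω in B, q t ω ∂P < ∞ := fun t B =>
    (setLIntegral_le_lintegral _ _).trans_lt ((lintegral_mono (hqle t)).trans_lt hf.2)
  have hQ : ∀ t, y.projectedEnergy f t = fun ω => (q t ω).toReal := fun t =>
    funext fun ω => y.projectedEnergy_eq_toReal hfm t ω
  have hQint : ∀ t, Integrable (y.projectedEnergy f t) P := fun t => by
    rw [hQ]
    refine integrable_toReal_of_lintegral_ne_top (hq t).aemeasurable ?_
    simpa using (hqint t univ).ne
  have hMint : ∀ t, Integrable (fun ω => M t ω ^ 2) P := fun t => (hM.memLp t).integrable_sq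
  refine ⟨hadp, Eventually.of_forall fun ω => setIntegral_Iic_bot _, ?_, ?_,
    martingale_of_setIntegral_eq (fun t => ((hM.martingale.1 t).pow 2).sub (hadp t))
      (fun t => (hMint t).sub (hQint t)) fun s t hst B hB => ?_⟩
  · filter_upwards [hfin] with ω hω using
      continuous_setIntegral_Iic (y.integrable_sq_norm_pr hfm hω)
  · filter_upwards [hfin] with ω hω using
      monotone_setIntegral_Iic (y.integrable_sq_norm_pr hfm hω) fun _ => sq_nonneg _
  have hMl : ∀ r, ∫ ω in B, M r ω ^ 2 ∂P = (∫⁻ ω in B, ‖M r ω‖ₑ ^ 2 ∂P).toReal := fun r => by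
    rw [integral_eq_lintegral_of_nonneg_ae (Eventually.of_forall fun _ => sq_nonneg _)
      (hMint r).1.restrict]
    simp_rw [enorm_sq_eq_ofReal, Real.norm_eq_abs, sq_abs]
  have hQl : ∀ r, ∫ ω in B, y.projectedEnergy f r ω ∂P = (∫⁻ ω in B, q r ω ∂P).toReal := fun r => by
    rw [hQ]
    exact integral_toReal (hq r).aemeasurable (ae_restrict_of_ae (hqfin r))
  have hMfin : ∀ r, ∫⁻ ω in B, ‖M r ω‖ₑ ^ 2 ∂P ≠ ∞ := fun r => by
    refine ((setLIntegral_le_lintegral _ _).trans_lt ?_).ne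
    rw [← sq_eLpNorm_two]
    exact ENNReal.pow_lt_top (hM.memLp r).2
  rw [integral_sub (hMint s).integrableOn (hQint s).integrableOn,
    integral_sub (hMint t).integrableOn (hQint t).integrableOn, hMl, hMl, hQl, hQl]
  have h1 := h s t hst B hB
  have h2 : ∫⁻ ω in B, q t ω ∂P = ∫⁻ ω in B, q s ω ∂P +
      ∫⁻ ω in B, ∫⁻ r in Ioc s t, ‖pr (y.toL2 r ω) (f r ω)‖ₑ ^ 2 ∂timeLeb T ∂P := by
    rw [← lintegral_add_left (hq s)]
    exact lintegral_congr fun ω => lintegral_Iic_add_lintegral_Ioc _ hst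
  have h3 : ∫⁻ ω in B, ∫⁻ r in Ioc s t, ‖pr (y.toL2 r ω) (f r ω)‖ₑ ^ 2 ∂timeLeb T ∂P ≠ ∞ :=
    ne_top_of_le_ne_top (hqint t B).ne (h2 ▸ le_add_self)
  rw [h1, h2, ENNReal.toReal_add (hMfin s) h3, ENNReal.toReal_add (hqint s B).ne h3]
  ring

theorem setLIntegral_sq_pr_eq [SFinite P] (y : RandomFlow T Ω)
    (hf : StronglyMeasurable (Function.uncurry f)) (I : Set (TimeInterval T)) (B : Set Ω) :
    ∫⁻ ω in B, ∫⁻ r in I, ‖pr (y.toL2 r ω) (f r ω)‖ₑ ^ 2 ∂timeLeb T ∂P =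
      eLpNorm (fun p : TimeInterval T × Ω => ‖pr (y.toL2 p.1 p.2) (f p.1 p.2)‖) 2
        (((timeLeb T).restrict I).prod (P.restrict B)) ^ 2 := by
  rw [sq_eLpNorm_two, lintegral_prod_symm]
  · simp_rw [enorm_norm]
  · simp_rw [enorm_norm]
    exact (y.measurable_sq_enorm_pr measurable_fst measurable_snd hf).aemeasurable

theorem stronglyMeasurable_norm_pr (y : RandomFlow T Ω) (hf : StronglyMeasurable (Function.uncurry f)) :
    StronglyMeasurable fun p : TimeInterval T × Ω => ‖pr (y.toL2 p.1 p.2) (f p.1 p.2)‖ := by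
  have h := (stronglyMeasurable_sq_norm_pr y.stronglyMeasurable_toL2 hf).measurable.sqrt
  simp only [Real.sqrt_sq (norm_nonneg _)] at h
  exact h.stronglyMeasurable

/-- Each term is the square of an L² norm, hence continuous. For the energy term, contractivity of
`pr` lets convergence of the integrands control convergence of their projections. -/
theorem HasEnergy.of_tendsto [SFinite P] {g : ℕ → TimeInterval T → Ω → L2} {X : ℕ → TimeInterval T → Ω → ℝ}
    {M : TimeInterval T → Ω → ℝ} (h : ∀ n, y.HasEnergy P (g n) (X n))
    (hg : ∀ n, StronglyMeasurable (Function.uncurry (g n)))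
    (hf : StronglyMeasurable (Function.uncurry f))
    (hX : ∀ n t, AEStronglyMeasurable (X n t) P) (hM : ∀ t, AEStronglyMeasurable (M t) P)
    (hgf : Tendsto (fun n => eLpNorm (Function.uncurry (g n) - Function.uncurry f) 2
      ((timeLeb T).prod P)) atTop (𝓝 0))
    (hXM : ∀ t, Tendsto (fun n => eLpNorm (X n t - M t) 2 P) atTop (𝓝 0)) :
    y.HasEnergy P f M := by
  intro s t hst B hB
  have h1 : ∀ r, Tendsto (fun n => ∫⁻ ω in B, ‖X n r ω‖ₑ ^ 2 ∂P) atTop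
      (𝓝 (∫⁻ ω in B, ‖M r ω‖ₑ ^ 2 ∂P)) := fun r => by
    simp_rw [← sq_eLpNorm_two]
    refine ENNReal.Tendsto.pow (tendsto_eLpNorm_of_tendsto_sub (fun n => (hX n r).restrict)
      (hM r).restrict one_le_two ?_)
    exact tendsto_of_tendsto_of_tendsto_of_le_of_le tendsto_const_nhds (hXM r) (fun _ => zero_le)
      fun n => eLpNorm_mono_measure _ Measure.restrict_le_self
  have h2 : Tendsto (fun n => ∫⁻ ω in B, ∫⁻ r in Ioc s t, ‖pr (y.toL2 r ω) (g n r ω)‖ₑ ^ 2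
      ∂timeLeb T ∂P) atTop
      (𝓝 (∫⁻ ω in B, ∫⁻ r in Ioc s t, ‖pr (y.toL2 r ω) (f r ω)‖ₑ ^ 2 ∂timeLeb T ∂P)) := by
    simp_rw [fun n => y.setLIntegral_sq_pr_eq (P := P) (hg n) (Ioc s t) B,
      y.setLIntegral_sq_pr_eq (P := P) hf (Ioc s t) B]
    refine ENNReal.Tendsto.pow (tendsto_eLpNorm_of_tendsto_sub
      (fun n => (y.stronglyMeasurable_norm_pr (hg n)).aestronglyMeasurable)
      (y.stronglyMeasurable_norm_pr hf).aestronglyMeasurable one_le_two ?_)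
    refine tendsto_of_tendsto_of_tendsto_of_le_of_le tendsto_const_nhds hgf (fun _ => zero_le)
      fun n => ?_
    rw [Measure.prod_restrict]
    refine (eLpNorm_mono_measure _ Measure.restrict_le_self).trans (eLpNorm_mono fun p => ?_)
    rw [Real.norm_eq_abs]
    refine (abs_norm_sub_norm_le _ _).trans ?_
    rw [← map_sub]
    exact norm_pr_le _ _
  refine tendsto_nhds_unique (h1 t) ?_
  simp_rw [fun n => h n s t hst B hB]
  exact (h1 s).add h2

end RandomFlow

/-! ### The stochastic integral on `𝓐²`: existence, uniqueness, quadratic variation. -/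

namespace RandomFlow

variable {T : ℝ≥0} {Ω : Type*} [mΩ : MeasurableSpace Ω] {y : RandomFlow T Ω} {P : Measure Ω}
  {f : TimeInterval T → Ω → L2} {M N : TimeInterval T → Ω → ℝ}

theorem sqNormM2_sub_eq (M N : TimeInterval T → Ω → ℝ) :
    sqNormM2 P (fun t ω => M t ω - N t ω) = eLpNorm (M ⊤ - N ⊤) 2 P ^ 2 :=
  (sq_eLpNorm_two (M ⊤ - N ⊤)).symm

theorem sqNormA2_sub_eq [SFinite P] {g : TimeInterval T → Ω → L2}
    (hg : StronglyMeasurable (Function.uncurry g)) (hf : StronglyMeasurable (Function.uncurry f)) :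
    sqNormA2 P (fun t ω => g t ω - f t ω) =
      eLpNorm (Function.uncurry g - Function.uncurry f) 2 ((timeLeb T).prod P) ^ 2 :=
  sqNormA2_eq_eLpNorm (f := fun t ω => g t ω - f t ω) (hg.sub hf)

theorem _root_.SimpleIntegrand.stronglyMeasurable_uncurry {𝓕 : Filtration (TimeInterval T) mΩ}
    (g : SimpleIntegrand 𝓕 P) (hT : 0 < T) : StronglyMeasurable (Function.uncurry g.process) :=
  (g.isStronglyPredictable hT).stronglyMeasurable_uncurry

theorem IsStochasticIntegral.congr (h : y.IsStochasticIntegral P f M)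
    (hN : StronglyAdapted y.filtration N) (hMN : ∀ᵐ ω ∂P, ∀ t, M t ω = N t ω) :
    y.IsStochasticIntegral P f N := by
  obtain ⟨hM, g, h1, h2⟩ := h
  refine ⟨hM.congr hN hMN, g, h1, h2.congr fun n => ?_⟩
  refine lintegral_congr_ae ?_
  filter_upwards [hMN] with ω hω
  rw [hω]

variable [IsProbabilityMeasure P]

theorem IsStepIntegral.eLpNorm_le (h : y.IsStepIntegral P f M) (hy : y.IsModifiedArratiaFlow P)
    (hf : StronglyMeasurable (Function.uncurry f)) :
    eLpNorm (M ⊤) 2 P ≤ eLpNorm (Function.uncurry f) 2 ((timeLeb T).prod P) := by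
  rw [← ENNReal.pow_le_pow_left_iff two_ne_zero, ← sqNormA2_eq_eLpNorm hf, sq_eLpNorm_two]
  exact (h.hasEnergy hy hf).sqNormM2_le (Eventually.of_forall h.zero)

theorem IsStepIntegral.eLpNorm_sub_le {f' : TimeInterval T → Ω → L2} {M' : TimeInterval T → Ω → ℝ}
    (h : y.IsStepIntegral P f M) (h' : y.IsStepIntegral P f' M') (hy : y.IsModifiedArratiaFlow P)
    (hf : StronglyMeasurable (Function.uncurry f)) (hf' : StronglyMeasurable (Function.uncurry f')) :
    eLpNorm (M ⊤ - M' ⊤) 2 P ≤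
      eLpNorm (Function.uncurry f - Function.uncurry f') 2 ((timeLeb T).prod P) :=
  (h.sub h').eLpNorm_le hy (hf.sub hf')

/-- The stochastic integral is the limit of the integrals of any approximating sequence of
processes which are constant in time between finitely many times. -/
theorem IsStochasticIntegral.tendsto_stepIntegral (hy : y.IsModifiedArratiaFlow P) (hT : 0 < T)
    (hf : MemA2 y.filtration P f) (h : y.IsStochasticIntegral P f M)
    {g : ℕ → TimeInterval T → Ω → L2} {X : ℕ → TimeInterval T → Ω → ℝ}
    (hX : ∀ n, y.IsStepIntegral P (g n) (X n))
    (hg : ∀ n, StronglyMeasurable (Function.uncurry (g n)))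
    (hgf : Tendsto (fun n => eLpNorm (Function.uncurry (g n) - Function.uncurry f) 2
      ((timeLeb T).prod P)) atTop (𝓝 0)) (t : TimeInterval T) :
    Tendsto (fun n => eLpNorm (X n t - M t) 2 P) atTop (𝓝 0) := by
  obtain ⟨hM, k, hk, hkM⟩ := h
  have hfm := hf.1.stronglyMeasurable_uncurry
  have hkm := fun n => (k n).stronglyMeasurable_uncurry hT
  simp_rw [fun n => sqNormA2_sub_eq (P := P) (hkm n) hfm] at hk
  simp_rw [sqNormM2_sub_eq] at hkM
  rw [tendsto_sq_nhds_zero_iff] at hk hkM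
  have hXc := fun n => (hX n).isContSqMartingale hy
  -- At time `⊤`, which dominates all earlier times, the distance from `X n` to `M` is at most that
  -- of `g n` to `f`, plus that of `f` to the simple process `k n` defining `M`, plus that of its
  -- integral to `M`.
  have hlim := (hgf.add hk).add hkM
  rw [add_zero, add_zero] at hlim
  refine tendsto_of_tendsto_of_tendsto_of_le_of_le tendsto_const_nhds hlim (fun _ => zero_le)
    fun n => ?_
  refine (((hXc n).sub hM).martingale.eLpNorm_le one_le_two (le_top (a := t))).trans ?_
  have hs := y.isStepIntegral_simpleIntegral (P := P) (k n)
  have hsc := hs.isContSqMartingale hy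
  have e1 : (fun ω => X n ⊤ ω - M ⊤ ω) = (X n ⊤ - y.simpleIntegral (k n) ⊤) +
      (y.simpleIntegral (k n) ⊤ - M ⊤) := (sub_add_sub_cancel _ _ _).symm
  rw [e1]
  refine (eLpNorm_add_le (((hXc n).memLp ⊤).sub (hsc.memLp ⊤)).1
    ((hsc.memLp ⊤).sub (hM.memLp ⊤)).1 one_le_two).trans (add_le_add ?_ le_rfl)
  refine ((hX n).eLpNorm_sub_le hs hy (hg n) (hkm n)).trans ?_
  rw [← sub_add_sub_cancel _ (Function.uncurry f)]
  refine (eLpNorm_add_le ((hg n).sub hfm).aestronglyMeasurable (hfm.sub (hkm n)).aestronglyMeasurable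
    one_le_two).trans (add_le_add le_rfl ?_)
  rw [eLpNorm_sub_comm]

theorem IsStochasticIntegral.exists_seq (hT : 0 < T) (hf : MemA2 y.filtration P f)
    (h : y.IsStochasticIntegral P f M) : ∃ g : ℕ → SimpleIntegrand y.filtration P,
      Tendsto (fun n => eLpNorm (Function.uncurry (g n).process - Function.uncurry f) 2
        ((timeLeb T).prod P)) atTop (𝓝 0) := by
  obtain ⟨-, k, hk, -⟩ := h
  simp_rw [fun n => sqNormA2_sub_eq (P := P) ((k n).stronglyMeasurable_uncurry hT)
    hf.1.stronglyMeasurable_uncurry] at hk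
  exact ⟨k, tendsto_sq_nhds_zero_iff.1 hk⟩

/-- The definition allows each integral its own approximating sequence. By the preceding
convergence, one sequence serves for both. -/
theorem IsStochasticIntegral.ae_eq (hy : y.IsModifiedArratiaFlow P) (hT : 0 < T)
    (hf : MemA2 y.filtration P f) (hM : y.IsStochasticIntegral P f M)
    (hN : y.IsStochasticIntegral P f N) : ∀ᵐ ω ∂P, ∀ t, M t ω = N t ω := by
  refine hM.1.ae_forall_eq hN.1 ?_
  obtain ⟨g, hg⟩ := hM.exists_seq hT hf
  have hs := fun n => y.isStepIntegral_simpleIntegral (P := P) (g n)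
  have hm := fun n => (g n).stronglyMeasurable_uncurry hT
  have h1 := hM.tendsto_stepIntegral hy hT hf hs hm hg ⊤
  have h2 := hN.tendsto_stepIntegral hy hT hf hs hm hg ⊤
  have hsm := fun n => (((hs n).isContSqMartingale hy).memLp ⊤).1
  have h3 : eLpNorm (M ⊤ - N ⊤) 2 P ≤ 0 := by
    refine ge_of_tendsto' (by simpa using h1.add h2) fun n => ?_
    have e : M ⊤ - N ⊤ = (y.simpleIntegral (g n) ⊤ - N ⊤) - (y.simpleIntegral (g n) ⊤ - M ⊤) :=
      (sub_sub_sub_cancel_left _ _ _).symm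
    rw [e, add_comm]
    exact MeasureTheory.eLpNorm_sub_le ((hsm n).sub (hN.1.memLp ⊤).1)
      ((hsm n).sub (hM.1.memLp ⊤).1) one_le_two
  rw [nonpos_iff_eq_zero, eLpNorm_eq_zero_iff ((hM.1.memLp ⊤).1.sub (hN.1.memLp ⊤).1)
    two_ne_zero] at h3
  filter_upwards [h3] with ω hω using sub_eq_zero.1 hω

theorem IsStochasticIntegral.hasEnergy (hy : y.IsModifiedArratiaFlow P) (hT : 0 < T)
    (hf : MemA2 y.filtration P f) (hM : y.IsStochasticIntegral P f M) : y.HasEnergy P f M := by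
  obtain ⟨g, hg⟩ := hM.exists_seq hT hf
  have hs := fun n => y.isStepIntegral_simpleIntegral (P := P) (g n)
  have hm := fun n => (g n).stronglyMeasurable_uncurry hT
  exact HasEnergy.of_tendsto (fun n => (hs n).hasEnergy hy (hm n)) hm hf.1.stronglyMeasurable_uncurry
    (fun n t => (((hs n).isContSqMartingale hy).memLp t).1) (fun t => (hM.1.memLp t).1) hg
    (hM.tendsto_stepIntegral hy hT hf hs hm hg)

theorem IsStochasticIntegral.isQuadraticVariation (hy : y.IsModifiedArratiaFlow P) (hT : 0 < T)
    (hf : MemA2 y.filtration P f) (hM : y.IsStochasticIntegral P f M) :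
    IsQuadraticVariation y.filtration P M (y.projectedEnergy f) :=
  (hM.hasEnergy hy hT hf).isQuadraticVariation hM.1 hf

/-- The rate `4⁻ⁿ` beats the level `2⁻ⁿ` in the maximal inequality and so gives uniform convergence
of paths. -/
theorem exists_simpleIntegrand_geometric (hT : 0 < T) (hf : MemA2 y.filtration P f) :
    ∃ g : ℕ → SimpleIntegrand y.filtration P, ∀ n,
      eLpNorm (Function.uncurry (g n).process - Function.uncurry f) 2 ((timeLeb T).prod P) ≤
        (((4⁻¹ : ℝ≥0) ^ n : ℝ≥0) : ℝ≥0∞) := by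
  have h : ∀ n : ℕ, (((4⁻¹ : ℝ≥0) ^ n : ℝ≥0) : ℝ≥0∞) ≠ 0 := fun n => by simp
  choose g hg using fun n => hf.exists_simpleIntegrand hT (h n)
  exact ⟨g, fun n => by rw [eLpNorm_sub_comm]; exact hg n⟩

theorem eLpNorm_simpleIntegral_sub_le (hy : y.IsModifiedArratiaFlow P) (hT : 0 < T)
    (hf : MemA2 y.filtration P f) {g : ℕ → SimpleIntegrand y.filtration P}
    (hg : ∀ n, eLpNorm (Function.uncurry (g n).process - Function.uncurry f) 2 ((timeLeb T).prod P) ≤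
        (((4⁻¹ : ℝ≥0) ^ n : ℝ≥0) : ℝ≥0∞)) (n : ℕ) :
    eLpNorm (y.simpleIntegral (g n) ⊤ - y.simpleIntegral (g (n + 1)) ⊤) 2 P ≤
      (2 : ℝ≥0) * (4⁻¹ : ℝ≥0) ^ n := by
  have hm := fun n => (g n).stronglyMeasurable_uncurry hT
  have hfm := hf.1.stronglyMeasurable_uncurry
  refine ((y.isStepIntegral_simpleIntegral (g n)).eLpNorm_sub_le
    (y.isStepIntegral_simpleIntegral (g (n + 1))) hy (hm n) (hm (n + 1))).trans ?_
  rw [← sub_sub_sub_cancel_right _ _ (Function.uncurry f)]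
  refine (MeasureTheory.eLpNorm_sub_le ((hm n).sub hfm).aestronglyMeasurable
    ((hm (n + 1)).sub hfm).aestronglyMeasurable one_le_two).trans
    ((add_le_add (hg n) (hg (n + 1))).trans ?_)
  rw [← ENNReal.coe_pow, ← ENNReal.coe_mul, ← ENNReal.coe_add, ENNReal.coe_le_coe,
    ← NNReal.coe_le_coe]
  push_cast
  have : (0 : ℝ) ≤ (4⁻¹ : ℝ) ^ n := by positivity
  rw [pow_succ]
  linarith

theorem tendsto_geometric_zero :
    Tendsto (fun n : ℕ => (((4⁻¹ : ℝ≥0) ^ n : ℝ≥0) : ℝ≥0∞)) atTop (𝓝 0) :=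
  ENNReal.tendsto_coe.2 (tendsto_pow_atTop_nhds_zero_of_lt_one (r := (4⁻¹ : ℝ≥0)) zero_le
    (by rw [← NNReal.coe_lt_coe]; norm_num))

/-- Progressive measurability of this version is recorded because the integral of an element of `𝓐`
will be a pointwise limit of such versions and must still be adapted after stopping. -/
theorem exists_isStochasticIntegral (hy : y.IsModifiedArratiaFlow P) (hT : 0 < T)
    (hf : MemA2 y.filtration P f) :
    ∃ M, y.IsStochasticIntegral P f M ∧ IsStronglyProgressive y.filtration M := by
  obtain ⟨g, hg⟩ := exists_simpleIntegrand_geometric hT hf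
  have hs := fun n => y.isStepIntegral_simpleIntegral (P := P) (g n)
  obtain ⟨M, hM, hMp, hlim⟩ := exists_limit_isContSqMartingale
    (fun n => (hs n).isContSqMartingale hy)
    (fun n => (hs n).stronglyAdapted.isStronglyProgressive_of_continuous (hs n).continuous) 2
    (eLpNorm_simpleIntegral_sub_le hy hT hf hg)
  refine ⟨M, ⟨hM, g, ?_, ?_⟩, hMp⟩
  · simp_rw [fun n => sqNormA2_sub_eq (P := P) ((g n).stronglyMeasurable_uncurry hT)
      hf.1.stronglyMeasurable_uncurry]
    rw [tendsto_sq_nhds_zero_iff]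
    exact tendsto_of_tendsto_of_tendsto_of_le_of_le tendsto_const_nhds tendsto_geometric_zero
      (fun _ => zero_le) hg
  · simp_rw [sqNormM2_sub_eq]
    rw [tendsto_sq_nhds_zero_iff]
    exact hlim ⊤

theorem isQuadraticVariation_simpleIntegral (hy : y.IsModifiedArratiaFlow P) (hT : 0 < T)
    (g : SimpleIntegrand y.filtration P) :
    IsQuadraticVariation y.filtration P (y.simpleIntegral g) (y.projectedEnergy g.process) :=
  ((y.isStepIntegral_simpleIntegral g).hasEnergy hy
    (g.stronglyMeasurable_uncurry hT)).isQuadraticVariation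
    ((y.isStepIntegral_simpleIntegral g).isContSqMartingale hy) (g.memA2 hT)

/-- The integrals of a fast approximating sequence converge uniformly. -/
theorem IsStochasticIntegral.ae_tendstoUniformly (hy : y.IsModifiedArratiaFlow P) (hT : 0 < T)
    (hf : MemA2 y.filtration P f) (hM : y.IsStochasticIntegral P f M)
    {g : ℕ → SimpleIntegrand y.filtration P}
    (hg : ∀ n, eLpNorm (Function.uncurry (g n).process - Function.uncurry f) 2 ((timeLeb T).prod P) ≤
        (((4⁻¹ : ℝ≥0) ^ n : ℝ≥0) : ℝ≥0∞)) :
    ∀ᵐ ω ∂P, TendstoUniformly (fun n t => y.simpleIntegral (g n) t ω) (fun t => M t ω) atTop := by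
  have hs := fun n => y.isStepIntegral_simpleIntegral (P := P) (g n)
  have hgf : Tendsto (fun n => eLpNorm (Function.uncurry (g n).process - Function.uncurry f) 2
      ((timeLeb T).prod P)) atTop (𝓝 0) :=
    tendsto_of_tendsto_of_tendsto_of_le_of_le tendsto_const_nhds tendsto_geometric_zero
      (fun _ => zero_le) hg
  have hlim := hM.tendsto_stepIntegral hy hT hf hs
    (fun n => (g n).stronglyMeasurable_uncurry hT) hgf
  have hunif : ∀ᵐ ω ∂P, TendstoUniformly (fun n t => y.simpleIntegral (g n) t ω)
      (fun t => limUnder atTop fun n => y.simpleIntegral (g n) t ω) atTop := by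
    filter_upwards [ae_eventually_forall_abs_sub_le (fun n => (hs n).isContSqMartingale hy) 2
      (eLpNorm_simpleIntegral_sub_le hy hT hf hg)] with ω hω
    exact tendstoUniformly_of_geometric hω fun t => fun ⟨l, hl⟩ => by rwa [hl.limUnder_eq]
  -- At a fixed time the L² limit and the pathwise limit agree almost surely; this is used at the
  -- dense times only, and continuity does the rest.
  have hpt : ∀ t, M t =ᵐ[P] fun ω => limUnder atTop fun n => y.simpleIntegral (g n) t ω := fun t =>
    ae_eq_of_tendsto_eLpNorm (fun n => (((hs n).isContSqMartingale hy).memLp t).1) one_le_two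
      (hM.1.memLp t).1 (hlim t) (hunif.mono fun ω hω => hω.tendsto_at t)
  filter_upwards [hunif, hM.1.continuous, ae_all_iff.2 fun j => hpt (denseTime T j)]
    with ω h1 h2 h3
  have h4 := forall_eq_of_forall_denseTime_eq h2
    (h1.continuous (Frequently.of_forall fun n => (hs n).continuous ω)) h3
  have h5 : (fun t => M t ω) = fun t => limUnder atTop fun n => y.simpleIntegral (g n) t ω :=
    funext h4
  rwa [h5]

end RandomFlow

/-! ### Stopping times and their approximation from above by finitely many values. -/

section StoppingTimes

variable {T : ℝ≥0}

/-- The minimum of a time and a possibly infinite time. -/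
noncomputable def stopTime (τ : WithTop (TimeInterval T)) (t : TimeInterval T) : TimeInterval T :=
  (min (t : WithTop (TimeInterval T)) τ).untopA

theorem coe_stopTime (τ : WithTop (TimeInterval T)) (t : TimeInterval T) :
    (stopTime τ t : WithTop (TimeInterval T)) = min (t : WithTop (TimeInterval T)) τ := by
  rw [stopTime, WithTop.untopA_eq_untop
    (ne_top_of_le_ne_top (WithTop.coe_ne_top (a := t)) (min_le_left _ _)), WithTop.coe_untop]

theorem le_stopTime_iff {τ : WithTop (TimeInterval T)} {t a : TimeInterval T} :
    a ≤ stopTime τ t ↔ a ≤ t ∧ (a : WithTop (TimeInterval T)) ≤ τ := by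
  rw [← WithTop.coe_le_coe, coe_stopTime, le_min_iff, WithTop.coe_le_coe]

theorem stopTime_lt_iff {τ : WithTop (TimeInterval T)} {t a : TimeInterval T} :
    stopTime τ t < a ↔ t < a ∨ τ < a := by
  rw [← WithTop.coe_lt_coe, coe_stopTime, min_lt_iff, WithTop.coe_lt_coe]

theorem stopTime_eq_self {τ : WithTop (TimeInterval T)} {t : TimeInterval T}
    (h : (t : WithTop (TimeInterval T)) ≤ τ) : stopTime τ t = t :=
  WithTop.coe_injective (by rw [coe_stopTime, min_eq_left h])

theorem stopTime_eq_stopTime {τ : WithTop (TimeInterval T)} {s t : TimeInterval T} (hst : s ≤ t)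
    (h : τ ≤ s) : stopTime τ t = stopTime τ s :=
  WithTop.coe_injective (by
    rw [coe_stopTime, coe_stopTime, min_eq_right h, min_eq_right (h.trans (WithTop.coe_le_coe.2 hst))])

theorem continuous_stopTime (τ : WithTop (TimeInterval T)) : Continuous (stopTime τ) := by
  induction τ using WithTop.recTopCoe with
  | top =>
    have : stopTime (⊤ : WithTop (TimeInterval T)) = id := funext fun t => stopTime_eq_self le_top
    rw [this]
    exact continuous_id
  | coe c =>
    have : stopTime (c : WithTop (TimeInterval T)) = fun t => min t c := funext fun t =>
      WithTop.coe_injective (by rw [coe_stopTime, WithTop.coe_min])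
    rw [this]
    exact continuous_id.min continuous_const

variable {Ω : Type*} {mΩ : MeasurableSpace Ω} {𝓕 : Filtration (TimeInterval T) mΩ}

theorem stoppedProcess_eq_stopTime {E : Type*} (u : TimeInterval T → Ω → E)
    (τ : Ω → WithTop (TimeInterval T)) (t : TimeInterval T) (ω : Ω) :
    stoppedProcess u τ t ω = u (stopTime (τ ω) t) ω := rfl

/-- The least of the first `m` times of a dense sequence after the time `τ`. -/
noncomputable def upperTime (m : ℕ) (τ : WithTop (TimeInterval T)) : WithTop (TimeInterval T) :=
  (Finset.range m).inf fun j => if τ ≤ denseTime T j then (denseTime T j : WithTop (TimeInterval T)) else ⊤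

theorem le_upperTime (m : ℕ) (τ : WithTop (TimeInterval T)) : τ ≤ upperTime m τ := by
  refine Finset.le_inf fun j _ => ?_
  split_ifs with h
  · exact h
  · exact le_top

theorem upperTime_le_iff {m : ℕ} {τ : WithTop (TimeInterval T)} {t : TimeInterval T} :
    upperTime m τ ≤ t ↔ ∃ j < m, τ ≤ denseTime T j ∧ denseTime T j ≤ t := by
  rw [upperTime, Finset.inf_le_iff (WithTop.coe_lt_top t)]
  simp only [Finset.mem_range]
  refine exists_congr fun j => and_congr_right fun _ => ?_
  split_ifs with h
  · simp [h]
  · simp [h]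

theorem upperTime_mem (m : ℕ) (τ : WithTop (TimeInterval T)) :
    upperTime m τ = ⊤ ∨ ∃ c ∈ (Finset.range m).image (denseTime T), upperTime m τ = c := by
  rcases (Finset.range m).eq_empty_or_nonempty with h | h
  · left
    rw [upperTime, h, Finset.inf_empty]
  obtain ⟨j, hj, h2⟩ := Finset.exists_mem_eq_inf _ h
    fun j => if τ ≤ denseTime T j then (denseTime T j : WithTop (TimeInterval T)) else ⊤
  rw [upperTime, h2]
  split_ifs with h3
  · exact Or.inr ⟨_, Finset.mem_image_of_mem _ hj, rfl⟩
  · exact Or.inl rfl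

theorem exists_denseTime_between {τ : WithTop (TimeInterval T)} {s : TimeInterval T} (h : τ < s) :
    ∃ j, τ < denseTime T j ∧ denseTime T j < s := by
  lift τ to TimeInterval T using (h.trans (WithTop.coe_lt_top s)).ne with c
  rw [WithTop.coe_lt_coe] at h
  obtain ⟨j, hj⟩ := exists_denseTime_mem (isOpen_Ioo (a := c) (b := s)) (nonempty_Ioo.2 h)
  exact ⟨j, WithTop.coe_lt_coe.2 hj.1, hj.2⟩

theorem eventually_upperTime_lt {τ : WithTop (TimeInterval T)} {s : TimeInterval T} (h : τ < s) :
    ∀ᶠ m in atTop, upperTime m τ < s := by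
  obtain ⟨j, h1, h2⟩ := exists_denseTime_between h
  filter_upwards [eventually_gt_atTop j] with m hm
  exact (upperTime_le_iff.2 ⟨j, hm, h1.le, le_rfl⟩).trans_lt (WithTop.coe_lt_coe.2 h2)

/-- The approximation never falls below `τ`, and a dense time eventually lies between `τ` and any
later time. When no listed time follows `τ` the value is `⊤`, which is harmless after taking the
minimum with `t`. -/
theorem tendsto_stopTime_upperTime (τ : WithTop (TimeInterval T)) (t : TimeInterval T) :
    Tendsto (fun m => stopTime (upperTime m τ) t) atTop (𝓝 (stopTime τ t)) := by
  rw [tendsto_order]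
  refine ⟨fun a ha => Eventually.of_forall fun m => ha.trans_le ?_, fun a ha => ?_⟩
  · have := le_stopTime_iff.1 (le_refl (stopTime τ t))
    exact le_stopTime_iff.2 ⟨this.1, this.2.trans (le_upperTime m τ)⟩
  · rcases stopTime_lt_iff.1 ha with h | h
    · exact Eventually.of_forall fun m => stopTime_lt_iff.2 (Or.inl h)
    · filter_upwards [eventually_upperTime_lt h] with m hm using stopTime_lt_iff.2 (Or.inr hm)

/-- Rounding upwards uses only the events `{τ ≤ d}` for dense times `d ≤ t`, all of which belong to
`𝓕_t`. -/
theorem MeasureTheory.IsStoppingTime.upperTime {τ : Ω → WithTop (TimeInterval T)}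
    (hτ : IsStoppingTime 𝓕 τ) (m : ℕ) : IsStoppingTime 𝓕 fun ω => upperTime m (τ ω) := by
  intro t
  have : {ω | _root_.upperTime m (τ ω) ≤ t} = ⋃ j ∈ {j | j < m ∧ denseTime T j ≤ t},
      {ω | τ ω ≤ denseTime T j} := by
    ext ω
    simp only [mem_ofPred_eq, upperTime_le_iff, mem_iUnion]
    constructor
    · rintro ⟨j, h1, h2, h3⟩
      exact ⟨j, ⟨h1, h3⟩, h2⟩
    · rintro ⟨j, ⟨h1, h3⟩, h2⟩
      exact ⟨j, h1, h2, h3⟩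
  rw [this]
  exact MeasurableSet.biUnion (to_countable _) fun j hj => 𝓕.mono hj.2 _ (hτ _)

/-- The complement `{τ < s}` is a countable union of predictable rectangles, because a dense time
separates `τ` from `s`. Right-continuity of the filtration plays no role. -/
theorem MeasureTheory.IsStoppingTime.measurableSet_predictable_le {τ : Ω → WithTop (TimeInterval T)}
    (hτ : IsStoppingTime 𝓕 τ) :
    MeasurableSet[𝓕.predictable] {p : TimeInterval T × Ω | (p.1 : WithTop (TimeInterval T)) ≤ τ p.2} := by
  have : {p : TimeInterval T × Ω | (p.1 : WithTop (TimeInterval T)) ≤ τ p.2} =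
      (⋃ j, Ioi (denseTime T j) ×ˢ {ω | τ ω ≤ denseTime T j})ᶜ := by
    ext p
    simp only [mem_ofPred_eq, mem_compl_iff, mem_iUnion, mem_prod, mem_Ioi, not_exists, not_and,
      not_le]
    constructor
    · intro h j hj
      exact (WithTop.coe_lt_coe.2 hj).trans_le h
    · intro h
      by_contra hlt
      obtain ⟨j, h1, h2⟩ := exists_denseTime_between (not_le.1 hlt)
      exact lt_irrefl _ ((h j h2).trans h1)
  rw [this]
  exact (MeasurableSet.iUnion fun j => measurableSet_predictable_Ioi_prod (hτ _)).compl

theorem MeasureTheory.IsStronglyPredictable.stopped {E : Type*} [TopologicalSpace E] [Zero E]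
    {f : TimeInterval T → Ω → E} (hf : IsStronglyPredictable 𝓕 f)
    {τ : Ω → WithTop (TimeInterval T)} (hτ : IsStoppingTime 𝓕 τ) :
    IsStronglyPredictable 𝓕 fun s => {ω | (s : WithTop (TimeInterval T)) ≤ τ ω}.indicator (f s) :=
  StronglyMeasurable.indicator hf hτ.measurableSet_predictable_le

theorem MemA2.stopped {P : Measure Ω} {f : TimeInterval T → Ω → L2} (hf : MemA2 𝓕 P f)
    {τ : Ω → WithTop (TimeInterval T)} (hτ : IsStoppingTime 𝓕 τ) :
    MemA2 𝓕 P fun s => {ω | (s : WithTop (TimeInterval T)) ≤ τ ω}.indicator (f s) := by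
  refine ⟨hf.1.stopped hτ, lt_of_le_of_lt (lintegral_mono fun ω => lintegral_mono fun s => ?_) hf.2⟩
  gcongr
  exact enorm_indicator_le_enorm_self _ _

end StoppingTimes

/-! ### Stopping a stochastic integral. -/

namespace RandomFlow

variable {T : ℝ≥0} {Ω : Type*} [mΩ : MeasurableSpace Ω] {y : RandomFlow T Ω} {P : Measure Ω}
  {f : TimeInterval T → Ω → L2} {M : TimeInterval T → Ω → ℝ}

/-- The finitely many values of `σ` are added to the breakpoints. On an interval without breakpoints
either `σ ≤ s` or `t ≤ σ`, and the event `{s < σ}` that decides belongs to `𝓕_s`, so the cut-off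
direction is still known at time `s`. -/
theorem IsStepIntegral.stopped (h : y.IsStepIntegral P f M) {σ : Ω → WithTop (TimeInterval T)}
    (hσ : IsStoppingTime y.filtration σ) (G : Finset (TimeInterval T))
    (hG : ∀ ω, σ ω = ⊤ ∨ ∃ c ∈ G, σ ω = c) :
    y.IsStepIntegral P (fun s => {ω | (s : WithTop (TimeInterval T)) ≤ σ ω}.indicator (f s))
      (stoppedProcess M σ) := by
  classical
  obtain ⟨S, hS⟩ := h.step
  refine ⟨fun ω => ?_, fun ω => (h.continuous ω).comp (continuous_stopTime (σ ω)), S ∪ G,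
    fun s t hst hfree => ?_⟩
  · rw [stoppedProcess_eq_stopTime, le_bot_iff.1 (le_stopTime_iff.1 (le_refl (stopTime (σ ω) ⊥))).1,
      h.zero]
  obtain ⟨φ, h1, h2, h3, h4⟩ := hS s t hst fun c hc => hfree c (Finset.mem_union_left _ hc)
  have hm : MeasurableSet[y.filtration s] {ω | (s : WithTop (TimeInterval T)) < σ ω} := by
    have : {ω | (s : WithTop (TimeInterval T)) < σ ω} = {ω | σ ω ≤ s}ᶜ := by
      ext ω
      simp
    rw [this]
    exact (hσ s).compl
  have hdich : ∀ ω, (s : WithTop (TimeInterval T)) < σ ω → (t : WithTop (TimeInterval T)) ≤ σ ω := by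
    intro ω hω
    rcases hG ω with h5 | ⟨c, hc, h5⟩
    · rw [h5]
      exact le_top
    · rw [h5] at hω ⊢
      rw [WithTop.coe_lt_coe] at hω
      rw [WithTop.coe_le_coe]
      by_contra hct
      exact hfree c (Finset.mem_union_right _ hc) ⟨hω, not_le.1 hct⟩
  refine ⟨{ω | (s : WithTop (TimeInterval T)) < σ ω}.indicator φ, h1.indicator hm,
    h2.indicator (y.filtration.le s _ hm), fun r hr ω => ?_, fun ω => ?_⟩
  · by_cases hω : (s : WithTop (TimeInterval T)) < σ ω
    · rw [indicator_of_mem (show ω ∈ {ω | (s : WithTop (TimeInterval T)) < σ ω} from hω),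
        indicator_of_mem, h3 r hr]
      exact (WithTop.coe_le_coe.2 hr.2).trans (hdich ω hω)
    · rw [indicator_of_notMem (show ω ∉ {ω | (s : WithTop (TimeInterval T)) < σ ω} from hω),
        indicator_of_notMem]
      exact fun h6 => hω ((WithTop.coe_lt_coe.2 hr.1).trans_le h6)
  · simp only [stoppedProcess_eq_stopTime]
    by_cases hω : (s : WithTop (TimeInterval T)) < σ ω
    · rw [indicator_of_mem (show ω ∈ {ω | (s : WithTop (TimeInterval T)) < σ ω} from hω),
        stopTime_eq_self (hdich ω hω), stopTime_eq_self hω.le, h4]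
    · rw [indicator_of_notMem (show ω ∉ {ω | (s : WithTop (TimeInterval T)) < σ ω} from hω),
        stopTime_eq_stopTime hst (not_lt.1 hω), sub_self, inner_zero_left]

variable [IsProbabilityMeasure P]

/-- The two cut-offs differ only between `τ` and its approximation, a set which each point
eventually leaves; `g` dominates. -/
theorem tendsto_eLpNorm_stopped_upperTime {g : TimeInterval T → Ω → L2}
    (hg : MemA2 y.filtration P g) {τ : Ω → WithTop (TimeInterval T)}
    (hτ : IsStoppingTime y.filtration τ) :
    Tendsto (fun m => eLpNorm (Function.uncurry (fun s : TimeInterval T =>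
        {ω | (s : WithTop (TimeInterval T)) ≤ upperTime m (τ ω)}.indicator (g s)) -
      Function.uncurry fun s : TimeInterval T => {ω | (s : WithTop (TimeInterval T)) ≤ τ ω}.indicator (g s)) 2
      ((timeLeb T).prod P)) atTop (𝓝 0) := by
  rw [← tendsto_sq_nhds_zero_iff]
  simp_rw [sq_eLpNorm_two]
  have hlim := tendsto_lintegral_of_dominated_convergence (μ := (timeLeb T).prod P)
    (F := fun m p => ‖(Function.uncurry (fun s : TimeInterval T =>
        {ω | (s : WithTop (TimeInterval T)) ≤ upperTime m (τ ω)}.indicator (g s)) -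
      Function.uncurry fun s : TimeInterval T => {ω | (s : WithTop (TimeInterval T)) ≤ τ ω}.indicator (g s)) p‖ₑ ^ 2)
    (f := fun _ => 0) (fun p => ‖Function.uncurry g p‖ₑ ^ 2)
    (fun m => (((hg.1.stopped (hτ.upperTime m)).stronglyMeasurable_uncurry.sub
      (hg.1.stopped hτ).stronglyMeasurable_uncurry).enorm.pow_const 2)) ?_ ?_ ?_
  · simpa using hlim
  · refine fun m => Eventually.of_forall fun p => ?_
    simp only [Pi.sub_apply, Function.uncurry]
    gcongr
    by_cases h1 : (p.1 : WithTop (TimeInterval T)) ≤ τ p.2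
    · have h2 := h1.trans (le_upperTime m _)
      simp [h1, h2]
    · by_cases h2 : (p.1 : WithTop (TimeInterval T)) ≤ upperTime m (τ p.2) <;> simp [h1, h2]
  · rw [← sq_eLpNorm_two]
    exact (ENNReal.pow_lt_top hg.memLp.2).ne
  · refine Eventually.of_forall fun p => tendsto_const_nhds.congr' ?_
    by_cases h1 : (p.1 : WithTop (TimeInterval T)) ≤ τ p.2
    · refine Eventually.of_forall fun m => ?_
      have h2 := h1.trans (le_upperTime m _)
      simp [Function.uncurry, h1, h2]
    · filter_upwards [eventually_upperTime_lt (not_le.1 h1)] with m hm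
      simp [Function.uncurry, h1, not_le.2 hm]

/-- Stopping a stochastic integral amounts to cutting off the integrand. -/
theorem IsStochasticIntegral.ae_stoppedProcess_eq (hy : y.IsModifiedArratiaFlow P) (hT : 0 < T)
    (hf : MemA2 y.filtration P f) (hM : y.IsStochasticIntegral P f M)
    {τ : Ω → WithTop (TimeInterval T)} (hτ : IsStoppingTime y.filtration τ)
    {Z : TimeInterval T → Ω → ℝ} (hZ : y.IsStochasticIntegral P
      (fun s => {ω | (s : WithTop (TimeInterval T)) ≤ τ ω}.indicator (f s)) Z) :
    ∀ᵐ ω ∂P, ∀ t, stoppedProcess M τ t ω = Z t ω := by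
  obtain ⟨g, hg⟩ := exists_simpleIntegrand_geometric hT hf
  have hε : ∀ k : ℕ, (0 : ℝ≥0∞) < (((4⁻¹ : ℝ≥0) ^ k : ℝ≥0) : ℝ≥0∞) := fun k =>
    pos_iff_ne_zero.2 (by simp)
  -- For each simple approximation a discretization of `τ` is chosen fine enough for its cut-off.
  -- The condition `k ≤ m` makes the discretized times converge to `τ` along the chosen sequence.
  have hch : ∀ k, ∃ m, k ≤ m ∧ eLpNorm (Function.uncurry (fun s : TimeInterval T =>
        {ω | (s : WithTop (TimeInterval T)) ≤ upperTime m (τ ω)}.indicator ((g k).process s)) -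
      Function.uncurry fun s : TimeInterval T => {ω | (s : WithTop (TimeInterval T)) ≤ τ ω}.indicator ((g k).process s)) 2
      ((timeLeb T).prod P) ≤ (((4⁻¹ : ℝ≥0) ^ k : ℝ≥0) : ℝ≥0∞) := fun k => by
    obtain ⟨m, h1, h2⟩ := (((tendsto_eLpNorm_stopped_upperTime ((g k).memA2 hT) hτ).eventually
      (gt_mem_nhds (hε k))).and (eventually_ge_atTop k)).exists
    exact ⟨m, h2, h1.le⟩
  choose m hkm hm using hch
  have hstep : ∀ k, y.IsStepIntegral P (fun s =>
      {ω | (s : WithTop (TimeInterval T)) ≤ upperTime (m k) (τ ω)}.indicator ((g k).process s))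
      (stoppedProcess (y.simpleIntegral (g k)) fun ω => upperTime (m k) (τ ω)) := fun k =>
    (y.isStepIntegral_simpleIntegral (g k)).stopped (hτ.upperTime (m k)) _
      fun ω => upperTime_mem (m k) (τ ω)
  have hsm : ∀ k, StronglyMeasurable (Function.uncurry fun s : TimeInterval T =>
      {ω | (s : WithTop (TimeInterval T)) ≤ upperTime (m k) (τ ω)}.indicator ((g k).process s)) :=
    fun k => (((g k).isStronglyPredictable hT).stopped (hτ.upperTime (m k))).stronglyMeasurable_uncurry
  have hsτ : ∀ k, StronglyMeasurable (Function.uncurry fun s : TimeInterval T =>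
      {ω | (s : WithTop (TimeInterval T)) ≤ τ ω}.indicator ((g k).process s)) :=
    fun k => (((g k).isStronglyPredictable hT).stopped hτ).stronglyMeasurable_uncurry
  have hfτ := (hf.stopped hτ).1.stronglyMeasurable_uncurry
  have happ : Tendsto (fun k => eLpNorm (Function.uncurry (fun s : TimeInterval T =>
      {ω | (s : WithTop (TimeInterval T)) ≤ upperTime (m k) (τ ω)}.indicator ((g k).process s)) -
      Function.uncurry fun s : TimeInterval T => {ω | (s : WithTop (TimeInterval T)) ≤ τ ω}.indicator (f s)) 2
      ((timeLeb T).prod P)) atTop (𝓝 0) := by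
    have h0 := tendsto_geometric_zero.add tendsto_geometric_zero
    rw [add_zero] at h0
    refine tendsto_of_tendsto_of_tendsto_of_le_of_le tendsto_const_nhds h0 (fun _ => zero_le)
      fun k => ?_
    rw [← sub_add_sub_cancel _ (Function.uncurry fun s : TimeInterval T =>
      {ω | (s : WithTop (TimeInterval T)) ≤ τ ω}.indicator ((g k).process s))]
    refine (eLpNorm_add_le ((hsm k).sub (hsτ k)).aestronglyMeasurable
      ((hsτ k).sub hfτ).aestronglyMeasurable one_le_two).trans (add_le_add (hm k) ?_)
    refine (eLpNorm_mono fun p => ?_).trans (hg k)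
    by_cases h1 : (p.1 : WithTop (TimeInterval T)) ≤ τ p.2 <;> simp [Function.uncurry, h1]
  have hunif := hM.ae_tendstoUniformly hy hT hf hg
  -- The stopped simple integrals converge in L² to `Z t`. They also converge pathwise to the
  -- stopped value of `M`, because the unstopped ones converge uniformly, the times converge and `M`
  -- is continuous.
  have hpt : ∀ t, Z t =ᵐ[P] fun ω => stoppedProcess M τ t ω := fun t => by
    refine ae_eq_of_tendsto_eLpNorm (fun k => (((hstep k).isContSqMartingale hy).memLp t).1)
      one_le_two (hZ.1.memLp t).1 (hZ.tendsto_stepIntegral hy hT (hf.stopped hτ) hstep hsm happ t) ?_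
    filter_upwards [hunif, hM.1.continuous] with ω h1 h2
    exact h1.tendsto_comp h2.continuousAt ((tendsto_stopTime_upperTime (τ ω) t).comp
      (tendsto_atTop_mono hkm tendsto_id))
  filter_upwards [hM.1.continuous, hZ.1.continuous, ae_all_iff.2 fun j => hpt (denseTime T j)]
    with ω h1 h2 h3
  exact forall_eq_of_forall_denseTime_eq (h1.comp (continuous_stopTime (τ ω))) h2
    fun j => (h3 j).symm

end RandomFlow

/-! ### Hitting times of the running energy and localization in `𝓐`. -/

section RunningEnergy

variable {T : ℝ≥0}

theorem setLIntegral_Iio_eq_iSup (x : TimeInterval T → ℝ≥0∞) (a : TimeInterval T) :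
    ∫⁻ s in Iio a, x s ∂timeLeb T =
      ⨆ j : {j : ℕ // denseTime T j < a}, ∫⁻ s in Iic (denseTime T j), x s ∂timeLeb T := by
  have h : Iio a = ⋃ j : {j : ℕ // denseTime T j < a}, Iic (denseTime T j) := by
    ext s
    simp only [mem_Iio, mem_iUnion, mem_Iic]
    constructor
    · intro hs
      obtain ⟨j, hj⟩ := exists_denseTime_mem (isOpen_Ioo (a := s) (b := a)) (nonempty_Ioo.2 hs)
      exact ⟨⟨j, hj.2⟩, hj.1.le⟩
    · rintro ⟨j, hj⟩
      exact hj.trans_lt j.2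
  conv_lhs => rw [h]
  refine setLIntegral_iUnion_of_directed _ fun i j => ?_
  rcases le_total (denseTime T i) (denseTime T j) with h1 | h1
  · exact ⟨j, Iic_subset_Iic.2 h1, subset_rfl⟩
  · exact ⟨i, subset_rfl, Iic_subset_Iic.2 h1⟩

theorem continuous_setLIntegral_Iic {x : TimeInterval T → ℝ≥0∞} (hx : Measurable x)
    (hfin : ∫⁻ s, x s ∂timeLeb T < ∞) : Continuous fun t => ∫⁻ s in Iic t, x s ∂timeLeb T := by
  have h1 : ∀ t, ∫⁻ s in Iic t, x s ∂timeLeb T =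
      ENNReal.ofReal (∫ s in Iic t, (x s).toReal ∂timeLeb T) := fun t => by
    rw [integral_toReal hx.aemeasurable (ae_restrict_of_ae (ae_lt_top hx hfin.ne)),
      ENNReal.ofReal_toReal]
    exact ((setLIntegral_le_lintegral _ _).trans_lt hfin).ne
  simp_rw [h1]
  exact ENNReal.continuous_ofReal.comp (continuous_setIntegral_Iic
    (integrable_toReal_of_lintegral_ne_top hx.aemeasurable hfin.ne))

theorem monotone_setLIntegral_Iic (x : TimeInterval T → ℝ≥0∞) :
    Monotone fun t => ∫⁻ s in Iic t, x s ∂timeLeb T := fun _ _ hst =>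
  lintegral_mono_set (Iic_subset_Iic.2 hst)

/-- The part of `x` before its integral exceeds `c`. -/
noncomputable def energyCut (x : TimeInterval T → ℝ≥0∞) (c : ℝ≥0∞) : TimeInterval T → ℝ≥0∞ :=
  {t | ∫⁻ s in Iic t, x s ∂timeLeb T ≤ c}.indicator x

theorem energyCut_le (x : TimeInterval T → ℝ≥0∞) (c : ℝ≥0∞) (s : TimeInterval T) :
    energyCut x c s ≤ x s := indicator_le_self _ _ _

/-- No integrability of `x` is assumed, so the running integral may jump from a value below `c` to
`∞`. The times with running integral at most `c` form an initial segment; its end point is null, and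
the part before it is exhausted by intervals `[0, d]` with `d` dense, each of energy at most `c`. -/
theorem lintegral_energyCut_le (x : TimeInterval T → ℝ≥0∞) (c : ℝ≥0∞) :
    ∫⁻ s, energyCut x c s ∂timeLeb T ≤ c := by
  set I := {t | ∫⁻ s in Iic t, x s ∂timeLeb T ≤ c} with hI
  have hle : ∀ᵐ s ∂timeLeb T, energyCut x c s ≤ (Iio (sSup I)).indicator x s := by
    filter_upwards [compl_mem_ae_iff.2 (measure_singleton (μ := timeLeb T) (sSup I))] with s hs
    by_cases hsI : s ∈ I
    · have h1 : s < sSup I := lt_of_le_of_ne (le_sSup hsI) hs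
      rw [indicator_of_mem (mem_Iio.2 h1)]
      exact energyCut_le x c s
    · rw [energyCut, indicator_of_notMem hsI]
      exact zero_le
  refine (lintegral_mono_ae hle).trans ?_
  rw [lintegral_indicator measurableSet_Iio, setLIntegral_Iio_eq_iSup]
  refine iSup_le fun j => ?_
  obtain ⟨i, hi, hji⟩ := lt_sSup_iff.1 j.2
  exact (monotone_setLIntegral_Iic x hji.le).trans hi

theorem measurable_energyCut {x : TimeInterval T → ℝ≥0∞} (hx : Measurable x) (c : ℝ≥0∞) :
    Measurable (energyCut x c) :=
  hx.indicator ((monotone_setLIntegral_Iic x).measurable measurableSet_Iic)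

/-- For finite total energy the running integral is continuous and takes the value `c` at some time;
up to that time nothing is cut. -/
theorem le_lintegral_energyCut_iff {x : TimeInterval T → ℝ≥0∞} (hx : Measurable x)
    (hfin : ∫⁻ s, x s ∂timeLeb T < ∞) (c : ℝ≥0∞) (t : TimeInterval T) :
    c ≤ ∫⁻ s in Iic t, energyCut x c s ∂timeLeb T ↔ c ≤ ∫⁻ s in Iic t, x s ∂timeLeb T := by
  refine ⟨fun h => h.trans (lintegral_mono fun s => energyCut_le x c s), fun h => ?_⟩
  have h0 : ∫⁻ s in Iic ⊥, x s ∂timeLeb T ≤ c := by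
    rw [Iic_bot, setLIntegral_measure_zero _ _ (measure_singleton _)]
    exact zero_le
  obtain ⟨r, hr, hrc⟩ := intermediate_value_Icc (bot_le (a := t))
    (continuous_setLIntegral_Iic hx hfin).continuousOn ⟨h0, h⟩
  have h1 : ∫⁻ s in Iic r, energyCut x c s ∂timeLeb T = ∫⁻ s in Iic r, x s ∂timeLeb T := by
    refine setLIntegral_congr_fun measurableSet_Iic fun s hs => indicator_of_mem ?_ _
    exact (monotone_setLIntegral_Iic x (mem_Iic.1 hs)).trans hrc.le
  calc c = ∫⁻ s in Iic r, energyCut x c s ∂timeLeb T := by rw [h1]; exact hrc.symm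
    _ ≤ _ := monotone_setLIntegral_Iic _ hr.2

open Classical in
/-- The first time at which `x` reaches the level `c`. -/
noncomputable def firstTime (x : TimeInterval T → ℝ≥0∞) (c : ℝ≥0∞) : WithTop (TimeInterval T) :=
  if c ≤ x ⊤ then ((sInf {t | c ≤ x t} : TimeInterval T) : WithTop (TimeInterval T)) else ⊤

theorem firstTime_le_iff {x : TimeInterval T → ℝ≥0∞} (hx : Continuous x) (hm : Monotone x) {c : ℝ≥0∞}
    {t : TimeInterval T} : firstTime x c ≤ t ↔ c ≤ x t := by
  rw [firstTime]
  split_ifs with h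
  · rw [WithTop.coe_le_coe]
    have hmem : sInf {t | c ≤ x t} ∈ {t | c ≤ x t} :=
      (isClosed_le continuous_const hx).csInf_mem ⟨⊤, h⟩ (OrderBot.bddBelow _)
    exact ⟨fun h1 => le_trans hmem (hm h1), fun h1 => sInf_le h1⟩
  · exact ⟨fun h1 => absurd h1 (by simp), fun h1 => absurd (h1.trans (hm le_top)) h⟩

variable {Ω : Type*} {mΩ : MeasurableSpace Ω} {𝓕 : Filtration (TimeInterval T) mΩ}

theorem MeasureTheory.IsStronglyProgressive.measurable_setLIntegral_Iic
    {h : TimeInterval T → Ω → ℝ≥0∞} (hh : IsStronglyProgressive 𝓕 h) (t : TimeInterval T) :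
    Measurable[𝓕 t] fun ω => ∫⁻ s in Iic t, h s ω ∂timeLeb T := by
  have h1 : (fun ω => ∫⁻ s in Iic t, h s ω ∂timeLeb T) =
      fun ω => ∫⁻ s in Iic t, h (min s t) ω ∂timeLeb T := by
    funext ω
    refine setLIntegral_congr_fun measurableSet_Iic fun s hs => ?_
    simp only [min_eq_left (mem_Iic.1 hs)]
  rw [h1]
  exact @Measurable.lintegral_prod_left' _ _ _ (𝓕 t) _ _ _
    (hh.stronglyMeasurable_comp_min t).measurable

/-- The running integral can jump to `∞`, so continuity of paths cannot be invoked. The moving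
domain is encoded as an indicator on a fixed one and Tonelli is applied. -/
theorem MeasureTheory.IsStronglyProgressive.isStronglyProgressive_setLIntegral_Iic
    {h : TimeInterval T → Ω → ℝ≥0∞} (hh : IsStronglyProgressive 𝓕 h) :
    IsStronglyProgressive 𝓕 fun t ω => ∫⁻ s in Iic t, h s ω ∂timeLeb T := by
  intro t
  let m : MeasurableSpace Ω := 𝓕 t
  have h1 : (fun p : Iic t × Ω => ∫⁻ s in Iic (p.1 : TimeInterval T), h s p.2 ∂timeLeb T) =
      fun p : Iic t × Ω => ∫⁻ s, {q : TimeInterval T × (Iic t × Ω) | q.1 ≤ q.2.1}.indicator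
        (fun q => h (min q.1 t) q.2.2) (s, p) ∂timeLeb T := by
    funext p
    rw [← lintegral_indicator measurableSet_Iic]
    refine lintegral_congr fun s => ?_
    by_cases hs : s ≤ p.1
    · rw [indicator_of_mem (mem_Iic.2 hs), indicator_of_mem (by exact hs)]
      simp only [min_eq_left (hs.trans p.1.2)]
    · rw [indicator_of_notMem (by exact hs), indicator_of_notMem (by exact hs)]
  rw [h1]
  have h2 := (hh.stronglyMeasurable_comp_min t).measurable
  have hfst : @Measurable (Iic t × Ω) (Iic t) (Subtype.instMeasurableSpace.prod m) _ Prod.fst :=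
    @measurable_fst _ _ _ m
  have hsnd : @Measurable (Iic t × Ω) Ω (Subtype.instMeasurableSpace.prod m) m Prod.snd :=
    @measurable_snd _ _ _ m
  let m' : MeasurableSpace (Iic t × Ω) := Subtype.instMeasurableSpace.prod m
  have h3 : Measurable fun q : TimeInterval T × (Iic t × Ω) => h (min q.1 t) q.2.2 :=
    @Measurable.comp _ _ _ _ (MeasurableSpace.prod inferInstance m) _ _ _ h2
      (measurable_fst.prodMk (hsnd.comp measurable_snd))
  have h4 : MeasurableSet {q : TimeInterval T × (Iic t × Ω) | q.1 ≤ q.2.1} :=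
    measurableSet_le measurable_fst
      (measurable_subtype_coe.comp (hfst.comp measurable_snd))
  exact (Measurable.lintegral_prod_left' (h3.indicator h4)).stronglyMeasurable

theorem MeasureTheory.IsStronglyProgressive.energyCut {h : TimeInterval T → Ω → ℝ≥0∞}
    (hh : IsStronglyProgressive 𝓕 h) (c : ℝ≥0∞) :
    IsStronglyProgressive 𝓕 fun t ω => energyCut (fun s => h s ω) c t := by
  intro t
  let m : MeasurableSpace (Iic t × Ω) := Subtype.instMeasurableSpace.prod (𝓕 t)
  exact StronglyMeasurable.indicator
    (s := {p : Iic t × Ω | ∫⁻ r in Iic (p.1 : TimeInterval T), h r p.2 ∂timeLeb T ≤ c}) (hh t)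
    ((hh.isStronglyProgressive_setLIntegral_Iic t).measurable measurableSet_Iic)

/-- The first time at which the running energy `∫₀ᵗ h` reaches the level `c`. -/
noncomputable def energyTime (h : TimeInterval T → Ω → ℝ≥0∞) (c : ℝ≥0∞) (ω : Ω) :
    WithTop (TimeInterval T) :=
  firstTime (fun t => ∫⁻ s in Iic t, energyCut (fun s => h s ω) c s ∂timeLeb T) c

theorem energyTime_le_iff {h : TimeInterval T → Ω → ℝ≥0∞} {ω : Ω} (hω : Measurable fun s => h s ω)
    {c : ℝ≥0∞} (hc : c ≠ ∞) {t : TimeInterval T} : energyTime h c ω ≤ t ↔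
      c ≤ ∫⁻ s in Iic t, energyCut (fun s => h s ω) c s ∂timeLeb T :=
  firstTime_le_iff (continuous_setLIntegral_Iic (measurable_energyCut hω c)
    ((lintegral_energyCut_le _ c).trans_lt hc.lt_top)) (monotone_setLIntegral_Iic _)

/-- The cut energy is at most `c` for every `ω`, hence its running integral is continuous
everywhere, even where the energy of `h` is infinite. Reaching the level before `t` is therefore an
event of `𝓕_t` without completing the filtration. -/
theorem isStoppingTime_energyTime {h : TimeInterval T → Ω → ℝ≥0∞} (hh : IsStronglyProgressive 𝓕 h)
    (hm : ∀ ω, Measurable fun s => h s ω) {c : ℝ≥0∞} (hc : c ≠ ∞) :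
    IsStoppingTime 𝓕 (energyTime h c) := by
  intro t
  simp_rw [fun ω => energyTime_le_iff (hm ω) hc (t := t)]
  exact (hh.energyCut c).measurable_setLIntegral_Iic t measurableSet_Ici

theorem energyTime_le_iff_of_lt_top {h : TimeInterval T → Ω → ℝ≥0∞} {ω : Ω}
    (hω : Measurable fun s => h s ω) (hfin : ∫⁻ s, h s ω ∂timeLeb T < ∞)
    {c : ℝ≥0∞} (hc : c ≠ ∞) {t : TimeInterval T} : energyTime h c ω ≤ t ↔
      c ≤ ∫⁻ s in Iic t, h s ω ∂timeLeb T :=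
  (energyTime_le_iff hω hc).trans (le_lintegral_energyCut_iff hω hfin c t)

theorem ae_timeLeb_coe_ne (τ : WithTop (TimeInterval T)) :
    ∀ᵐ s : TimeInterval T ∂timeLeb T, (s : WithTop (TimeInterval T)) ≠ τ := by
  induction τ using WithTop.recTopCoe with
  | top => exact Eventually.of_forall fun s => WithTop.coe_ne_top
  | coe c =>
    filter_upwards [compl_mem_ae_iff.2 (measure_singleton (μ := timeLeb T) c)] with s hs h
    exact hs (WithTop.coe_injective h)

/-- The top of `WithTop` lies strictly above the last time `T`, hence is isolated. Localizing
sequences thus stop nothing from some index on. -/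
theorem eventually_eq_top_of_tendsto {τ : ℕ → WithTop (TimeInterval T)}
    (h : Tendsto τ atTop (𝓝 ⊤)) : ∀ᶠ n in atTop, τ n = ⊤ := by
  filter_upwards [h.eventually (lt_mem_nhds (WithTop.coe_lt_top (⊤ : TimeInterval T)))] with n hn
  by_contra hne
  lift τ n to TimeInterval T using hne with c
  exact absurd (WithTop.coe_lt_coe.1 hn) (not_lt.2 le_top)

theorem MemA.exists_isLocalizingSequence {P : Measure Ω} [IsProbabilityMeasure P]
    {f : TimeInterval T → Ω → L2} (hf : MemA 𝓕 P f) :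
    ∃ τ : ℕ → Ω → WithTop (TimeInterval T), IsLocalizingSequence 𝓕 τ P ∧ ∀ n, MemA2 𝓕 P
      fun s => {ω | (s : WithTop (TimeInterval T)) ≤ τ n ω}.indicator (f s) := by
  let h : TimeInterval T → Ω → ℝ≥0∞ := fun s ω => ‖f s ω‖ₑ ^ 2
  have hfm := hf.1.stronglyMeasurable_uncurry
  have hh : IsStronglyProgressive 𝓕 h := fun t => by
    let m : MeasurableSpace Ω := 𝓕 t
    exact ((hf.1.isStronglyProgressive t).enorm.pow_const 2).stronglyMeasurable
  have hm : ∀ ω, Measurable fun s => h s ω := fun ω =>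
    (hfm.comp_measurable measurable_prodMk_right).enorm.pow_const 2
  -- The levels tend to infinity. A path of finite total energy fails to reach all but finitely many
  -- of them, and then the hitting time is `⊤`.
  let c : ℕ → ℝ≥0∞ := fun n => n + 1
  have hc : ∀ n, c n ≠ ∞ := fun n => by simp [c]
  have hτs : ∀ n, IsStoppingTime 𝓕 (energyTime h (c n)) := fun n =>
    isStoppingTime_energyTime hh hm (hc n)
  refine ⟨fun n => energyTime h (c n), ⟨⟨hτs, ?_⟩, ?_⟩, fun n => ⟨hf.1.stopped (hτs n), ?_⟩⟩
  · filter_upwards [hf.2] with ω hω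
    obtain ⟨N, hN⟩ := ENNReal.exists_nat_gt hω.ne
    refine tendsto_const_nhds.congr' ?_
    filter_upwards [eventually_ge_atTop N] with n hn
    by_contra hne
    have h1 : energyTime h (c n) ω ≤ (⊤ : TimeInterval T) := by
      obtain ⟨b, hb⟩ := WithTop.ne_top_iff_exists.1 (Ne.symm hne)
      rw [← hb]
      exact WithTop.coe_le_coe.2 le_top
    rw [energyTime_le_iff_of_lt_top (hm ω) hω (hc n)] at h1
    have h2 : (N : ℝ≥0∞) ≤ c n := (Nat.cast_le.2 hn).trans le_self_add
    exact absurd (h2.trans (h1.trans (setLIntegral_le_lintegral _ _))) (not_le.2 hN)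
  · filter_upwards [hf.2] with ω hω
    intro m n hmn
    have hcmn : c m ≤ c n := add_le_add (Nat.cast_le.2 hmn) le_rfl
    by_cases htop : energyTime h (c n) ω = ⊤
    · simp only [htop]
      exact le_top
    obtain ⟨b, hb⟩ := WithTop.ne_top_iff_exists.1 htop
    simp only
    rw [← hb, energyTime_le_iff_of_lt_top (hm ω) hω (hc m)]
    exact hcmn.trans ((energyTime_le_iff_of_lt_top (hm ω) hω (hc n)).1 hb.ge)
  · have hle : ∀ᵐ ω ∂P, ∫⁻ s, ‖{ω | (s : WithTop (TimeInterval T)) ≤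
        energyTime h (c n) ω}.indicator (f s) ω‖ₑ ^ 2 ∂timeLeb T ≤ c n := by
      filter_upwards [hf.2] with ω hω
      refine (lintegral_mono_ae ?_).trans (lintegral_energyCut_le (fun s => h s ω) (c n))
      filter_upwards [ae_timeLeb_coe_ne (energyTime h (c n) ω)] with s hs
      by_cases hsτ : (s : WithTop (TimeInterval T)) ≤ energyTime h (c n) ω
      · have h1 := mt (energyTime_le_iff_of_lt_top (hm ω) hω (hc n)).2
          (not_le.2 (lt_of_le_of_ne hsτ hs))
        rw [indicator_of_mem (by exact hsτ), energyCut,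
          indicator_of_mem (by exact (not_le.1 h1).le)]
      · rw [indicator_of_notMem (by exact hsτ)]
        simp
    refine (lintegral_mono_ae hle).trans_lt ?_
    simp [(hc n).lt_top]

end RunningEnergy

/-! ### Cut-off integrands and restriction to events known at time zero. -/

section CutOff

variable {T : ℝ≥0} {Ω : Type*} {mΩ : MeasurableSpace Ω} {𝓕 : Filtration (TimeInterval T) mΩ}
  {P : Measure Ω}

/-- The process `f 1_{[0,τ]}`. -/
noncomputable abbrev cutOff (τ : Ω → WithTop (TimeInterval T)) (f : TimeInterval T → Ω → L2) :
    TimeInterval T → Ω → L2 :=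
  fun s => {ω | (s : WithTop (TimeInterval T)) ≤ τ ω}.indicator (f s)

theorem cutOff_of_le {τ : Ω → WithTop (TimeInterval T)} (f : TimeInterval T → Ω → L2)
    {s : TimeInterval T} {ω : Ω} (h : (s : WithTop (TimeInterval T)) ≤ τ ω) :
    cutOff τ f s ω = f s ω := indicator_of_mem (by exact h) _

theorem cutOff_of_not_le {τ : Ω → WithTop (TimeInterval T)} (f : TimeInterval T → Ω → L2)
    {s : TimeInterval T} {ω : Ω} (h : ¬ (s : WithTop (TimeInterval T)) ≤ τ ω) :
    cutOff τ f s ω = 0 := indicator_of_notMem (by exact h) _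

theorem cutOff_cutOff_comm (τ σ : Ω → WithTop (TimeInterval T)) (f : TimeInterval T → Ω → L2) :
    cutOff τ (cutOff σ f) = cutOff σ (cutOff τ f) := by
  funext s ω
  by_cases h1 : (s : WithTop (TimeInterval T)) ≤ τ ω <;>
    by_cases h2 : (s : WithTop (TimeInterval T)) ≤ σ ω <;> simp [h1, h2]

theorem cutOff_cutOff_of_le {τ σ : Ω → WithTop (TimeInterval T)} (f : TimeInterval T → Ω → L2)
    {ω : Ω} (h : τ ω ≤ σ ω) (s : TimeInterval T) : cutOff τ (cutOff σ f) s ω = cutOff τ f s ω := by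
  by_cases h1 : (s : WithTop (TimeInterval T)) ≤ τ ω
  · rw [cutOff_of_le _ h1, cutOff_of_le _ h1, cutOff_of_le _ (h1.trans h)]
  · rw [cutOff_of_not_le _ h1, cutOff_of_not_le _ h1]

theorem stopTime_top (t : TimeInterval T) : stopTime ⊤ t = t := stopTime_eq_self le_top

/-- `Locally` restricts the stopped process to the event `{⊥ < τ}`. As this event belongs to `𝓕_⊥`,
the restriction preserves martingales. -/
theorem measurableSet_bot_lt {τ : Ω → WithTop (TimeInterval T)} (hτ : IsStoppingTime 𝓕 τ) :
    MeasurableSet[𝓕 ⊥] {ω | ⊥ < τ ω} := by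
  have : {ω | ⊥ < τ ω} = {ω | τ ω ≤ (⊥ : TimeInterval T)}ᶜ := by
    ext ω
    simp only [mem_ofPred_eq, mem_compl_iff, not_le]
    rfl
  rw [this]
  exact (hτ ⊥).compl

theorem MeasureTheory.Martingale.indicator_bot [IsFiniteMeasure P] {M : TimeInterval T → Ω → ℝ}
    (hM : Martingale M 𝓕 P) {A : Set Ω} (hA : MeasurableSet[𝓕 ⊥] A) :
    Martingale (fun t => A.indicator (M t)) 𝓕 P := by
  have hAt : ∀ t, MeasurableSet[𝓕 t] A := fun t => 𝓕.mono bot_le _ hA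
  refine ⟨fun t => (hM.1 t).indicator (hAt t), fun s t hst => ?_⟩
  refine (condExp_indicator (hM.integrable t) (hAt s)).trans ?_
  filter_upwards [hM.2 s t hst] with ω hω
  by_cases h : ω ∈ A <;> simp [h, hω]

theorem IsContSqMartingale.indicator_bot [IsFiniteMeasure P] {M : TimeInterval T → Ω → ℝ}
    (hM : IsContSqMartingale 𝓕 P M) {A : Set Ω} (hA : MeasurableSet[𝓕 ⊥] A) :
    IsContSqMartingale 𝓕 P fun t => A.indicator (M t) := by
  refine ⟨hM.martingale.indicator_bot hA, fun t => (hM.memLp t).indicator (𝓕.le _ _ hA), ?_⟩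
  filter_upwards [hM.continuous] with ω hω
  by_cases h : ω ∈ A
  · simpa [h] using hω
  · simpa [h] using continuous_const

end CutOff

/-! ### The integral on `𝓐` and the weak equation. -/

namespace RandomFlow

variable {T : ℝ≥0} {Ω : Type*} [mΩ : MeasurableSpace Ω] {y : RandomFlow T Ω} {P : Measure Ω}
  {f : TimeInterval T → Ω → L2} {M N : TimeInterval T → Ω → ℝ}

theorem projectedEnergy_cutOff (y : RandomFlow T Ω) (f : TimeInterval T → Ω → L2)
    (τ : Ω → WithTop (TimeInterval T)) (t : TimeInterval T) (ω : Ω) :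
    y.projectedEnergy f (stopTime (τ ω) t) ω = y.projectedEnergy (cutOff τ f) t ω := by
  rw [projectedEnergy, projectedEnergy, ← integral_indicator measurableSet_Iic,
    ← integral_indicator measurableSet_Iic]
  congr 1
  funext s
  by_cases h1 : s ≤ t
  · rw [indicator_of_mem (mem_Iic.2 h1)]
    by_cases h2 : (s : WithTop (TimeInterval T)) ≤ τ ω
    · rw [indicator_of_mem (mem_Iic.2 (le_stopTime_iff.2 ⟨h1, h2⟩)), cutOff_of_le _ h2]
    · rw [indicator_of_notMem fun h => h2 (le_stopTime_iff.1 (mem_Iic.1 h)).2,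
        cutOff_of_not_le _ h2]
      simp
  · rw [indicator_of_notMem fun h => h1 (mem_Iic.1 h),
      indicator_of_notMem fun h => h1 (le_stopTime_iff.1 (mem_Iic.1 h)).1]

theorem IsStochasticIntegral.congr_integrand {f' : TimeInterval T → Ω → L2}
    (h : y.IsStochasticIntegral P f M) (hff' : ∀ᵐ ω ∂P, ∀ t, f t ω = f' t ω) :
    y.IsStochasticIntegral P f' M := by
  obtain ⟨hM, g, h1, h2⟩ := h
  refine ⟨hM, g, h1.congr fun n => lintegral_congr_ae ?_, h2⟩
  filter_upwards [hff'] with ω hω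
  simp only [hω]

theorem ae_integrable_sq_norm_pr (hf : MemA y.filtration P f) : ∀ᵐ ω ∂P,
    Integrable (fun s => ‖pr (y.toL2 s ω) (f s ω)‖ ^ 2) (timeLeb T) :=
  hf.2.mono fun _ hω => y.integrable_sq_norm_pr hf.1.stronglyMeasurable_uncurry hω

variable [IsProbabilityMeasure P]

theorem exists_isLocalStochasticIntegral (hy : y.IsModifiedArratiaFlow P) (hT : 0 < T)
    (hf : MemA y.filtration P f) : ∃ M, y.IsLocalStochasticIntegral P f M := by
  obtain ⟨τ, hτ, hA2⟩ := hf.exists_isLocalizingSequence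
  choose X hX hXp using fun n => exists_isStochasticIntegral hy hT (hA2 n)
  -- Consistency: cutting `f 1_{[0,τ_m]}` further at `τ_n ≤ τ_m` gives `f 1_{[0,τ_n]}`, so `X m`
  -- stopped at `τ_n` is `X n`.
  have hcons : ∀ᵐ ω ∂P, ∀ n m, n ≤ m → ∀ t, X m (stopTime (τ n ω) t) ω = X n t ω := by
    refine ae_all_iff.2 fun n => ae_all_iff.2 fun m => ?_
    by_cases hnm : n ≤ m
    · have h1 : y.IsStochasticIntegral P (cutOff (τ n) (cutOff (τ m) f)) (X n) := by
        refine (hX n).congr_integrand ?_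
        filter_upwards [hτ.mono] with ω hω t
        exact (cutOff_cutOff_of_le f (hω hnm) t).symm
      filter_upwards [(hX m).ae_stoppedProcess_eq hy hT (hA2 m) (hτ.isStoppingTime n) h1]
        with ω hω _ t using hω t
    · exact Eventually.of_forall fun ω h => absurd h hnm
  have hMp : IsStronglyProgressive y.filtration fun t ω => limUnder atTop fun n => X n t ω :=
    IsStronglyProgressive.limUnder hXp
  refine ⟨fun t ω => limUnder atTop fun n => X n t ω, hMp.stronglyAdapted, τ, hτ, fun n =>
    ⟨hA2 n, (hX n).congr (hMp.stronglyAdapted_stoppedProcess (hτ.isStoppingTime n)) ?_⟩⟩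
  filter_upwards [hcons, hτ.tendsto_top] with ω h1 h2 t
  -- Once `τ N = ⊤`, consistency makes `X m` independent of `m ≥ N`, so the limit is attained along
  -- the path.
  obtain ⟨N, hN⟩ := (eventually_eq_top_of_tendsto h2).exists
  rw [stoppedProcess_eq_stopTime]
  have hconst : ∀ r, ∀ m ≥ N, X m r ω = X N r ω := fun r m hm => by
    rw [← h1 N m hm r, hN, stopTime_top]
  have hlim : ∀ r, Tendsto (fun m => X m r ω) atTop (𝓝 (X N r ω)) := fun r =>
    tendsto_const_nhds.congr' ((eventually_ge_atTop N).mono fun m hm => (hconst r m hm).symm)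
  rw [(hlim _).limUnder_eq, ← hconst _ (max n N) (le_max_right _ _), h1 n _ (le_max_left _ _)]

/-- The two integrals may come with different localizing sequences. Stopping each one also along the
other sequence gives, for each `n`, two integrals of the same doubly cut-off integrand, and both
stopping times are eventually `⊤`. -/
theorem IsLocalStochasticIntegral.ae_eq (hy : y.IsModifiedArratiaFlow P) (hT : 0 < T)
    (hM : y.IsLocalStochasticIntegral P f M) (hN : y.IsLocalStochasticIntegral P f N) :
    ∀ᵐ ω ∂P, ∀ t, M t ω = N t ω := by
  obtain ⟨-, τ, hτ, hτM⟩ := hM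
  obtain ⟨-, σ, hσ, hσN⟩ := hN
  have key : ∀ n, ∀ᵐ ω ∂P, ∀ t, M (stopTime (τ n ω) (stopTime (σ n ω) t)) ω =
      N (stopTime (σ n ω) (stopTime (τ n ω) t)) ω := fun n => by
    have hA2 : MemA2 y.filtration P (cutOff (σ n) (cutOff (τ n) f)) :=
      (hτM n).1.stopped (hσ.isStoppingTime n)
    obtain ⟨W, hW, -⟩ := exists_isStochasticIntegral hy hT hA2
    have hW' : y.IsStochasticIntegral P (cutOff (τ n) (cutOff (σ n) f)) W := by
      rw [cutOff_cutOff_comm]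
      exact hW
    filter_upwards [(hτM n).2.ae_stoppedProcess_eq hy hT (hτM n).1 (hσ.isStoppingTime n) hW,
      (hσN n).2.ae_stoppedProcess_eq hy hT (hσN n).1 (hτ.isStoppingTime n) hW'] with ω h1 h2 t
    exact (h1 t).trans (h2 t).symm
  filter_upwards [ae_all_iff.2 key, hτ.tendsto_top, hσ.tendsto_top] with ω h1 h2 h3 t
  obtain ⟨n, hn, hn'⟩ := ((eventually_eq_top_of_tendsto h2).and
    (eventually_eq_top_of_tendsto h3)).exists
  simpa [hn, hn', stopTime_top] using h1 n t

theorem IsLocalStochasticIntegral.isContLocalSqMartingale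
    (hM : y.IsLocalStochasticIntegral P f M) : IsContLocalSqMartingale y.filtration P M := by
  obtain ⟨hadp, τ, hτ, hτM⟩ := hM
  refine ⟨hadp, ?_, τ, hτ, fun n => ?_⟩
  · filter_upwards [ae_all_iff.2 fun n => (hτM n).2.1.continuous, hτ.tendsto_top] with ω h1 h2
    obtain ⟨n, hn⟩ := (eventually_eq_top_of_tendsto h2).exists
    have h3 := h1 n
    simp only [stoppedProcess_eq_stopTime, hn, stopTime_top] at h3
    exact h3
  · exact (hτM n).2.1.indicator_bot (measurableSet_bot_lt (hτ.isStoppingTime n))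

theorem IsLocalStochasticIntegral.isLocalQuadraticVariation (hy : y.IsModifiedArratiaFlow P)
    (hT : 0 < T) (hf : MemA y.filtration P f) (hM : y.IsLocalStochasticIntegral P f M) :
    IsLocalQuadraticVariation y.filtration P M (y.projectedEnergy f) := by
  obtain ⟨hadp, τ, hτ, hτM⟩ := hM
  refine ⟨y.stronglyAdapted_projectedEnergy hf.1, Eventually.of_forall fun ω => setIntegral_Iic_bot _,
    (ae_integrable_sq_norm_pr hf).mono fun ω hω => continuous_setIntegral_Iic hω,
    (ae_integrable_sq_norm_pr hf).mono fun ω hω => monotone_setIntegral_Iic hω fun _ => sq_nonneg _,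
    τ, hτ, fun n => ?_⟩
  have h1 := ((hτM n).2.isQuadraticVariation hy hT (hτM n).1).martingale.indicator_bot
    (measurableSet_bot_lt (hτ.isStoppingTime n))
  have h2 : (fun t => {ω | ⊥ < τ n ω}.indicator fun ω => stoppedProcess M (τ n) t ω ^ 2 -
      y.projectedEnergy (cutOff (τ n) f) t ω) = stoppedProcess (fun t => {ω | ⊥ < τ n ω}.indicator
        fun ω => M t ω ^ 2 - y.projectedEnergy f t ω) (τ n) := by
    funext t ω
    rw [stoppedProcess_eq_stopTime]
    by_cases hω : ω ∈ {ω | ⊥ < τ n ω}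
    · rw [indicator_of_mem hω, indicator_of_mem hω, projectedEnergy_cutOff,
        stoppedProcess_eq_stopTime]
    · rw [indicator_of_notMem hω, indicator_of_notMem hω]
  exact h2 ▸ h1

/-- The initial condition holds almost surely for each `u`; Fubini gives it almost surely for almost
every `u`, which suffices in L₂. -/
theorem IsModifiedArratiaFlow.ae_toL2_bot_eq (hy : y.IsModifiedArratiaFlow P) :
    ∀ᵐ ω ∂P, y.toL2 ⊥ ω = idL2 := by
  have h1 : ∀ᵐ ω ∂P, ∀ᵐ u : unitInterval, y.path ω u ⊥ = u := by
    rw [Measure.ae_ae_comm]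
    · exact Eventually.of_forall hy.initial
    · exact measurableSet_eq_fun ((y.measurable_path_at ⊥).comp measurable_swap)
        (measurable_subtype_coe.comp measurable_snd)
  filter_upwards [h1] with ω hω
  refine Lp.ext ?_
  have h2 : (idL2 : unitInterval → ℝ) =ᵐ[volume] fun u => (u : ℝ) :=
    ContinuousMap.coeFn_toLp volume _
  filter_upwards [hω, h2, y.coeFn_toL2 ⊥ ω] with u h3 h4 h5
  rw [h5, h3, h4]

theorem IsModifiedArratiaFlow.hasEnergy_inner (hy : y.IsModifiedArratiaFlow P) (g : L2) :
    y.HasEnergy P (fun _ _ => g) fun t ω => inner ℝ g (y.toL2 t ω) := by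
  intro s t hst B hB
  have hM := hy.isContSqMartingale_inner g
  rw [hM.martingale.setLIntegral_sq_eq_add hM.memLp hst hB,
    ← hy.setLIntegral_sq_inner_increment hst (φ := fun _ => g) stronglyMeasurable_const hB]
  simp_rw [inner_sub_right]

theorem memA2_const (y : RandomFlow T Ω) (g : L2) : MemA2 y.filtration P fun _ _ => g := by
  refine ⟨stronglyMeasurable_const, ?_⟩
  simp only [sqNormA2, lintegral_const]
  exact ENNReal.mul_lt_top (ENNReal.mul_lt_top (ENNReal.pow_lt_top enorm_lt_top)
    (measure_lt_top _ _)) (measure_lt_top _ _)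

/-- The adjoint in the equation disappears because `pr` is self-adjoint. What remains is the energy
identity for the constant integrand `g`. -/
theorem IsModifiedArratiaFlow.isWeakMartingaleSolution (hy : y.IsModifiedArratiaFlow P) :
    IsWeakMartingaleSolution y.filtration P pr idL2 y.toL2 := by
  refine ⟨y.stronglyAdapted_toL2, Eventually.of_forall y.continuous_toL2, hy.ae_toL2_bot_eq,
    hy.isContSqMartingale_inner, fun g => ?_, fun g => ?_⟩
  · simp_rw [adjoint_pr]
    exact (ae_lintegral_lt_top_of_memA2 (y.memA2_const g)).mono fun ω hω =>
      y.integrable_sq_norm_pr (f := fun _ _ => g) stronglyMeasurable_const hω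
  · simp_rw [adjoint_pr]
    exact (hy.hasEnergy_inner g).isQuadraticVariation (hy.isContSqMartingale_inner g)
      (y.memA2_const g)

end RandomFlow

theorem mainTheorem4 {T : ℝ≥0} (hT : 0 < T) {Ω : Type*} [MeasurableSpace Ω] (P : Measure Ω)
    [IsProbabilityMeasure P] (y : RandomFlow T Ω) (hy : y.IsModifiedArratiaFlow P) :
    -- simple integrands
    (∀ f : SimpleIntegrand y.filtration P,
      MemA2 y.filtration P f.process ∧
      IsContSqMartingale y.filtration P (y.simpleIntegral f) ∧
      IsQuadraticVariation y.filtration P (y.simpleIntegral f) (y.projectedEnergy f.process)) ∧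
    -- predictable integrands with `E ∫ ‖f‖² < ∞`
    (∀ f : TimeInterval T → Ω → L2, MemA2 y.filtration P f →
      (∃ M, y.IsStochasticIntegral P f M) ∧
      (∀ M N, y.IsStochasticIntegral P f M → y.IsStochasticIntegral P f N →
        ∀ᵐ ω ∂P, ∀ t, M t ω = N t ω) ∧
      (∀ M, y.IsStochasticIntegral P f M →
        IsQuadraticVariation y.filtration P M (y.projectedEnergy f))) ∧
    -- predictable integrands with `∫ ‖f‖² < ∞` almost surely
    (∀ f : TimeInterval T → Ω → L2, MemA y.filtration P f →
      (∀ᵐ ω ∂P, Integrable (fun s => ‖pr (y.toL2 s ω) (f s ω)‖ ^ 2) (timeLeb T)) ∧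
      (∃ M, y.IsLocalStochasticIntegral P f M) ∧
      (∀ M N, y.IsLocalStochasticIntegral P f M → y.IsLocalStochasticIntegral P f N →
        ∀ᵐ ω ∂P, ∀ t, M t ω = N t ω) ∧
      (∀ M, y.IsLocalStochasticIntegral P f M →
        IsContLocalSqMartingale y.filtration P M ∧
        IsLocalQuadraticVariation y.filtration P M (y.projectedEnergy f))) ∧
    -- the flow is a weak solution of `dy = pr_y dW`, `y(0) = id`
    IsWeakMartingaleSolution y.filtration P pr idL2 y.toL2 := by
  refine ⟨fun f => ⟨f.memA2 hT, (y.isStepIntegral_simpleIntegral f).isContSqMartingale hy,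
    y.isQuadraticVariation_simpleIntegral hy hT f⟩, fun f hf => ⟨?_, fun M N hM hN =>
    hM.ae_eq hy hT hf hN, fun M hM => hM.isQuadraticVariation hy hT hf⟩, fun f hf =>
    ⟨RandomFlow.ae_integrable_sq_norm_pr hf, RandomFlow.exists_isLocalStochasticIntegral hy hT hf,
    fun M N hM hN => hM.ae_eq hy hT hN, fun M hM => ⟨hM.isContLocalSqMartingale,
    hM.isLocalQuadraticVariation hy hT hf⟩⟩, hy.isWeakMartingaleSolution⟩
  obtain ⟨M, hM, -⟩ := RandomFlow.exists_isStochasticIntegral hy hT hf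
  exact ⟨M, hM⟩
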